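/- **Setting.** Let $\mathfrak g$ be a finite-dimensional simple complex Lie algebra, $\mathfrak h\subset\mathfrak g$ a Cartan subalgebra, $i:\mathfrak h\to\mathfrak g$ the inclusion, and $\Omega\in(S^2\mathfrak g)^{\mathfrak g}$ the Casimir element of the Killing form. A *classical dynamical $r$-matrix with spectral parameter* is a meromorphic function $r:\mathfrak h^*\times\mathbb C\to\mathfrak g\otimes\mathfrak g$ such that, as identities of meromorphic functions, (a) $[x\otimes1+1\otimes x,\,r(q,z)]=0$ for $x\in\mathfrak h$; (b) $r(q,z)+r^{21}(q,-z)=0$; (c) $r(q,\cdot)$ has a simple pole at $z=0$ with residue $\Omega$; (d) with $z_{ij}=z_i-z_j$, a basis $(x_k)$ of $\mathfrak h$ and the corresponding coordinates on $\mathfrak h^*$, $$\sum_k\Big(x_k^{(1)}\partial_k r^{23}(q,z_{23})-x_k^{(2)}\partial_k r^{13}(q,z_{13})+x_k^{(3)}\partial_k r^{12}(q,z_{12})\Big)+[r^{12}(q,z_{12}),r^{13}(q,z_{13})]+[r^{12}(q,z_{12}),r^{23}(q,z_{23})]+[r^{13}(q,z_{13}),r^{23}(q,z_{23})]=0 .$$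 Let $U\subset\mathfrak h^*$ be the open set of those $q$ such that, for all $q'$ near $q$, $r(q',\cdot)$ has no poles in a common punctured disc around $0$. For a finite-dimensional complex vector space $V$ let $LV$ be the space of Laurent series $\sum_{n\ge -N}v_nz^n$ with $v_n\in V$, convergent in some annulus $0<|z|<\rho$ ($N$ and $\rho$ may depend on the series). $L\mathfrak g$ is a Lie algebra with the pointwise bracket; its restricted dual is $L\mathfrak g^*:=L(\mathfrak g^*)$, with the pairing $\langle M,Y\rangle=\operatorname{Res}_{z=0}\langle M(z),Y(z)\rangle\,dz$. For $M\in L\mathfrak g^*$ and small $z\ne0$ put $$(R_qM)(z)=\mathrm{p.v.}\,\frac1{2\pi i}\oint_{|w|=|z|}\langle M(w)\otimes 1,\ r(q,w-z)\rangle\,dw\in\mathfrak g .$$ Write $\mathcal X_a$ for the derivative with respect to $q$ along the constant vector field $a\in\mathfrak h^*$. On $T^*\mathfrak h^*\times\mathfrak g^*=\mathfrak h^*\times\mathfrak h\times\mathfrak g^*\ni(q,p,\xi)$ take the product of the canonical Poisson structure, normalized by $\{p_i,q_j\}=\delta_{ij}$, and the Lie–Poisson structure $\{a,b\}(\xi)=\langle\xi,[a,b]\rangle$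 ($a,b\in\mathfrak g$); the flow of a Hamiltonian $F$ is given by $\frac{d}{dt}G(\phi_t)=\{G,F\}(\phi_t)$. Let $$L(q,p,\xi)(z)=p+(r_-^\#(q)\xi)(z),\qquad \langle\eta,(r_-^\#(q)\xi)(z)\rangle=\langle\eta\otimes\xi,\ r(q,z)\rangle\quad(\eta\in\mathfrak g^*).$$ **Theorem A.** Let $r$ be a classical dynamical $r$-matrix with spectral parameter. (1) For $q\in U$ the function $L(q,p,\xi)$ is an element of $L\mathfrak g$: its Laurent expansion at $0$ converges to it in $0<|z|<\rho$ whenever $r(q,\cdot)$ has no pole there. At all points at which the values of $r$ that occur are regular, with $L_1=L\otimes 1$, $L_2=1\otimes L$, $$\begin{aligned}\{L_1(z),L_2(w)\}&=-[r^{12}(q,z-w),L_1(z)]+[r^{21}(q,w-z),L_2(w)]-\mathcal X_{i^*\xi}r(q,z-w)\\&=-[r^{12}(q,z-w),\,L_1(z)+L_2(w)]-\mathcal X_{i^*\xi}r(q,z-w).\end{aligned}$$ (2) Let $f:L\mathfrak g\to\mathbb C$ be smooth in the complex sense (i.e. smooth on each of the Banach spaces $\{\sum_{k\ge-N}v_kz^k:\sum_k\|v_k\|\rho^{k}<\infty\}$,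 of which $L\mathfrak g$ is the inductive limit), with differential $df(X)\in L\mathfrak g^*$ for every $X\in L\mathfrak g$, and ad-invariant: $\langle df(X),[Y,X]\rangle=0$ for all $X,Y\in L\mathfrak g$. Then $L^*f=f\circ L$ is differentiable on $U\times\mathfrak h\times\mathfrak g^*$, and along every integral curve $\phi_t=(q_t,p_t,\xi_t)$ of its Hamiltonian flow in this set, $t\mapsto L(\phi_t)\in L\mathfrak g$ is differentiable and $$\frac{d}{dt}L(\phi_t)=\big[R_{q_t}(df(L(\phi_t))),\,L(\phi_t)\big]+(\mathcal X_{i^*\xi_t}R)_{q_t}\big(df(L(\phi_t))\big),$$ where in the last term $R_q$ is differentiated with respect to $q$ with its argument $df(L(\phi_t))$ held fixed. This holds at every $z$ with $0<|z|<\rho$ whenever $r(q_t,\cdot)$ has no pole in $0<|\zeta|<2\rho$ and the series $df(L(\phi_t))$ converges in $0<|w|<\rho$; there, in particular, the principal value and its derivative exist. -/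

import Mathlib

open Filter Topology
open scoped TensorProduct ContDiff

/-! ## Linear coordinates

Analysis on finite-dimensional complex vector spaces is done in linear coordinates. The notions
defined this way do not depend on the choice of the basis. -/

section Coordinates

variable (V : Type*) [AddCommGroup V] [Module ℂ V] [FiniteDimensional ℂ V]

/-- The coordinates of the vectors of `V` in a fixed basis. -/
noncomputable def coords : V ≃ₗ[ℂ] (Fin (Module.finrank ℂ V) → ℂ) :=
  (Module.finBasis ℂ V).equivFun

variable {V}
variable {W : Type*} [AddCommGroup W] [Module ℂ W] [FiniteDimensional ℂ W]

/-- The function `F : V → W`, written in coordinates. -/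
noncomputable def inCoords (F : V → W) :
    (Fin (Module.finrank ℂ V) → ℂ) → (Fin (Module.finrank ℂ W) → ℂ) :=
  fun c => coords W (F ((coords V).symm c))

/-- `F` is holomorphic (analytic) at `x`. -/
def HolAt (F : V → W) (x : V) : Prop := AnalyticAt ℂ (inCoords F) (coords V x)

/-- A meromorphic function: near each point a quotient of holomorphic functions. Its values on the
zero set of the denominator are irrelevant; its regular points are those at which it is
holomorphic. -/
def IsMeromorphicFun (F : V → W) : Prop :=
  ∀ x : V, ∃ (N : V → W) (d : V → ℂ), HolAt N x ∧ HolAt d x ∧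
    (¬ ∀ᶠ c in 𝓝 (coords V x), d ((coords V).symm c) = 0) ∧
    ∀ᶠ c in 𝓝 (coords V x), d ((coords V).symm c) ≠ 0 →
      F ((coords V).symm c) = (d ((coords V).symm c))⁻¹ • N ((coords V).symm c)

/-- The derivative at `0` of a curve in `V` with a complex parameter. -/
noncomputable def derivZero (c : ℂ → V) : V :=
  (coords V).symm (deriv (fun s => coords V (c s)) 0)

end Coordinates

/-! ## Convergent Laurent series -/

section Loops

variable (V : Type*) [AddCommGroup V] [Module ℂ V] [FiniteDimensional ℂ V]

variable {V} in
/-- The Laurent series `∑ c n z ^ n` converges (absolutely) in the annulus `0 < |z| < ρ`. -/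
def ConvergesOn (c : ℤ → V) (ρ : ℝ) : Prop :=
  ∀ s : ℝ, 0 < s → s < ρ → Summable fun n : ℤ => ‖coords V (c n)‖ * s ^ n

/-- The space `LV` of Laurent series `∑_{n ≥ -N} c n z ^ n` with coefficients in `V` which
converge in some annulus `0 < |z| < ρ`; `N` and `ρ` may depend on the series. -/
def loopSubmodule : Submodule ℂ (ℤ → V) where
  carrier := {c | (∃ N : ℤ, ∀ n < N, c n = 0) ∧ ∃ ρ : ℝ, 0 < ρ ∧ ConvergesOn c ρ}
  zero_mem' := ⟨⟨0, fun _ _ => rfl⟩, 1, one_pos, fun s _ _ => by simp⟩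
  add_mem' := by
    rintro a b ⟨⟨N, hN⟩, ρ, hρ, ha⟩ ⟨⟨M, hM⟩, σ, hσ, hb⟩
    refine ⟨⟨min N M, fun n hn => ?_⟩, min ρ σ, lt_min hρ hσ, fun s hs hsm => ?_⟩
    · simp [hN n (lt_of_lt_of_le hn (min_le_left _ _)),
        hM n (lt_of_lt_of_le hn (min_le_right _ _))]
    · refine Summable.of_nonneg_of_le (fun n => by positivity) (fun n => ?_)
        ((ha s hs (lt_of_lt_of_le hsm (min_le_left _ _))).add
          (hb s hs (lt_of_lt_of_le hsm (min_le_right _ _))))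
      rw [← add_mul, Pi.add_apply, map_add]
      exact mul_le_mul_of_nonneg_right (norm_add_le _ _) (by positivity)
  smul_mem' := by
    rintro k a ⟨⟨N, hN⟩, ρ, hρ, ha⟩
    refine ⟨⟨N, fun n hn => by simp [hN n hn]⟩, ρ, hρ, fun s hs hsm => ?_⟩
    simpa [norm_smul, mul_assoc] using (ha s hs hsm).mul_left ‖k‖

abbrev Loop : Type _ := loopSubmodule V

variable {V}

/-- The Laurent series `X` converges at `z`, with sum `v`. -/
def Loop.HasValue (X : Loop V) (z : ℂ) (v : V) : Prop :=
  HasSum (fun n : ℤ => z ^ n • coords V (X.1 n)) (coords V v)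

/-- The value at `z` of a Laurent series. -/
noncomputable def Loop.eval (X : Loop V) (z : ℂ) : V :=
  (coords V).symm (∑' n : ℤ, z ^ n • coords V (X.1 n))

open Classical in
/-- The Laurent expansion at `0` of a function (and `0` if there is none in `LV`). -/
noncomputable def Loop.ofFun (F : ℂ → V) : Loop V :=
  if h : ∃ X : Loop V, ∀ᶠ z in 𝓝[≠] (0 : ℂ), X.HasValue z (F z) then h.choose else 0

variable (V) in
/-- The Banach space `ℓ¹(ℕ, V)`, with the vectors of `V` given by their coordinates. -/
abbrev SeqSpace : Type := lp (fun _ : ℕ => Fin (Module.finrank ℂ V) → ℂ) 1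

theorem Loop.step_mem (N : ℕ) {ρ : ℝ} (hρ : 0 < ρ) (x : SeqSpace V) :
    (fun k : ℤ => if -(N : ℤ) ≤ k then
      ((ρ : ℂ) ^ (k + N))⁻¹ • (coords V).symm (x (k + N).toNat) else 0) ∈ loopSubmodule V := by
  refine ⟨⟨-(N : ℤ), fun n hn => if_neg (not_le.mpr hn)⟩, ρ, hρ, fun s hs hsρ => ?_⟩
  have h1 : Summable fun n : ℕ => ‖x n‖ := by
    simpa using (lp.memℓp x).summable (by norm_num)
  have h2 : Summable fun n : ℕ => s ^ (-(N : ℤ)) * ‖x n‖ := h1.mul_left _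
  have hinj : Function.Injective fun n : ℕ => (n : ℤ) - N := fun a b h => by
    simpa using h
  rw [← hinj.summable_iff]
  · refine Summable.of_nonneg_of_le (fun n => mul_nonneg (norm_nonneg _) (by positivity))
      (fun n => ?_) h2
    have hn : -(N : ℤ) ≤ (n : ℤ) - N := by omega
    simp only [Function.comp, if_pos hn, sub_add_cancel, Int.toNat_natCast, map_smul,
      LinearEquiv.apply_symm_apply, norm_smul, norm_inv,
      norm_zpow, Complex.norm_real, Real.norm_of_nonneg hρ.le]
    have h3 : s ^ ((n : ℤ) - N) = s ^ n * s ^ (-(N : ℤ)) := by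
      rw [sub_eq_add_neg, zpow_add₀ hs.ne', zpow_natCast]
    have h4 : (ρ ^ (n : ℤ))⁻¹ * s ^ n ≤ 1 := by
      rw [zpow_natCast, inv_mul_le_iff₀ (by positivity), mul_one]
      exact pow_le_pow_left₀ hs.le hsρ.le n
    rw [h3]
    calc (ρ ^ (n : ℤ))⁻¹ * ‖x n‖ * (s ^ n * s ^ (-(N : ℤ)))
        = ((ρ ^ (n : ℤ))⁻¹ * s ^ n) * (s ^ (-(N : ℤ)) * ‖x n‖) := by ring
      _ ≤ 1 * (s ^ (-(N : ℤ)) * ‖x n‖) := by gcongr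
      _ = _ := one_mul _
  · intro k hk
    have : ¬ -(N : ℤ) ≤ k := fun h => hk ⟨(k + N).toNat, by simp; omega⟩
    simp [if_neg this]

/-- `LV` is the increasing union of the Banach spaces of the series `∑_{k ≥ -N} c k z ^ k` with
`∑ ‖c k‖ ρ ^ (k + N) < ∞`, for `N` in `ℕ` and `ρ > 0`. This is the inclusion of such a space, which
is identified with `ℓ¹(ℕ, V)` by `x n = ρ ^ n c (n - N)`. -/
noncomputable def Loop.step (N : ℕ) {ρ : ℝ} (hρ : 0 < ρ) (x : SeqSpace V) : Loop V :=
  ⟨fun k : ℤ => if -(N : ℤ) ≤ k then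
      ((ρ : ℂ) ^ (k + N))⁻¹ • (coords V).symm (x (k + N).toNat) else 0,
    Loop.step_mem N hρ x⟩

/-- Smoothness of a function on `LV`, an inductive limit of Banach spaces with compact connecting
maps: smoothness on every step. -/
def Loop.Smooth (f : Loop V → ℂ) : Prop :=
  ∀ (N : ℕ) (ρ : ℝ) (hρ : 0 < ρ), ContDiff ℂ ∞ fun x : SeqSpace V => f (Loop.step N hρ x)

/-- The curve `c` in `LV` has derivative `c'` at `t`: near `t` it is a curve in one of the steps,
differentiable there with derivative `c'`. -/
def Loop.HasDerivAtLoop (c : ℝ → Loop V) (c' : Loop V) (t : ℝ) : Prop :=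
  ∃ (N : ℕ) (ρ : ℝ) (hρ : 0 < ρ) (γ : ℝ → SeqSpace V) (γ' : SeqSpace V),
    (∀ᶠ s in 𝓝 t, Loop.step N hρ (γ s) = c s) ∧ Loop.step N hρ γ' = c' ∧ HasDerivAt γ γ' t

/-- The pairing `⟨M, Y⟩ = ∮ ⟨M(z), Y(z)⟩ dz / (2 π i) = Res_{z = 0} ⟨M(z), Y(z)⟩ dz` of the
restricted dual `LV* = L(V*)` with `LV`; the sum has finitely many nonzero terms. -/
noncomputable def Loop.pairing (M : Loop (Module.Dual ℂ V)) (Y : Loop V) : ℂ :=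
  ∑ᶠ n : ℤ, M.1 (-1 - n) (Y.1 n)

/-- `df X` in the restricted dual is the differential of `f` at `X`, for all `X` in `LV`. -/
def Loop.IsDifferential (f : Loop V → ℂ) (df : Loop V → Loop (Module.Dual ℂ V)) : Prop :=
  ∀ X Y : Loop V, HasDerivAt (fun s : ℂ => f (X + s • Y)) (Loop.pairing (df X) Y) 0

end Loops

section LieAlgebra

variable {g : Type*} [LieRing g] [LieAlgebra ℂ g] [FiniteDimensional ℂ g]

theorem exists_norm_coords_lie_le : ∃ K : ℝ, 0 ≤ K ∧
    ∀ x y : g, ‖coords g ⁅x, y⁆‖ ≤ K * (‖coords g x‖ * ‖coords g y‖) := by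
  refine ⟨∑ i, ∑ j, ‖coords g ⁅Module.finBasis ℂ g i, Module.finBasis ℂ g j⁆‖,
    Finset.sum_nonneg fun _ _ => Finset.sum_nonneg fun _ _ => norm_nonneg _, fun x y => ?_⟩
  have hexp : ∀ v : g, v = ∑ i, coords g v i • Module.finBasis ℂ g i := fun v =>
    ((Module.finBasis ℂ g).sum_equivFun v).symm
  have h : coords g ⁅x, y⁆ = ∑ i, ∑ j, (coords g x i * coords g y j) •
      coords g ⁅Module.finBasis ℂ g i, Module.finBasis ℂ g j⁆ := by
    conv_lhs => rw [hexp x, hexp y]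
    simp only [sum_lie, lie_sum, smul_lie, lie_smul, map_sum, map_smul, smul_smul, Finset.smul_sum]
    rw [Finset.sum_comm]
    simp only [mul_comm]
  rw [h, Finset.sum_mul]
  refine (norm_sum_le _ _).trans (Finset.sum_le_sum fun i _ => ?_)
  rw [Finset.sum_mul]
  refine (norm_sum_le _ _).trans (Finset.sum_le_sum fun j _ => ?_)
  rw [norm_smul, norm_mul, mul_comm]
  gcongr
  · exact norm_le_pi_norm (coords g x) i
  · exact norm_le_pi_norm (coords g y) j

theorem Loop.lie_mem (X Y : Loop g) :
    (fun n : ℤ => ∑ᶠ i : ℤ, ⁅X.1 i, Y.1 (n - i)⁆) ∈ loopSubmodule g := by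
  obtain ⟨X, ⟨N, hN⟩, ρ, hρ, hX⟩ := X
  obtain ⟨Y, ⟨M, hM⟩, σ, hσ, hY⟩ := Y
  obtain ⟨K, hK, hlie⟩ := exists_norm_coords_lie_le (g := g)
  refine ⟨⟨N + M, fun n hn => ?_⟩, min ρ σ, lt_min hρ hσ, fun s hs hsm => ?_⟩
  · refine (finsum_congr fun i => ?_).trans finsum_zero
    rcases lt_or_ge i N with h | h
    · simp [hN i h]
    · simp [hM (n - i) (by omega)]
  · have hx := hX s hs (lt_of_lt_of_le hsm (min_le_left _ _))
    have hy := hY s hs (lt_of_lt_of_le hsm (min_le_right _ _))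
    have hxy := hx.mul_of_nonneg hy (fun n => by positivity) (fun n => by positivity)
    let e : ℤ × ℤ ≃ ℤ × ℤ :=
      ⟨fun p => (p.2, p.1 - p.2), fun p => (p.1 + p.2, p.1), fun p => by simp, fun p => by simp⟩
    have hxy' : Summable fun p : ℤ × ℤ => (‖coords g (X p.2)‖ * s ^ p.2) *
        (‖coords g (Y (p.1 - p.2))‖ * s ^ (p.1 - p.2)) :=
      (e.summable_iff (f := fun p : ℤ × ℤ =>
        (‖coords g (X p.1)‖ * s ^ p.1) * (‖coords g (Y p.2)‖ * s ^ p.2))).mpr hxy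
    have hK' := hxy'.mul_left K
    refine Summable.of_nonneg_of_le (fun n => by positivity) (fun n => ?_) hK'.prod
    have hn : ∀ i : ℤ, ‖coords g ⁅X i, Y (n - i)⁆‖ * s ^ n ≤
        K * ((‖coords g (X i)‖ * s ^ i) * (‖coords g (Y (n - i))‖ * s ^ (n - i))) := fun i => by
      have h1 : s ^ n = s ^ i * s ^ (n - i) := by
        rw [← zpow_add₀ hs.ne']; congr 1; ring
      calc ‖coords g ⁅X i, Y (n - i)⁆‖ * s ^ n
          ≤ K * (‖coords g (X i)‖ * ‖coords g (Y (n - i))‖) * s ^ n := by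
            gcongr; exact hlie _ _
        _ = _ := by rw [h1]; ring
    have hfib : Summable fun i : ℤ =>
        K * ((‖coords g (X i)‖ * s ^ i) * (‖coords g (Y (n - i))‖ * s ^ (n - i))) :=
      hK'.prod_factor n
    have hs1 : Summable fun i : ℤ => ‖coords g ⁅X i, Y (n - i)⁆‖ * s ^ n :=
      Summable.of_nonneg_of_le (fun i => by positivity) hn hfib
    have hs2 : Summable fun i : ℤ => ‖coords g ⁅X i, Y (n - i)⁆‖ :=
      (summable_mul_right_iff (by positivity : s ^ n ≠ 0)).mp hs1
    have hfin : (Function.support fun i : ℤ => ⁅X i, Y (n - i)⁆).Finite := by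
      refine (Set.finite_Icc N (n - M)).subset fun i hi => ?_
      by_contra hcon
      rw [Set.mem_Icc, not_and_or, not_le, not_le] at hcon
      refine hi ?_
      rcases hcon with h | h
      · simp [hN i h]
      · simp [hM (n - i) (by omega)]
    have hsum : coords g (∑ᶠ i : ℤ, ⁅X i, Y (n - i)⁆) = ∑' i : ℤ, coords g ⁅X i, Y (n - i)⁆ := by
      rw [tsum_eq_finsum (hfin.subset fun i hi h => hi (by simp [h]))]
      exact (coords g).toLinearMap.toAddMonoidHom.map_finsum hfin
    calc ‖coords g (∑ᶠ i : ℤ, ⁅X i, Y (n - i)⁆)‖ * s ^ n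
        ≤ (∑' i : ℤ, ‖coords g ⁅X i, Y (n - i)⁆‖) * s ^ n := by
          rw [hsum]; gcongr; exact norm_tsum_le_tsum_norm hs2
      _ = ∑' i : ℤ, ‖coords g ⁅X i, Y (n - i)⁆‖ * s ^ n := tsum_mul_right.symm
      _ ≤ _ := hs1.tsum_le_tsum hn hfib

/-- The bracket of the loop algebra `Lg`, `[X, Y](z) = [X(z), Y(z)]`, in terms of the
coefficients. -/
noncomputable instance Loop.instBracket : Bracket (Loop g) (Loop g) where
  bracket X Y := ⟨fun n : ℤ => ∑ᶠ i : ℤ, ⁅X.1 i, Y.1 (n - i)⁆, Loop.lie_mem X Y⟩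

/-- A function on `Lg` with differential `df` is ad-invariant if `⟨df(X), [Y, X]⟩ = 0` for all
`X`, `Y` in `Lg`. -/
def Loop.AdInvariant (df : Loop g → Loop (Module.Dual ℂ g)) : Prop :=
  ∀ X Y : Loop g, Loop.pairing (df X) ⁅Y, X⁆ = 0

/-! ## Tensors -/

/-- `a ⊗ b ↦ ξ(a) b`. -/
noncomputable def contrFst (ξ : Module.Dual ℂ g) : g ⊗[ℂ] g →ₗ[ℂ] g :=
  (TensorProduct.lid ℂ g).toLinearMap ∘ₗ LinearMap.rTensor g ξ

/-- `a ⊗ b ↦ ξ(b) a`. -/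
noncomputable def contrSnd (ξ : Module.Dual ℂ g) : g ⊗[ℂ] g →ₗ[ℂ] g :=
  (TensorProduct.rid ℂ g).toLinearMap ∘ₗ LinearMap.lTensor g ξ

/-- `s²¹`, i.e. `a ⊗ b ↦ b ⊗ a`. -/
noncomputable def flipTensor (s : g ⊗[ℂ] g) : g ⊗[ℂ] g := TensorProduct.comm ℂ g g s

/-- `[s, X₁] = [s, X ⊗ 1]`, i.e. `a ⊗ b ↦ [a, X] ⊗ b`. -/
noncomputable def lieSlotOne (s : g ⊗[ℂ] g) (X : g) : g ⊗[ℂ] g :=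
  -LinearMap.rTensor g (LieAlgebra.ad ℂ g X : g →ₗ[ℂ] g) s

/-- `[s, X₂] = [s, 1 ⊗ X]`, i.e. `a ⊗ b ↦ a ⊗ [b, X]`. -/
noncomputable def lieSlotTwo (s : g ⊗[ℂ] g) (X : g) : g ⊗[ℂ] g :=
  -LinearMap.lTensor g (LieAlgebra.ad ℂ g X : g →ₗ[ℂ] g) s

/-- `[s¹², t¹³]`: `(a ⊗ b, c ⊗ d) ↦ [a, c] ⊗ b ⊗ d`. -/
noncomputable def lie1213 (s t : g ⊗[ℂ] g) : g ⊗[ℂ] (g ⊗[ℂ] g) :=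
  TensorProduct.map₂ (LieModule.toEnd ℂ g g : g →ₗ[ℂ] g →ₗ[ℂ] g) (TensorProduct.mk ℂ g g) s t

/-- `[s¹², t²³]`: `(a ⊗ b, c ⊗ d) ↦ a ⊗ [b, c] ⊗ d`. -/
noncomputable def lie1223 (s t : g ⊗[ℂ] g) : g ⊗[ℂ] (g ⊗[ℂ] g) :=
  LinearMap.lTensor g
    ((LinearMap.rTensorHom g ∘ₗ (LieModule.toEnd ℂ g g : g →ₗ[ℂ] g →ₗ[ℂ] g)).flip t) s

/-- `[s¹³, t²³]`: `(a ⊗ b, c ⊗ d) ↦ a ⊗ c ⊗ [b, d]`. -/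
noncomputable def lie1323 (s t : g ⊗[ℂ] g) : g ⊗[ℂ] (g ⊗[ℂ] g) :=
  LinearMap.lTensor g
    ((LinearMap.lTensorHom g ∘ₗ (LieModule.toEnd ℂ g g : g →ₗ[ℂ] g →ₗ[ℂ] g)).flip t) s

/-- `x⁽¹⁾ s²³`: `a ⊗ b ↦ x ⊗ a ⊗ b`. -/
noncomputable def putFirst (x : g) (s : g ⊗[ℂ] g) : g ⊗[ℂ] (g ⊗[ℂ] g) := x ⊗ₜ[ℂ] s

/-- `x⁽²⁾ s¹³`: `a ⊗ b ↦ a ⊗ x ⊗ b`. -/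
noncomputable def putSecond (x : g) (s : g ⊗[ℂ] g) : g ⊗[ℂ] (g ⊗[ℂ] g) :=
  LinearMap.lTensor g (TensorProduct.mk ℂ g g x) s

/-- `x⁽³⁾ s¹²`: `a ⊗ b ↦ a ⊗ b ⊗ x`. -/
noncomputable def putThird (x : g) (s : g ⊗[ℂ] g) : g ⊗[ℂ] (g ⊗[ℂ] g) :=
  LinearMap.lTensor g ((TensorProduct.mk ℂ g g).flip x) s

variable (g) in
/-- The Casimir element `Ω = ∑ eᵢ ⊗ eⁱ`, for dual bases with respect to the Killing form. -/
noncomputable def casimir [LieAlgebra.IsSimple ℂ g] : g ⊗[ℂ] g :=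
  ∑ i, Module.finBasis ℂ g i ⊗ₜ[ℂ]
    (killingForm ℂ g).dualBasis (LieAlgebra.IsKilling.killingForm_nondegenerate ℂ g)
      (Module.finBasis ℂ g) i

/-! ## Dynamical r-matrices -/

variable {H : LieSubalgebra ℂ g}

/-- `𝒳_a r (q, z)`: the derivative of `r` with respect to `q` along the constant vector field
`a` on `h*`. -/
noncomputable def derivBase (r : Module.Dual ℂ H × ℂ → g ⊗[ℂ] g) (a q : Module.Dual ℂ H) (z : ℂ) :
    g ⊗[ℂ] g :=
  derivZero fun s => r (q + s • a, z)

/-- The set of `q` in `h*` such that, for `q'` near `q`, `r(q', ·)` has no pole in a common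
punctured disc around `0`. For meromorphic `r` it is open and dense. -/
def baseDomain (r : Module.Dual ℂ H × ℂ → g ⊗[ℂ] g) : Set (Module.Dual ℂ H) :=
  {q | ∃ δ : ℝ, 0 < δ ∧ ∀ᶠ c in 𝓝 (coords (Module.Dual ℂ H) q), ∀ z : ℂ, 0 < ‖z‖ → ‖z‖ < δ →
    HolAt r ((coords (Module.Dual ℂ H)).symm c, z)}

/-- `r(q, ·)` has no pole in `|z| < ρ` other than `0`. -/
def RegularBelow (r : Module.Dual ℂ H × ℂ → g ⊗[ℂ] g) (q : Module.Dual ℂ H) (ρ : ℝ) : Prop :=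
  ∀ z : ℂ, 0 < ‖z‖ → ‖z‖ < ρ → HolAt r (q, z)

/-- `Alt(d_h r)` at `(q, z₁, z₂, z₃)`, with `zᵢⱼ = zᵢ - zⱼ`, is
`∑ᵢ xᵢ⁽¹⁾ ∂ᵢ r²³(q, z₂₃) - ∑ᵢ xᵢ⁽²⁾ ∂ᵢ r¹³(q, z₁₃) + ∑ᵢ xᵢ⁽³⁾ ∂ᵢ r¹²(q, z₁₂)`, for a basis `xᵢ` of
`h` and the corresponding linear coordinates on `h*`. -/
noncomputable def altDeriv (r : Module.Dual ℂ H × ℂ → g ⊗[ℂ] g) (q : Module.Dual ℂ H)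
    (z₁ z₂ z₃ : ℂ) : g ⊗[ℂ] (g ⊗[ℂ] g) :=
  ∑ i, (putFirst (Module.finBasis ℂ H i : g)
        (derivBase r ((Module.finBasis ℂ H).coord i) q (z₂ - z₃))
      - putSecond (Module.finBasis ℂ H i : g)
        (derivBase r ((Module.finBasis ℂ H).coord i) q (z₁ - z₃))
      + putThird (Module.finBasis ℂ H i : g)
        (derivBase r ((Module.finBasis ℂ H).coord i) q (z₁ - z₂)))

/-- Classical dynamical r-matrices with spectral parameter associated with `h ⊂ g`. The identities
are identities of meromorphic functions, i.e. they are required at regular points. -/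
structure IsDynamicalRMatrix [LieAlgebra.IsSimple ℂ g] (H : LieSubalgebra ℂ g)
    (r : Module.Dual ℂ H × ℂ → g ⊗[ℂ] g) : Prop where
  meromorphic : IsMeromorphicFun r
  /-- `[x ⊗ 1 + 1 ⊗ x, r(q, z)] = 0` for `x` in `h`. -/
  zeroWeight : ∀ (q : Module.Dual ℂ H) (z : ℂ), HolAt r (q, z) → ∀ x ∈ H, ⁅x, r (q, z)⁆ = 0
  /-- `r(q, z) + r²¹(q, -z) = 0`. -/
  unitarity : ∀ (q : Module.Dual ℂ H) (z : ℂ), HolAt r (q, z) → HolAt r (q, -z) →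
    r (q, z) + flipTensor (r (q, -z)) = 0
  /-- `r(q, ·)` has a simple pole at `0`, with residue `Ω`. -/
  residue : ∀ q ∈ baseDomain r, Tendsto (fun z : ℂ => coords (g ⊗[ℂ] g) (z • r (q, z))) (𝓝[≠] 0)
    (𝓝 (coords (g ⊗[ℂ] g) (casimir g)))
  /-- The classical dynamical Yang-Baxter equation. -/
  cdybe : ∀ (q : Module.Dual ℂ H) (z₁ z₂ z₃ : ℂ), HolAt r (q, z₁ - z₂) →
    HolAt r (q, z₁ - z₃) → HolAt r (q, z₂ - z₃) →
    altDeriv r q z₁ z₂ z₃ + lie1213 (r (q, z₁ - z₂)) (r (q, z₁ - z₃))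
      + lie1223 (r (q, z₁ - z₂)) (r (q, z₂ - z₃))
      + lie1323 (r (q, z₁ - z₃)) (r (q, z₂ - z₃)) = 0

/-! ## The phase space -/

/-- The phase space `T*h* × g* = h* × h × g*`, with points `(q, p, ξ)`. -/
abbrev Phase (H : LieSubalgebra ℂ g) : Type _ := Module.Dual ℂ H × H × Module.Dual ℂ g

/-- `i*ξ`, the restriction of `ξ` in `g*` to `h`. -/
def restrictDual (H : LieSubalgebra ℂ g) (ξ : Module.Dual ℂ g) : Module.Dual ℂ H :=
  ξ ∘ₗ (H.subtype : H →ₗ[ℂ] g)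

/-- The derivative of `F` at `x` in the direction `v`. -/
noncomputable def dirDeriv (F : Phase H → ℂ) (x v : Phase H) : ℂ :=
  deriv (fun s : ℂ => F (x + s • v)) 0

/-- `∂F/∂qᵢ`, for the linear coordinates `qᵢ` on `h*` given by a basis of `h`. -/
noncomputable def dQ (F : Phase H → ℂ) (x : Phase H) (i : Fin (Module.finrank ℂ H)) : ℂ :=
  dirDeriv F x ((Module.finBasis ℂ H).coord i, 0, 0)

/-- `∂F/∂pᵢ`, for the coordinates `pᵢ` on `h` dual to the `qᵢ`. -/
noncomputable def dP (F : Phase H → ℂ) (x : Phase H) (i : Fin (Module.finrank ℂ H)) : ℂ :=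
  dirDeriv F x (0, Module.finBasis ℂ H i, 0)

/-- `∂F/∂ξ`, a vector of `g = (g*)*`. -/
noncomputable def gradXi (F : Phase H → ℂ) (x : Phase H) : g :=
  ∑ a, dirDeriv F x (0, 0, (Module.finBasis ℂ g).coord a) • Module.finBasis ℂ g a

/-- The product of the canonical Poisson structure on `T*h*`, with `{pᵢ, qⱼ} = δᵢⱼ`, and the plus
Lie-Poisson structure on `g*`, with `{a, b}(ξ) = ξ([a, b])` for `a`, `b` in `g = (g*)*`. -/
noncomputable def poisson (F G : Phase H → ℂ) (x : Phase H) : ℂ :=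
  ∑ i, (dP F x i * dQ G x i - dQ F x i * dP G x i) + x.2.2 ⁅gradXi F x, gradXi G x⁆

/-- `{F₁, G₂} = ∑_{a, b} {Fᵃ, Gᵇ} e_a ⊗ e_b`, for functions `F = ∑ Fᵃ e_a` and `G = ∑ Gᵇ e_b` with
values in `g`. -/
noncomputable def poissonTensor (F G : Phase H → g) (x : Phase H) : g ⊗[ℂ] g :=
  ∑ a, ∑ b, poisson (fun y => (Module.finBasis ℂ g).coord a (F y))
      (fun y => (Module.finBasis ℂ g).coord b (G y)) x •
    (Module.finBasis ℂ g a ⊗ₜ[ℂ] Module.finBasis ℂ g b)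

/-- `φ` satisfies Hamilton's equations at time `t` for the Hamiltonian `F`:
`dℓ(φ)/dt = {ℓ, F}(φ)` for all linear functions `ℓ` on the phase space. -/
def SatisfiesHamiltonAt (F : Phase H → ℂ) (φ : ℝ → Phase H) (t : ℝ) : Prop :=
  ∀ l : Module.Dual ℂ (Phase H), HasDerivAt (fun s => l (φ s)) (poisson l F (φ t)) t

/-! ## The Lax map and the operator `R` -/

/-- `L(q, p, ξ)(z) = p + (r₋^#(q) ξ)(z)`, where `⟨η, (r₋^#(q) ξ)(z)⟩ = ⟨η ⊗ ξ, r(q, z)⟩`. -/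
noncomputable def laxAt (r : Module.Dual ℂ H × ℂ → g ⊗[ℂ] g) (x : Phase H) (z : ℂ) : g :=
  (x.2.1 : g) + contrSnd x.2.2 (r (x.1, z))

/-- The Lax map with values in the loop algebra. -/
noncomputable def lax (r : Module.Dual ℂ H × ℂ → g ⊗[ℂ] g) (x : Phase H) : Loop g :=
  Loop.ofFun (laxAt r x)

/-- `1 / (2 π i)` times the integral of `⟨M(w) ⊗ 1, r(q, w - z)⟩ dw` over the part `|w - z| > ε` of
the circle `|w| = |z|`, positively oriented (in coordinates). -/
noncomputable def truncatedIntegral (r : Module.Dual ℂ H × ℂ → g ⊗[ℂ] g) (q : Module.Dual ℂ H)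
    (M : Loop (Module.Dual ℂ g)) (z : ℂ) (ε : ℝ) : Fin (Module.finrank ℂ g) → ℂ :=
  (2 * Real.pi * Complex.I : ℂ)⁻¹ • circleIntegral (fun w =>
    if ε < ‖w - z‖ then coords g (contrFst (M.eval w) (r (q, w - z))) else 0) 0 ‖z‖

/-- `(R_q M)(z) = v`, where `(R_q M)(z)` is the principal value of the integral of
`⟨M(w) ⊗ 1, r(q, w - z)⟩ dw / (2 π i)` over the circle `|w| = |z|`. -/
def HasValueR (r : Module.Dual ℂ H × ℂ → g ⊗[ℂ] g) (q : Module.Dual ℂ H)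
    (M : Loop (Module.Dual ℂ g)) (z : ℂ) (v : g) : Prop :=
  Tendsto (truncatedIntegral r q M z) (𝓝[>] 0) (𝓝 (coords g v))

/-- `(R_q M)(z)`. -/
noncomputable def opR (r : Module.Dual ℂ H × ℂ → g ⊗[ℂ] g) (q : Module.Dual ℂ H)
    (M : Loop (Module.Dual ℂ g)) (z : ℂ) : g :=
  (coords g).symm (limUnder (𝓝[>] (0 : ℝ)) (truncatedIntegral r q M z))

/-- `((𝒳_a R)(M))(z)` at `q`: the derivative of `q ↦ (R_q M)(z)` along `a`, for fixed `M`. -/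
noncomputable def derivOpR (r : Module.Dual ℂ H × ℂ → g ⊗[ℂ] g) (a q : Module.Dual ℂ H)
    (M : Loop (Module.Dual ℂ g)) (z : ℂ) : g :=
  derivZero fun s => opR r (q + s • a) M z

end LieAlgebra

/-! The function `L = p + r_-^#(q) ξ` is affine in `(p, ξ)`, so the brackets of its matrix entries
are explicit. The canonical part contributes `x_k ⊗ ∂_k` and `∂_k ⊗ x_k` terms, and the Lie–Poisson
part contributes `[r¹³(z), r²³(w)]` contracted with `ξ` in the third factor (`poisson_laxDeriv`).
These are the terms of the dynamical Yang–Baxter equation at `(z₁, z₂, z₃) = (z, w, 0)`, contracted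
with `ξ`, that do not contain `r¹²`. The terms with `r¹²(z - w)` give the commutators with `L` and,
because `∑ ξ(x_k) ∂_k` is the derivative along `i*ξ`, the dynamical term. The momentum `p` may be
added to the arguments of the commutators by the zero weight condition. This is
`IsDynamicalRMatrix.laxBracket_eq`.

For the quasi-Lax equation, Cauchy's coefficient formula on a fixed circle makes `L` a
differentiable map into one Banach step (`exists_hasFDerivAt_step`,
`IsDynamicalRMatrix.exists_hasFDerivAt_lax`). The chain rule then gives `d(f ∘ L) = ⟨M, dL⟩` with `M
= df(L)`, and the pairing is a contour integral over `|w| = σ` for any small `σ`. With `σ < |z|`,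
the bracket of `L(z)` with `f ∘ L` is the integral over this circle of the brackets of `L(z)` with
`⟨M(w), L(w)⟩`, where `M` is frozen. Ad-invariance, which holds pointwise in `w`
(`Loop.AdInvariant.eval_lie_eq_zero`), kills the commutator in the second factor, and unitarity
turns `-r(z - w)` into `r²¹(w - z)`. The velocity of `L(z)` is therefore the asserted right-hand
side, with inner-circle integrals in place of principal values
(`IsDynamicalRMatrix.laxDeriv_velocity_eq`).

Finally, the principal value over `|w| = |z|` is the inner integral plus half the residue at `w =
z`, namely half the contraction of `Ω` with `M(z)` (`IsDynamicalRMatrix.hasValueR`). This correction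
commutes with `L(z)`, because under the Killing form it represents the invariant functional `M(z)/2`
(`lie_contrFst_casimir`). It does not depend on `q`, so it also drops out of the derivative of `R`.
-/

/-! ### Contractions of tensors and of the terms of the Yang–Baxter equation. -/

section TensorAlgebra

variable {g : Type*} [LieRing g] [LieAlgebra ℂ g]

@[simp] theorem contrFst_tmul (ξ : Module.Dual ℂ g) (a b : g) :
    contrFst ξ (a ⊗ₜ b) = ξ a • b := by
  simp [contrFst]

@[simp] theorem contrSnd_tmul (ξ : Module.Dual ℂ g) (a b : g) :
    contrSnd ξ (a ⊗ₜ b) = ξ b • a := by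
  simp [contrSnd]

theorem apply_contrSnd (η ζ : Module.Dual ℂ g) (s : g ⊗[ℂ] g) :
    η (contrSnd ζ s) = ζ (contrFst η s) := by
  induction s with
  | zero => simp
  | tmul a b => simp [mul_comm]
  | add a b ha hb => simp [ha, hb]

theorem contrSnd_flipTensor (ζ : Module.Dual ℂ g) (s : g ⊗[ℂ] g) :
    contrSnd ζ (flipTensor s) = contrFst ζ s := by
  unfold flipTensor
  induction s with
  | zero => simp
  | tmul a b => simp
  | add a b ha hb => simp [ha, hb]

variable (g) in
/-- `ξ ↦ contrFst ξ` as a linear map. -/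
noncomputable def contrFstHom : Module.Dual ℂ g →ₗ[ℂ] g ⊗[ℂ] g →ₗ[ℂ] g :=
  LinearMap.mk₂ ℂ (fun ξ s => contrFst ξ s)
    (fun ξ η s => by simp [contrFst, LinearMap.rTensor_add])
    (fun c ξ s => by simp [contrFst, LinearMap.rTensor_smul])
    (fun ξ s t => map_add _ _ _) (fun c ξ s => map_smul _ _ _)

variable (g) in
/-- `ξ ↦ contrSnd ξ` as a linear map. -/
noncomputable def contrSndHom : Module.Dual ℂ g →ₗ[ℂ] g ⊗[ℂ] g →ₗ[ℂ] g :=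
  LinearMap.mk₂ ℂ (fun ξ s => contrSnd ξ s)
    (fun ξ η s => by simp [contrSnd, LinearMap.lTensor_add])
    (fun c ξ s => by simp [contrSnd, LinearMap.lTensor_smul])
    (fun ξ s t => map_add _ _ _) (fun c ξ s => map_smul _ _ _)

@[simp] theorem contrSndHom_apply (ξ : Module.Dual ℂ g) (s : g ⊗[ℂ] g) :
    contrSndHom g ξ s = contrSnd ξ s := rfl

theorem contrSnd_lieSlotOne (ζ : Module.Dual ℂ g) (s : g ⊗[ℂ] g) (X : g) :
    contrSnd ζ (lieSlotOne s X) = ⁅contrSnd ζ s, X⁆ := by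
  unfold lieSlotOne
  induction s with
  | zero => simp
  | tmul a b => simp [← smul_neg]
  | add a b ha hb => simp only [map_add, neg_add, add_lie, ha, hb]

theorem contrSnd_lieSlotTwo (ζ : Module.Dual ℂ g) (s : g ⊗[ℂ] g) (X : g)
    (h : ∀ y : g, ζ ⁅y, X⁆ = 0) : contrSnd ζ (lieSlotTwo s X) = 0 := by
  unfold lieSlotTwo
  induction s with
  | zero => simp
  | tmul a b =>
    have hb := h b
    rw [← lie_skew, map_neg, neg_eq_zero] at hb
    simp [hb]
  | add a b ha hb => simp only [map_add, neg_add, ha, hb, add_zero]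

/-- `a ⊗ b ⊗ c ↦ ξ(c) a ⊗ b`. -/
noncomputable def contrThird (ξ : Module.Dual ℂ g) : g ⊗[ℂ] (g ⊗[ℂ] g) →ₗ[ℂ] g ⊗[ℂ] g :=
  LinearMap.lTensor g (contrSnd ξ)

theorem contrThird_putFirst (ξ : Module.Dual ℂ g) (x : g) (s : g ⊗[ℂ] g) :
    contrThird ξ (putFirst x s) = x ⊗ₜ contrSnd ξ s := by
  simp [contrThird, putFirst]

theorem contrThird_putSecond (ξ : Module.Dual ℂ g) (x : g) (s : g ⊗[ℂ] g) :
    contrThird ξ (putSecond x s) = contrSnd ξ s ⊗ₜ x := by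
  unfold contrThird putSecond
  induction s with
  | zero => simp
  | tmul a b => simp [TensorProduct.smul_tmul]
  | add a b ha hb => simp only [map_add, ha, hb, TensorProduct.add_tmul]

theorem contrThird_putThird (ξ : Module.Dual ℂ g) (x : g) (s : g ⊗[ℂ] g) :
    contrThird ξ (putThird x s) = ξ x • s := by
  unfold contrThird putThird
  induction s with
  | zero => simp
  | tmul a b => simp
  | add a b ha hb => simp only [map_add, ha, hb, smul_add]

theorem contrThird_lie1213 (ξ : Module.Dual ℂ g) (s t : g ⊗[ℂ] g) :
    contrThird ξ (lie1213 s t) = lieSlotOne s (contrSnd ξ t) := by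
  unfold contrThird lie1213 lieSlotOne
  induction s with
  | zero => simp
  | add a b ha hb => simp only [map_add, LinearMap.add_apply, ha, hb, neg_add]
  | tmul a b =>
    induction t with
    | zero => simp
    | add c d hc hd => simp only [map_add, LinearMap.rTensor_add, LinearMap.add_apply, hc, hd,
        neg_add]
    | tmul c d =>
      simp only [TensorProduct.map₂_apply_tmul, TensorProduct.map_tmul, LieHom.coe_toLinearMap,
        LieModule.toEnd_apply_apply, TensorProduct.mk_apply, LinearMap.lTensor_tmul,
        contrSnd_tmul, map_smul, LinearMap.rTensor_smul, LinearMap.smul_apply,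
        LinearMap.rTensor_tmul, LieAlgebra.ad_apply, TensorProduct.tmul_smul]
      rw [← lie_skew a c, TensorProduct.neg_tmul, smul_neg]

theorem contrThird_lie1223 (ξ : Module.Dual ℂ g) (s t : g ⊗[ℂ] g) :
    contrThird ξ (lie1223 s t) = lieSlotTwo s (contrSnd ξ t) := by
  unfold contrThird lie1223 lieSlotTwo
  induction s with
  | zero => simp
  | add a b ha hb => simp only [map_add, ha, hb, neg_add]
  | tmul a b =>
    induction t with
    | zero => simp
    | add c d hc hd =>
      simp only [map_add, LinearMap.lTensor_add, LinearMap.add_apply, hc, hd, neg_add]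
    | tmul c d =>
      have h : a ⊗ₜ[ℂ] ⁅b, c⁆ = -(a ⊗ₜ[ℂ] ⁅c, b⁆) := by
        rw [← lie_skew b c, TensorProduct.tmul_neg]
      simp [h]

/-- The right-hand side has the shape of the Lie–Poisson bracket at `ξ` of two functions with
gradients `contrFst η s` and `contrFst ζ t`; this is how `[r¹³, r²³]` enters the Poisson bracket. -/
theorem apply_contrSnd_contrThird_lie1323 (ξ η ζ : Module.Dual ℂ g) (s t : g ⊗[ℂ] g) :
    η (contrSnd ζ (contrThird ξ (lie1323 s t))) = ξ ⁅contrFst η s, contrFst ζ t⁆ := by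
  unfold contrThird lie1323
  induction s with
  | zero => simp
  | add a b ha hb => simp only [map_add, ha, hb, add_lie]
  | tmul a b =>
    induction t with
    | zero => simp
    | add c d hc hd => 
      simp only [map_add, LinearMap.lTensor_add, LinearMap.add_apply, hc, hd, lie_add]
    | tmul c d =>
      simp
      ring

/-- Translates the zero weight condition, stated with the module structure on `g ⊗ g`, into
commutators in the two slots. The sign appears because the slots have `x` on the right of the
bracket. -/
theorem lie_tensor_eq_lieSlot (s : g ⊗[ℂ] g) (x : g) :
    ⁅x, s⁆ = -(lieSlotOne s x + lieSlotTwo s x) := by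
  unfold lieSlotOne lieSlotTwo
  induction s with
  | zero => simp
  | tmul a b => simp [add_comm]
  | add a b ha hb => simp only [map_add, lie_add, ha, hb]; abel

theorem lieSlotOne_add (s : g ⊗[ℂ] g) (x y : g) :
    lieSlotOne s (x + y) = lieSlotOne s x + lieSlotOne s y := by
  simp only [lieSlotOne, map_add, LinearMap.rTensor_add, LinearMap.add_apply, neg_add]

theorem lieSlotTwo_add (s : g ⊗[ℂ] g) (x y : g) :
    lieSlotTwo s (x + y) = lieSlotTwo s x + lieSlotTwo s y := by
  simp only [lieSlotTwo, map_add, LinearMap.lTensor_add, LinearMap.add_apply, neg_add]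

variable [FiniteDimensional ℂ g]

theorem sum_apply_contrSnd_smul_tmul (s : g ⊗[ℂ] g) :
    ∑ a, ∑ b, ((Module.finBasis ℂ g).coord a (contrSnd ((Module.finBasis ℂ g).coord b) s)) •
      (Module.finBasis ℂ g a ⊗ₜ[ℂ] Module.finBasis ℂ g b) = s := by
  induction s with
  | zero => simp
  | add s t hs ht =>
    simp only [map_add, add_smul, Finset.sum_add_distrib, hs, ht]
  | tmul x y =>
    conv_rhs => rw [← (Module.finBasis ℂ g).sum_repr x, ← (Module.finBasis ℂ g).sum_repr y]
    rw [Finset.sum_comm]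
    simp only [contrSnd_tmul, map_smul, Module.Basis.coord_apply, TensorProduct.sum_tmul,
      TensorProduct.tmul_sum, TensorProduct.smul_tmul_smul, smul_eq_mul, mul_comm]

/-- Contracting `Ω` with `ζ` gives the element `u` that represents `ζ` in the Killing form `κ`. By
invariance `κ([u, X], y) = κ(u, [X, y]) = ζ([X, y]) = 0` for all `y`, and `κ` is nondegenerate. -/
theorem lie_contrFst_casimir [LieAlgebra.IsSimple ℂ g] (ζ : Module.Dual ℂ g) (X : g)
    (h : ∀ y : g, ζ ⁅y, X⁆ = 0) : ⁅contrFst ζ (casimir g), X⁆ = 0 := by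
  have hnd := LieAlgebra.IsKilling.killingForm_nondegenerate ℂ g
  have key : ∀ y, killingForm ℂ g (contrFst ζ (casimir g)) y = ζ y := by
    intro y
    have : killingForm ℂ g (contrFst ζ (casimir g)) = ζ := by
      refine (Module.finBasis ℂ g).ext fun j => ?_
      simp [casimir, LinearMap.BilinForm.apply_dualBasis_left]
    rw [this]
  refine hnd.1 _ fun y => ?_
  rw [LieModule.traceForm_apply_lie_apply, key, ← lie_skew, map_neg, h, neg_zero]

end TensorAlgebra

/-! ### The Poisson bracket of the entries of the Lax function. -/

section PoissonAlgebra

variable {g : Type*} [LieRing g] [LieAlgebra ℂ g] {H : LieSubalgebra ℂ g}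

theorem dirDeriv_dual (l : Module.Dual ℂ (Phase H)) (x v : Phase H) : dirDeriv l x v = l v := by
  have : HasDerivAt (fun s : ℂ => l (x + s • v)) (l v) 0 := by
    simp only [map_add, map_smul, smul_eq_mul]
    simpa using ((hasDerivAt_id (0 : ℂ)).mul_const (l v)).const_add (l x)
  exact this.deriv

/-- The derivative of `(q, p, ξ) ↦ p + contrSnd ξ (r q)` at a point with `g*`-component `ξ` where
`r` has the value `s` and the derivative `ds`. -/
noncomputable def laxDeriv (ξ : Module.Dual ℂ g) (s : g ⊗[ℂ] g)
    (ds : Module.Dual ℂ H →ₗ[ℂ] g ⊗[ℂ] g) : Phase H →ₗ[ℂ] g :=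
  (H.subtype : H →ₗ[ℂ] g) ∘ₗ LinearMap.fst ℂ _ _ ∘ₗ LinearMap.snd ℂ _ _
    + (contrSndHom g).flip s ∘ₗ LinearMap.snd ℂ _ _ ∘ₗ LinearMap.snd ℂ _ _
    + contrSnd ξ ∘ₗ ds ∘ₗ LinearMap.fst ℂ _ _

theorem laxDeriv_apply (ξ : Module.Dual ℂ g) (s : g ⊗[ℂ] g)
    (ds : Module.Dual ℂ H →ₗ[ℂ] g ⊗[ℂ] g) (v : Phase H) :
    laxDeriv ξ s ds v = (v.2.1 : g) + contrSnd v.2.2 s + contrSnd ξ (ds v.1) := rfl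

variable [FiniteDimensional ℂ g]

/-- The bracket at a point sees only first derivatives, so each function may be replaced there by
its linear part. -/
theorem poisson_congr {F F' G G' : Phase H → ℂ} {x : Phase H}
    (hF : ∀ v, dirDeriv F x v = dirDeriv F' x v) (hG : ∀ v, dirDeriv G x v = dirDeriv G' x v) :
    poisson F G x = poisson F' G' x := by
  simp only [poisson, dP, dQ, gradXi, hF, hG]

/-- The tensor `{L₁, L₂}` in terms of the values and the derivatives of `r`. -/
noncomputable def laxBracket (ξ : Module.Dual ℂ g) (s t : g ⊗[ℂ] g)
    (ds dt : Module.Dual ℂ H →ₗ[ℂ] g ⊗[ℂ] g) : g ⊗[ℂ] g :=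
  ∑ i, ((Module.finBasis ℂ H i : g) ⊗ₜ contrSnd ξ (dt ((Module.finBasis ℂ H).coord i))
    - contrSnd ξ (ds ((Module.finBasis ℂ H).coord i)) ⊗ₜ (Module.finBasis ℂ H i : g))
    + contrThird ξ (lie1323 s t)

theorem sum_apply_contrSnd_coord_smul (η : Module.Dual ℂ g) (s : g ⊗[ℂ] g) :
    ∑ a, η (contrSnd ((Module.finBasis ℂ g).coord a) s) • Module.finBasis ℂ g a
      = contrFst η s := by
  simp only [apply_contrSnd]
  exact (Module.finBasis ℂ g).sum_repr _

/-- The `p`-derivatives of `η ∘ L` are `η(x_i)`, the `q`-derivatives are contractions of `ds` with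
`ξ`, and the `ξ`-gradient is `contrFst η s`. The two halves of the bracket are thus the two parts of
`laxBracket`. -/
theorem poisson_laxDeriv (η ζ : Module.Dual ℂ g) (x : Phase H) (s t : g ⊗[ℂ] g)
    (ds dt : Module.Dual ℂ H →ₗ[ℂ] g ⊗[ℂ] g) :
    poisson (η ∘ₗ laxDeriv x.2.2 s ds) (ζ ∘ₗ laxDeriv x.2.2 t dt) x
      = η (contrSnd ζ (laxBracket x.2.2 s t ds dt)) := by
  have h0 : ∀ u : g ⊗[ℂ] g, contrSnd (0 : Module.Dual ℂ g) u = 0 := fun u => by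
    rw [← contrSndHom_apply, map_zero, LinearMap.zero_apply]
  simp only [poisson, dP, dQ, gradXi, dirDeriv_dual, LinearMap.comp_apply, laxDeriv_apply, map_zero,
    h0, add_zero, zero_add, ZeroMemClass.coe_zero, sum_apply_contrSnd_coord_smul, laxBracket,
    map_add, map_sum, map_sub, contrSnd_tmul, apply_contrSnd_contrThird_lie1323, map_smul,
    smul_eq_mul]
  congr 1
  refine Finset.sum_congr rfl fun i _ => ?_
  ring

theorem poissonTensor_eq_laxBracket {F G : Phase H → g} {x : Phase H} {s t : g ⊗[ℂ] g}
    {ds dt : Module.Dual ℂ H →ₗ[ℂ] g ⊗[ℂ] g}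
    (hF : ∀ (η : Module.Dual ℂ g) v, dirDeriv (fun y => η (F y)) x v
      = η (laxDeriv x.2.2 s ds v))
    (hG : ∀ (η : Module.Dual ℂ g) v, dirDeriv (fun y => η (G y)) x v
      = η (laxDeriv x.2.2 t dt v)) :
    poissonTensor F G x = laxBracket x.2.2 s t ds dt := by
  rw [← sum_apply_contrSnd_smul_tmul (laxBracket x.2.2 s t ds dt)]
  refine Finset.sum_congr rfl fun a _ => Finset.sum_congr rfl fun b _ => ?_
  rw [← poisson_laxDeriv]
  congr 1
  exact poisson_congr
    (fun v => (hF _ v).trans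
      (dirDeriv_dual ((Module.finBasis ℂ g).coord a ∘ₗ laxDeriv x.2.2 s ds) x v).symm)
    (fun v => (hG _ v).trans
      (dirDeriv_dual ((Module.finBasis ℂ g).coord b ∘ₗ laxDeriv x.2.2 t dt) x v).symm)

/-- Identifies `∑ ξ(x_i) ∂_i`, the contraction of the `x⁽³⁾` term of the Yang–Baxter equation, as
the derivative along `i*ξ`. -/
theorem sum_restrictDual_smul_coord (ξ : Module.Dual ℂ g) :
    ∑ i, ξ (Module.finBasis ℂ H i : g) • (Module.finBasis ℂ H).coord i = restrictDual H ξ := by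
  refine (Module.finBasis ℂ H).ext fun j => ?_
  simp [restrictDual, Finsupp.single_apply]
  rfl

/-- The contraction of the dynamical Yang-Baxter equation with `ξ` in the third factor. -/
theorem laxBracket_eq (p : H) (ξ : Module.Dual ℂ g) (s t u : g ⊗[ℂ] g)
    (ds dt du : Module.Dual ℂ H →ₗ[ℂ] g ⊗[ℂ] g)
    (hu : ⁅(p : g), u⁆ = 0)
    (h : (∑ i, (putFirst (Module.finBasis ℂ H i : g) (dt ((Module.finBasis ℂ H).coord i))
        - putSecond (Module.finBasis ℂ H i : g) (ds ((Module.finBasis ℂ H).coord i))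
        + putThird (Module.finBasis ℂ H i : g) (du ((Module.finBasis ℂ H).coord i))))
      + lie1213 u s + lie1223 u t + lie1323 s t = 0) :
    laxBracket ξ s t ds dt = -(lieSlotOne u (p + contrSnd ξ s) + lieSlotTwo u (p + contrSnd ξ t))
      - du (restrictDual H ξ) := by
  have h' := congrArg (contrThird ξ) h
  simp only [map_add, map_sum, map_sub, map_zero, contrThird_putFirst, contrThird_putSecond,
    contrThird_putThird, contrThird_lie1213, contrThird_lie1223] at h'
  have hdu : du (restrictDual H ξ)
      = ∑ i, ξ (Module.finBasis ℂ H i : g) • du ((Module.finBasis ℂ H).coord i) := by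
    rw [← sum_restrictDual_smul_coord, map_sum]
    simp only [map_smul]
  rw [lie_tensor_eq_lieSlot, neg_eq_zero] at hu
  rw [Finset.sum_add_distrib, ← hdu] at h'
  -- The difference of the two sides is the contracted equation `h'` plus the zero weight expression
  -- `hu` in `p`, and both vanish.
  rw [laxBracket, lieSlotOne_add, lieSlotTwo_add, eq_comm, ← sub_eq_zero, ← neg_eq_zero, ← h',
    ← sub_eq_zero, ← hu]
  abel

end PoissonAlgebra

/-! ### Laurent series and contour integrals. -/

section Laurent

open Complex Metric

variable {E : Type*} [NormedAddCommGroup E] [NormedSpace ℂ E]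

theorem hasSum_int_iff_hasSum_nat {E : Type*} [AddCommMonoid E] [TopologicalSpace E]
    {f : ℤ → E} {N : ℤ} (h : ∀ k < -N, f k = 0) {a : E} :
    HasSum f a ↔ HasSum (fun n : ℕ => f (n - N)) a := by
  have hinj : Function.Injective fun n : ℕ => (n : ℤ) - N := fun a b h => by simpa using h
  refine (hinj.hasSum_iff fun k hk => ?_).symm
  by_contra h0
  have : -N ≤ k := by
    by_contra hlt
    exact h0 (h k (not_le.mp hlt))
  exact hk ⟨(k + N).toNat, by simp only; omega⟩

/-- Laurent expansion of a function with at most a simple pole at `0`. -/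
theorem exists_laurent_of_bounded [CompleteSpace E] {F : ℂ → E} {R : ℝ}
    (hd : ∀ z, 0 < ‖z‖ → ‖z‖ < R → DifferentiableAt ℂ F z) {C : ℝ}
    (hb : ∀ᶠ z in 𝓝[≠] (0 : ℂ), ‖z • F z‖ ≤ C) :
    ∃ c : ℤ → E, (∀ n < -1, c n = 0) ∧
      ∀ z, 0 < ‖z‖ → ‖z‖ < R → HasSum (fun n : ℤ => z ^ n • c n) (F z) := by
  rcases le_or_gt R 0 with hR | hR
  · exact ⟨0, fun _ _ => rfl, fun z h0 h1 => absurd (h0.trans h1) (not_lt.mpr hR)⟩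
  -- `z F(z)` is bounded near `0`, so it has a removable singularity. Its Taylor coefficient of
  -- order `k + 1` is the Laurent coefficient of `F` of order `k`.
  set G : ℂ → E := fun z => z • F z with hG
  have hG1 : DifferentiableOn ℂ (Function.update G 0 (limUnder (𝓝[≠] 0) G)) (ball 0 R) := by
    refine differentiableOn_update_limUnder_of_isLittleO (ball_mem_nhds 0 hR) ?_ ?_
    · intro z hz
      have hz0 : z ≠ 0 := hz.2
      have hzR : ‖z‖ < R := by simpa using hz.1
      exact (differentiableAt_id.smul (hd z (norm_pos_iff.mpr hz0) hzR)).differentiableWithinAt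
    · refine IsBoundedUnder.isLittleO_sub_self_inv ⟨C + ‖G 0‖, ?_⟩
      rw [eventually_map]
      filter_upwards [hb] with z hz
      exact norm_sub_le_of_le hz le_rfl
  set G1 := Function.update G 0 (limUnder (𝓝[≠] 0) G)
  refine ⟨fun k => if -1 ≤ k then ((((k + 1).toNat).factorial : ℂ)⁻¹ •
    iteratedDeriv (k + 1).toNat G1 0) else 0, fun n hn => if_neg (not_le.mpr hn), ?_⟩
  intro z h0 h1
  have hz0 : z ≠ 0 := norm_pos_iff.mp h0
  have hs := hasSum_taylorSeries_on_ball hG1 (z := z) (by simpa using h1)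
  have hv : G1 z = z • F z := by simp [G1, hz0, hG]
  rw [hv] at hs
  have hs' := hs.const_smul z⁻¹
  rw [inv_smul_smul₀ hz0] at hs'
  rw [hasSum_int_iff_hasSum_nat (N := 1)]
  · convert hs' using 2 with n
    have : (-1 : ℤ) ≤ (n : ℤ) - 1 := by omega
    beta_reduce
    rw [if_pos this]
    simp only [sub_add_cancel, Int.toNat_natCast, sub_zero, zpow_sub₀ hz0, zpow_natCast, zpow_one,
      smul_smul]
    congr 1
    ring
  · intro k hk
    beta_reduce
    rw [if_neg (not_le.mpr hk), smul_zero]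

theorem hasSum_circleIntegral {ι : Type*} [Countable ι] {f : ι → ℂ → E} {F : ℂ → E}
    {s : ℝ} (hs : 0 ≤ s) {u : ι → ℝ} (hu : Summable u)
    (hc : ∀ n, ContinuousOn (f n) (sphere 0 s)) (hb : ∀ n, ∀ z ∈ sphere (0 : ℂ) s, ‖f n z‖ ≤ u n)
    (hF : ∀ z ∈ sphere (0 : ℂ) s, HasSum (fun n => f n z) (F z)) :
    HasSum (fun n => ∮ z in C(0, s), f n z) (∮ z in C(0, s), F z) := by
  have hm : ∀ θ, circleMap 0 s θ ∈ sphere (0 : ℂ) s := fun θ => circleMap_mem_sphere _ hs θ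
  refine intervalIntegral.hasSum_integral_of_dominated_convergence (fun n _ => s * u n)
    (fun n => ?_) (fun n => ?_) ?_ ?_ ?_
  · have h1 : Continuous fun θ => f n (circleMap 0 s θ) :=
      (hc n).comp_continuous (continuous_circleMap 0 s) hm
    have h2 : Continuous fun θ => deriv (circleMap 0 s) θ := by
      simp only [deriv_circleMap]
      exact (continuous_circleMap 0 s).mul continuous_const
    exact (h2.smul h1).aestronglyMeasurable
  · refine Eventually.of_forall fun θ _ => ?_
    rw [norm_smul]
    have : ‖deriv (circleMap 0 s) θ‖ = s := by simp [abs_of_nonneg hs]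
    rw [this]
    exact mul_le_mul_of_nonneg_left (hb n _ (hm θ)) hs
  · exact Eventually.of_forall fun θ _ => hu.mul_left _
  · exact intervalIntegrable_const
  · exact Eventually.of_forall fun θ _ => (hF _ (hm θ)).const_smul _

theorem circleIntegral_zpow {s : ℝ} (hs : 0 < s) (n : ℤ) :
    (∮ z in C(0, s), z ^ n) = if n = -1 then 2 * Real.pi * I else 0 := by
  split_ifs with h
  · subst h
    simpa using circleIntegral.integral_sub_center_inv (0 : ℂ) hs.ne'
  · simpa using circleIntegral.integral_sub_zpow_of_ne h 0 0 s

theorem norm_zpow_smul_of_mem_sphere {s : ℝ} {z : ℂ} (hz : z ∈ sphere (0 : ℂ) s) (n : ℤ) (v : E) :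
    ‖z ^ n • v‖ = ‖v‖ * s ^ n := by
  rw [norm_smul, norm_zpow, mem_sphere_zero_iff_norm.mp hz, mul_comm]

theorem ne_zero_of_mem_sphere' {s : ℝ} (hs : 0 < s) {z : ℂ} (hz : z ∈ sphere (0 : ℂ) s) :
    z ≠ 0 := by
  rintro rfl
  simp at hz
  exact hs.ne hz

theorem continuousOn_zpow_sphere {s : ℝ} (hs : 0 < s) (n : ℤ) :
    ContinuousOn (fun z : ℂ => z ^ n) (sphere 0 s) := fun z hz =>
  (continuousAt_zpow₀ z n (Or.inl (ne_zero_of_mem_sphere' hs hz))).continuousWithinAt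

/-- The coefficients of an absolutely convergent Laurent series as integrals. -/
theorem circleIntegral_zpow_smul_laurent [CompleteSpace E] {c : ℤ → E} {F : ℂ → E} {s : ℝ}
    (hs : 0 < s) (hc : Summable fun n => ‖c n‖ * s ^ n)
    (hF : ∀ z ∈ sphere (0 : ℂ) s, HasSum (fun n : ℤ => z ^ n • c n) (F z)) (n : ℤ) :
    (∮ z in C(0, s), z ^ n • F z) = (2 * Real.pi * I : ℂ) • c (-1 - n) := by
  have h := hasSum_circleIntegral (f := fun m z => z ^ n • z ^ m • c m)
    (F := fun z => z ^ n • F z) hs.le (hc.mul_left (s ^ n))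
    (fun m => (continuousOn_zpow_sphere hs n).smul
      ((continuousOn_zpow_sphere hs m).smul continuousOn_const))
    (fun m z hz => by
      rw [norm_zpow_smul_of_mem_sphere hz, norm_zpow_smul_of_mem_sphere hz, mul_comm])
    (fun z hz => (hF z hz).const_smul _)
  refine h.unique ?_
  have h2 : ∀ m, (∮ z in C(0, s), z ^ n • z ^ m • c m)
      = (if m = -1 - n then (2 * Real.pi * I : ℂ) • c (-1 - n) else 0) := by
    intro m
    have : (∮ z in C(0, s), z ^ n • z ^ m • c m) = ∮ z in C(0, s), z ^ (n + m) • c m := by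
      refine circleIntegral.integral_congr hs.le fun z hz => ?_
      simp only [smul_smul]
      rw [zpow_add₀ (ne_zero_of_mem_sphere' hs hz)]
    rw [this, circleIntegral.integral_smul_const, circleIntegral_zpow hs]
    by_cases hm : m = -1 - n
    · subst hm
      simp
    · rw [if_neg hm, if_neg (by omega), zero_smul]
  simp only [h2]
  exact hasSum_ite_eq _ _

theorem laurent_continuousOn_sphere [CompleteSpace E] {c : ℤ → E} {F : ℂ → E} {s : ℝ}
    (hs : 0 < s) (hc : Summable fun n => ‖c n‖ * s ^ n)
    (hF : ∀ z ∈ sphere (0 : ℂ) s, HasSum (fun n : ℤ => z ^ n • c n) (F z)) :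
    ContinuousOn F (sphere 0 s) := by
  refine (continuousOn_tsum (f := fun (n : ℤ) (z : ℂ) => z ^ n • c n)
    (fun n => (continuousOn_zpow_sphere hs n).smul continuousOn_const) hc
    fun n z hz => (norm_zpow_smul_of_mem_sphere hz n _).le).congr fun z hz => (hF z hz).tsum_eq.symm

theorem norm_laurent_le {c : ℤ → E} {F : ℂ → E} {s : ℝ}
    (hc : Summable fun n => ‖c n‖ * s ^ n)
    (hF : ∀ z ∈ sphere (0 : ℂ) s, HasSum (fun n : ℤ => z ^ n • c n) (F z)) {z : ℂ}
    (hz : z ∈ sphere (0 : ℂ) s) : ‖F z‖ ≤ ∑' n, ‖c n‖ * s ^ n := by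
  rw [← (hF z hz).tsum_eq]
  exact tsum_of_norm_bounded hc.hasSum fun n => (norm_zpow_smul_of_mem_sphere hz n _).le

variable {E₁ E₂ : Type*} [NormedAddCommGroup E₁] [NormedSpace ℂ E₁] [CompleteSpace E₁]
  [NormedAddCommGroup E₂] [NormedSpace ℂ E₂] [CompleteSpace E₂]

theorem clm_circleIntegral_comm (A : E₁ →L[ℂ] E₂) {f : ℂ → E₁} {s : ℝ} (hs : 0 ≤ s)
    (hf : ContinuousOn f (sphere 0 s)) :
    (∮ z in C(0, s), A (f z)) = A (∮ z in C(0, s), f z) := by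
  have hi : CircleIntegrable f 0 s := hf.circleIntegrable hs
  unfold circleIntegral
  rw [← ContinuousLinearMap.intervalIntegral_comp_comm _ hi.out]
  simp only [map_smul]

/-- The integral of a bilinear expression in two absolutely convergent Laurent series. -/
theorem hasSum_circleIntegral_bilin [CompleteSpace E] (B : E →L[ℂ] E₁ →L[ℂ] E₂)
    {c : ℤ → E} {d : ℤ → E₁} {F : ℂ → E} {G : ℂ → E₁} {s : ℝ} (hs : 0 < s)
    (hc : Summable fun n => ‖c n‖ * s ^ n) (hd : Summable fun n => ‖d n‖ * s ^ n)
    (hF : ∀ z ∈ sphere (0 : ℂ) s, HasSum (fun n : ℤ => z ^ n • c n) (F z))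
    (hG : ∀ z ∈ sphere (0 : ℂ) s, HasSum (fun n : ℤ => z ^ n • d n) (G z)) :
    HasSum (fun n : ℤ => (2 * Real.pi * I : ℂ) • B (c n) (d (-1 - n)))
      (∮ z in C(0, s), B (F z) (G z)) := by
  have hGc := laurent_continuousOn_sphere hs hd hG
  have hzc : ∀ n : ℤ, ContinuousOn (fun z => z ^ n • G z) (sphere 0 s) := fun n =>
    (continuousOn_zpow_sphere hs n).smul hGc
  -- Only `F` is expanded. Each term is `B (c n)` applied to `∮ zⁿ G`, a coefficient of `G`, so no
  -- double series occurs.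
  have h := hasSum_circleIntegral (f := fun (n : ℤ) z => B (c n) (z ^ n • G z))
    (F := fun z => B (F z) (G z)) hs.le
    (hc.mul_left (‖B‖ * ∑' n, ‖d n‖ * s ^ n))
    (fun n => (B (c n)).continuous.comp_continuousOn (hzc n))
    (fun n z hz => by
      refine (B.le_opNorm₂ _ _).trans ?_
      rw [norm_zpow_smul_of_mem_sphere hz]
      have := norm_laurent_le hd hG hz
      calc ‖B‖ * ‖c n‖ * (‖G z‖ * s ^ n)
          ≤ ‖B‖ * ‖c n‖ * ((∑' n, ‖d n‖ * s ^ n) * s ^ n) := by gcongr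
        _ = _ := by ring)
    (fun z hz => by
      have := (B.flip (G z)).hasSum (hF z hz)
      simpa using this)
  convert h using 2 with n
  rw [clm_circleIntegral_comm _ hs.le (hzc n), circleIntegral_zpow_smul_laurent hs hd hG, map_smul]

theorem laurent_differentiableAt [CompleteSpace E] {c : ℤ → E} {F : ℂ → E} {ρ : ℝ}
    (hc : ∀ s, 0 < s → s < ρ → Summable fun n => ‖c n‖ * s ^ n)
    (hF : ∀ z, 0 < ‖z‖ → ‖z‖ < ρ → HasSum (fun n : ℤ => z ^ n • c n) (F z)) {z : ℂ}
    (h0 : 0 < ‖z‖) (h1 : ‖z‖ < ρ) : DifferentiableAt ℂ F z := by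
  obtain ⟨a, ha0, ha⟩ := exists_between h0
  obtain ⟨b, hb, hb1⟩ := exists_between h1
  set U : Set ℂ := {w | a < ‖w‖ ∧ ‖w‖ < b} with hU
  have hUo : IsOpen U := (isOpen_lt continuous_const continuous_norm).inter
    (isOpen_lt continuous_norm continuous_const)
  have hzU : z ∈ U := ⟨ha, hb⟩
  -- On `a < |w| < b` the powers `|w|ⁿ` are at most `bⁿ` for `n ≥ 0` and at most `aⁿ` for `n ≤ 0`,
  -- so the sum of both series is a uniform majorant.
  have hsum := (hc a ha0 (ha.trans h1)).add (hc b (h0.trans hb) hb1)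
  have hd : DifferentiableOn ℂ (fun w => ∑' n : ℤ, w ^ n • c n) U := by
    refine differentiableOn_tsum_of_summable_norm hsum (fun n w hw => ?_) hUo fun n w hw => ?_
    · have hw0 : w ≠ 0 := norm_pos_iff.mp (ha0.trans hw.1)
      exact ((differentiableAt_zpow.mpr (Or.inl hw0)).smul_const _).differentiableWithinAt
    · have hw0 : 0 < ‖w‖ := ha0.trans hw.1
      rw [norm_smul, norm_zpow, mul_comm, ← mul_add]
      refine mul_le_mul_of_nonneg_left ?_ (norm_nonneg _)
      rcases le_total 0 n with hn | hn
      · have := zpow_le_zpow_left₀ hn hw0.le hw.2.le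
        have := zpow_pos ha0 n
        linarith
      · have h3 : ‖w‖ ^ n ≤ a ^ n := by
          have := zpow_le_zpow_left₀ (neg_nonneg.mpr hn) ha0.le hw.1.le
          rw [zpow_neg, zpow_neg] at this
          exact (inv_le_inv₀ (zpow_pos ha0 n) (zpow_pos hw0 n)).mp this
        have := zpow_pos (h0.trans hb) n
        linarith
  refine ((hd z hzU).differentiableAt (hUo.mem_nhds hzU)).congr_of_eventuallyEq ?_
  filter_upwards [hUo.mem_nhds hzU] with w hw
  exact (hF w (ha0.trans hw.1) (hw.2.trans hb1)).tsum_eq.symm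

end Laurent

/-! ### Principal values of integrals over a circle through a simple pole. -/

section PrincipalValue

open Complex Metric MeasureTheory

variable {E : Type*} [NormedAddCommGroup E]

theorem ae_circleMap_ne {z : ℂ} (hz : z ≠ 0) : ∀ᵐ θ : ℝ, circleMap 0 ‖z‖ θ ≠ z := by
  have : (circleMap 0 ‖z‖ ⁻¹' {z}).Countable :=
    Set.Countable.preimage_circleMap (Set.countable_singleton z) 0 (norm_ne_zero_iff.mpr hz)
  have h := this.ae_notMem volume
  filter_upwards [h] with θ hθ using hθ

theorem continuous_deriv_circleMap (s : ℝ) : Continuous fun θ => deriv (circleMap 0 s) θ := by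
  simp only [deriv_circleMap]
  exact (continuous_circleMap 0 s).mul continuous_const

theorem circleIntegrable_truncate {k : ℂ → E} {z : ℂ}
    (hk : ContinuousOn k (sphere 0 ‖z‖)) (ε : ℝ) :
    CircleIntegrable (fun w => if ε < ‖w - z‖ then k w else 0) 0 ‖z‖ := by
  have h1 : Continuous fun θ => k (circleMap 0 ‖z‖ θ) :=
    hk.comp_continuous (continuous_circleMap 0 ‖z‖) fun θ =>
      circleMap_mem_sphere _ (norm_nonneg z) θ
  have hs : MeasurableSet {θ : ℝ | ε < ‖circleMap 0 ‖z‖ θ - z‖} :=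
    (isOpen_lt continuous_const
      ((continuous_circleMap 0 ‖z‖).sub continuous_const).norm).measurableSet
  refine (h1.intervalIntegrable 0 (2 * Real.pi)).mono_fun
    ((h1.aestronglyMeasurable.indicator hs).congr (ae_of_all _ fun θ => ?_))
    (ae_of_all _ fun θ => ?_)
  · rfl
  · beta_reduce
    split_ifs with h
    · exact le_rfl
    · simp

variable [NormedSpace ℂ E]

/-- Truncations of a continuous function on a circle at a point of the circle. -/
theorem tendsto_circleIntegral_truncate {k : ℂ → E} {z : ℂ} (hz : z ≠ 0)
    (hk : ContinuousOn k (sphere 0 ‖z‖)) :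
    Tendsto (fun ε : ℝ => ∮ w in C(0, ‖z‖), if ε < ‖w - z‖ then k w else 0) (𝓝[>] 0)
      (𝓝 (∮ w in C(0, ‖z‖), k w)) := by
  have hm : ∀ θ, circleMap 0 ‖z‖ θ ∈ sphere (0 : ℂ) ‖z‖ := fun θ =>
    circleMap_mem_sphere _ (norm_nonneg z) θ
  have h1 : Continuous fun θ => k (circleMap 0 ‖z‖ θ) :=
    hk.comp_continuous (continuous_circleMap 0 ‖z‖) hm
  have h2 := continuous_deriv_circleMap ‖z‖
  unfold circleIntegral
  refine intervalIntegral.tendsto_integral_filter_of_dominated_convergence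
    (fun θ => ‖deriv (circleMap 0 ‖z‖) θ • k (circleMap 0 ‖z‖ θ)‖) ?_ ?_ ?_ ?_
  · refine Eventually.of_forall fun ε => ?_
    have hs : MeasurableSet {θ : ℝ | ε < ‖circleMap 0 ‖z‖ θ - z‖} :=
      (isOpen_lt continuous_const
        ((continuous_circleMap 0 ‖z‖).sub continuous_const).norm).measurableSet
    refine ((h2.smul h1).aestronglyMeasurable.indicator hs).congr (ae_of_all _ fun θ => ?_)
    beta_reduce
    by_cases h : ε < ‖circleMap 0 ‖z‖ θ - z‖
    · rw [Set.indicator_of_mem (show θ ∈ {θ : ℝ | ε < ‖circleMap 0 ‖z‖ θ - z‖} from h), if_pos h]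
      rfl
    · rw [Set.indicator_of_notMem (show θ ∉ {θ : ℝ | ε < ‖circleMap 0 ‖z‖ θ - z‖} from h),
        if_neg h, smul_zero]
  · refine Eventually.of_forall fun ε => Eventually.of_forall fun θ _ => ?_
    beta_reduce
    split_ifs with h
    · exact le_rfl
    · simp
  · exact ((h2.smul h1).norm).intervalIntegrable _ _
  · filter_upwards [ae_circleMap_ne hz] with θ hθ _
    refine tendsto_const_nhds.congr' ?_
    have hpos : 0 < ‖circleMap 0 ‖z‖ θ - z‖ := norm_pos_iff.mpr (sub_ne_zero.mpr hθ)
    filter_upwards [nhdsWithin_le_nhds (Iio_mem_nhds hpos)] with ε hε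
    rw [if_pos (show ε < _ from hε)]

theorem intervalIntegrable_of_measurable_of_norm_le {u : ℝ → ℂ} (hu : Measurable u) {C : ℝ}
    (hC : ∀ θ, ‖u θ‖ ≤ C) (a b : ℝ) : IntervalIntegrable u volume a b :=
  (intervalIntegrable_const (c := C)).mono_fun hu.aestronglyMeasurable
    (ae_of_all _ fun θ => (hC θ).trans (le_abs_self C))

theorem measurable_truncate_inv (z : ℂ) (ε : ℝ) :
    Measurable fun w : ℂ => if ε < ‖w - z‖ then (w - z)⁻¹ else 0 :=
  Measurable.ite (isOpen_lt continuous_const (continuous_id.sub continuous_const).norm).measurableSet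
    (measurable_id.sub_const z).inv measurable_const

theorem norm_truncate_inv_le (z w : ℂ) {ε : ℝ} (hε : 0 < ε) :
    ‖if ε < ‖w - z‖ then (w - z)⁻¹ else 0‖ ≤ ε⁻¹ := by
  split_ifs with h
  · rw [norm_inv]
    exact inv_anti₀ hε h.le
  · simpa using hε.le

/-- The reflection `w ↦ z²/w` of the circle in the line through `0` and `z` preserves `|w - z|`,
hence the truncated circle. In angles, the density of `dw/(w - z)` plus its reflection is the
density of `dw/w`. The identity is therefore exact for every `ε`, and no asymptotics are needed. -/
theorem circleIntegral_truncate_inv {z : ℂ} (hz : z ≠ 0) {ε : ℝ} (hε : 0 < ε) :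
    (∮ w in C(0, ‖z‖), if ε < ‖w - z‖ then (w - z)⁻¹ else 0)
      = 2⁻¹ * ∮ w in C(0, ‖z‖), if ε < ‖w - z‖ then w⁻¹ else 0 := by
  set R := ‖z‖ with hR
  have hR0 : 0 < R := norm_pos_iff.mpr hz
  obtain ⟨α, hα⟩ : ∃ α : ℝ, z = circleMap 0 R α :=
    ⟨arg z, by simp [circleMap, hR, norm_mul_exp_arg_mul_I]⟩
  set f : ℝ → ℂ := fun θ => deriv (circleMap 0 R) θ •
    (if ε < ‖circleMap 0 R θ - z‖ then (circleMap 0 R θ - z)⁻¹ else 0) with hf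
  set k : ℝ → ℂ := fun θ => deriv (circleMap 0 R) θ •
    (if ε < ‖circleMap 0 R θ - z‖ then (circleMap 0 R θ)⁻¹ else 0) with hk
  have hper : Function.Periodic f (2 * Real.pi) := fun θ => by
    simp only [hf, deriv_circleMap, periodic_circleMap 0 R θ]
  have hrel : ∀ θ, circleMap 0 R (2 * α - θ) * circleMap 0 R θ = z ^ 2 := fun θ => by
    rw [hα]
    simp only [circleMap, zero_add]
    rw [mul_mul_mul_comm, ← exp_add, mul_pow, ← exp_nat_mul, ← sq]
    congr 2
    push_cast
    ring
  have hsymm : ∀ θ, f (2 * α - θ) + f θ = k θ := by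
    intro θ
    have hw0 : circleMap 0 R θ ≠ 0 := circleMap_ne_center hR0.ne'
    have h1 := hrel θ
    have hu : circleMap 0 R (2 * α - θ) = z ^ 2 / circleMap 0 R θ := by
      rw [eq_div_iff hw0, h1]
    have hsub : circleMap 0 R (2 * α - θ) - z
        = -(z / circleMap 0 R θ) * (circleMap 0 R θ - z) := by
      rw [hu]; field_simp; ring
    have hnorm : ‖circleMap 0 R (2 * α - θ) - z‖ = ‖circleMap 0 R θ - z‖ := by
      rw [hsub, norm_mul, norm_neg, norm_div]
      have : ‖circleMap 0 R θ‖ = R := by simp [abs_of_pos hR0]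
      rw [this, ← hR, div_self hR0.ne', one_mul]
    simp only [hf, hk, deriv_circleMap, hnorm]
    split_ifs with h
    · have hne : circleMap 0 R θ - z ≠ 0 := norm_pos_iff.mp (hε.trans h)
      rw [hsub, hu]
      simp only [smul_eq_mul]
      field_simp
      ring
    · simp
  have hmeas : Measurable f := by
    refine Measurable.smul (continuous_deriv_circleMap R).measurable ?_
    exact (measurable_truncate_inv z ε).comp (continuous_circleMap 0 R).measurable
  have hbound : ∀ θ, ‖f θ‖ ≤ R * ε⁻¹ := fun θ => by
    rw [hf, norm_smul]
    have : ‖deriv (circleMap 0 R) θ‖ = R := by simp [abs_of_pos hR0]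
    rw [this]
    exact mul_le_mul_of_nonneg_left (norm_truncate_inv_le z _ hε) hR0.le
  have hgint := intervalIntegrable_of_measurable_of_norm_le hmeas hbound 0 (2 * Real.pi)
  -- The substitution maps the interval onto another full period.
  have e1 : ∫ θ in (0 : ℝ)..2 * Real.pi, f (2 * α - θ) = ∫ θ in (0 : ℝ)..2 * Real.pi, f θ := by
    rw [intervalIntegral.integral_comp_sub_left f (2 * α)]
    have := hper.intervalIntegral_add_eq (2 * α - 2 * Real.pi) 0
    simpa using this
  have e2 : ∫ θ in (0 : ℝ)..2 * Real.pi, k θ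
      = (∫ θ in (0 : ℝ)..2 * Real.pi, f (2 * α - θ)) + ∫ θ in (0 : ℝ)..2 * Real.pi, f θ := by
    rw [← intervalIntegral.integral_add _ hgint]
    · simp only [hsymm]
    · exact intervalIntegrable_of_measurable_of_norm_le
        (hmeas.comp (measurable_const.sub measurable_id)) (fun θ => hbound _) 0 (2 * Real.pi)
  unfold circleIntegral
  rw [show (∫ θ in (0 : ℝ)..2 * Real.pi, deriv (circleMap 0 R) θ •
    (if ε < ‖circleMap 0 R θ - z‖ then (circleMap 0 R θ)⁻¹ else 0)) =
    ∫ θ in (0 : ℝ)..2 * Real.pi, k θ from rfl, e2, e1]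
  simp only [hf]
  ring

/-- The principal value of the integral over a circle of a function with a simple pole on it. -/
theorem tendsto_circleIntegral_truncate_pole [CompleteSpace E] {h k : ℂ → E} {z : ℂ} (hz : z ≠ 0) (A : E)
    (hk : ContinuousOn k (sphere 0 ‖z‖))
    (heq : ∀ w ∈ sphere (0 : ℂ) ‖z‖, w ≠ z → h w = (w - z)⁻¹ • A + k w) :
    Tendsto (fun ε : ℝ => ∮ w in C(0, ‖z‖), if ε < ‖w - z‖ then h w else 0) (𝓝[>] 0)
      (𝓝 ((∮ w in C(0, ‖z‖), k w) + (Real.pi * I : ℂ) • A)) := by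
  have hz' : 0 < ‖z‖ := norm_pos_iff.mpr hz
  have hinv : ContinuousOn (fun w : ℂ => w⁻¹) (sphere 0 ‖z‖) := fun w hw =>
    (continuousAt_inv₀ (ne_zero_of_mem_sphere' hz' hw)).continuousWithinAt
  have h1 := tendsto_circleIntegral_truncate hz hinv
  have h2 : (∮ w in C(0, ‖z‖), w⁻¹) = 2 * Real.pi * I := by
    simpa using circleIntegral.integral_sub_center_inv (0 : ℂ) hz'.ne'
  rw [h2] at h1
  have h3 : Tendsto (fun ε : ℝ => ∮ w in C(0, ‖z‖), if ε < ‖w - z‖ then (w - z)⁻¹ else 0)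
      (𝓝[>] 0) (𝓝 (Real.pi * I)) := by
    have := h1.const_mul (2⁻¹ : ℂ)
    rw [show (2⁻¹ : ℂ) * (2 * Real.pi * I) = Real.pi * I by ring] at this
    refine this.congr' ?_
    filter_upwards [self_mem_nhdsWithin] with ε hε
    exact (circleIntegral_truncate_inv hz hε).symm
  refine ((tendsto_circleIntegral_truncate hz hk).add (h3.smul_const A)).congr' ?_
  filter_upwards [self_mem_nhdsWithin] with ε hε
  have hε' : 0 < ε := hε
  rw [← circleIntegral.integral_smul_const, ← circleIntegral.integral_add]
  · refine circleIntegral.integral_congr hz'.le fun w hw => ?_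
    split_ifs with hlt
    · have hne : w ≠ z := by
        rintro rfl
        simp only [sub_self, norm_zero] at hlt
        exact lt_asymm hlt hε'
      rw [heq w hw hne, add_comm]
    · simp
  · exact circleIntegrable_truncate hk ε
  · have : CircleIntegrable (fun w => if ε < ‖w - z‖ then (w - z)⁻¹ else 0) 0 ‖z‖ :=
      intervalIntegrable_of_measurable_of_norm_le
        ((measurable_truncate_inv z ε).comp (continuous_circleMap 0 ‖z‖).measurable)
        (fun θ => norm_truncate_inv_le z _ hε') 0 (2 * Real.pi)
    exact ⟨this.1.smul_const A, this.2.smul_const A⟩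

/-- The principal value in terms of the integral over a smaller circle. -/
theorem tendsto_circleIntegral_truncate_inner [CompleteSpace E] {h : ℂ → E} {z : ℂ} {A : E} {ρ σ : ℝ}
    (hzρ : ‖z‖ < ρ) (hσ : 0 < σ) (hσz : σ < ‖z‖)
    (hd : ∀ w, 0 < ‖w‖ → ‖w‖ < ρ → w ≠ z → DifferentiableAt ℂ h w)
    (hA : Tendsto (fun w => (w - z) • h w) (𝓝[≠] z) (𝓝 A)) :
    Tendsto (fun ε : ℝ => ∮ w in C(0, ‖z‖), if ε < ‖w - z‖ then h w else 0) (𝓝[>] 0)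
      (𝓝 ((∮ w in C(0, σ), h w) + (Real.pi * I : ℂ) • A)) := by
  have hz' : 0 < ‖z‖ := hσ.trans hσz
  have hz : z ≠ 0 := norm_pos_iff.mp hz'
  set U : Set ℂ := {w | 0 < ‖w‖ ∧ ‖w‖ < ρ} with hU
  have hUo : IsOpen U := (isOpen_lt continuous_const continuous_norm).inter
    (isOpen_lt continuous_norm continuous_const)
  -- Without its principal part `h` extends holomorphically over `z`, and the integral of the
  -- extension `k` can be moved to `|w| = σ`. There the principal part integrates to zero because
  -- `z` lies outside, which leaves the integral of `h`.
  set k₀ : ℂ → E := fun w => h w - (w - z)⁻¹ • A with hk₀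
  have hk₀d : ∀ w ∈ U \ {z}, DifferentiableAt ℂ k₀ w := fun w hw => by
    have hne : w - z ≠ 0 := sub_ne_zero.mpr hw.2
    exact (hd w hw.1.1 hw.1.2 hw.2).sub
      (((differentiableAt_id.sub_const z).inv hne).smul_const A)
  -- Subtracting the constant `k₀ z` puts the limit in the form required for the removable
  -- singularity; `k₀ z` is an arbitrary default value.
  have hlim : Tendsto (fun w => (w - z) • (k₀ w - k₀ z)) (𝓝[≠] z) (𝓝 0) := by
    have h1 : Tendsto (fun w => (w - z) • k₀ w) (𝓝[≠] z) (𝓝 0) := by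
      have := hA.sub_const A
      rw [sub_self] at this
      refine this.congr' ?_
      filter_upwards [self_mem_nhdsWithin] with w hw
      have hne : w - z ≠ 0 := sub_ne_zero.mpr hw
      rw [hk₀]
      simp only [smul_sub]
      rw [smul_inv_smul₀ hne]
    have h2 : Tendsto (fun w => (w - z) • k₀ z) (𝓝[≠] z) (𝓝 0) := by
      have hc : Continuous fun w : ℂ => (w - z) • k₀ z := by fun_prop
      have := (hc.tendsto z).mono_left (nhdsWithin_le_nhds (s := {z}ᶜ))
      simpa using this
    have := h1.sub h2
    simpa [smul_sub] using this
  have hkd : DifferentiableOn ℂ (Function.update k₀ z (limUnder (𝓝[≠] z) k₀)) U := by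
    refine differentiableOn_update_limUnder_of_isLittleO (hUo.mem_nhds ⟨hz', hzρ⟩)
      (fun w hw => (hk₀d w hw).differentiableWithinAt) ?_
    refine (Asymptotics.isLittleO_iff_forall_isBigOWith.mpr fun C hC => ?_)
    refine Asymptotics.IsBigOWith.of_bound ?_
    have := (tendsto_zero_iff_norm_tendsto_zero.mp hlim).eventually (gt_mem_nhds hC)
    filter_upwards [this, self_mem_nhdsWithin] with w hw hwz
    have hne : 0 < ‖w - z‖ := norm_pos_iff.mpr (sub_ne_zero.mpr hwz)
    rw [norm_inv, ← div_eq_mul_inv, le_div_iff₀ hne, mul_comm, ← norm_smul]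
    exact hw.le
  set k := Function.update k₀ z (limUnder (𝓝[≠] z) k₀) with hk
  have hkat : ∀ w ∈ U, DifferentiableAt ℂ k w := fun w hw =>
    (hkd w hw).differentiableAt (hUo.mem_nhds hw)
  have hkeq : ∀ w, w ≠ z → k w = h w - (w - z)⁻¹ • A := fun w hw => by
    rw [hk, Function.update_of_ne hw]
  have hsph : ∀ w ∈ sphere (0 : ℂ) ‖z‖, w ∈ U := fun w hw => by
    rw [mem_sphere_zero_iff_norm] at hw
    exact ⟨hw ▸ hz', hw ▸ hzρ⟩
  have main := tendsto_circleIntegral_truncate_pole (h := h) (k := k) hz A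
    (fun w hw => (hkat w (hsph w hw)).continuousAt.continuousWithinAt)
    (fun w _ hne => by rw [hkeq w hne]; abel)
  have hann : (∮ w in C(0, ‖z‖), k w) = ∮ w in C(0, σ), k w := by
    refine circleIntegral_eq_of_differentiable_on_annulus_off_countable hσ hσz.le
      Set.countable_empty (fun w hw => ?_) (fun w hw => ?_)
    · refine (hkat w ⟨?_, ?_⟩).continuousAt.continuousWithinAt
      · have : σ ≤ ‖w‖ := by simpa using hw.2
        exact hσ.trans_le this
      · have : ‖w‖ ≤ ‖z‖ := by simpa using hw.1
        exact this.trans_lt hzρ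
    · refine hkat w ⟨?_, ?_⟩
      · have : σ < ‖w‖ := by simpa using hw.1.2
        exact hσ.trans this
      · have : ‖w‖ < ‖z‖ := by simpa using hw.1.1
        exact this.trans hzρ
  have hne : ∀ w ∈ closedBall (0 : ℂ) σ, w - z ≠ 0 := fun w hw => by
    refine sub_ne_zero.mpr ?_
    rintro rfl
    rw [mem_closedBall_zero_iff] at hw
    exact not_lt.mpr hw hσz
  have hinvd : ∀ w ∈ closedBall (0 : ℂ) σ, DifferentiableAt ℂ (fun w => (w - z)⁻¹ • A) w :=
    fun w hw => ((differentiableAt_id.sub_const z).inv (hne w hw)).smul_const A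
  have hzero : (∮ w in C(0, σ), (w - z)⁻¹ • A) = 0 :=
    circleIntegral_eq_zero_of_differentiable_on_off_countable hσ.le Set.countable_empty
      (fun w hw => (hinvd w hw).continuousAt.continuousWithinAt)
      (fun w hw => hinvd w (ball_subset_closedBall hw.1))
  have hinner : (∮ w in C(0, σ), k w) = ∮ w in C(0, σ), h w := by
    have h1 : (∮ w in C(0, σ), k w) = ∮ w in C(0, σ), (h w - (w - z)⁻¹ • A) :=
      circleIntegral.integral_congr hσ.le fun w hw =>
        hkeq w (sub_ne_zero.mp (hne w (sphere_subset_closedBall hw)))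
    rw [h1, circleIntegral.integral_sub, hzero, sub_zero]
    · refine ContinuousOn.circleIntegrable hσ.le fun w hw => ?_
      have hw' := mem_sphere_zero_iff_norm.mp hw
      exact (hd w (hw' ▸ hσ) (hw' ▸ hσz.trans hzρ)
        (sub_ne_zero.mp (hne w (sphere_subset_closedBall hw)))).continuousAt.continuousWithinAt
    · exact ContinuousOn.circleIntegrable hσ.le fun w hw =>
        (hinvd w (sphere_subset_closedBall hw)).continuousAt.continuousWithinAt
  rwa [hann, hinner] at main

end PrincipalValue

/-! ### Differentiation under the integral sign. -/

section ParametricIntegral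

open MeasureTheory

variable {P E E' : Type*} [NormedAddCommGroup P] [NormedSpace ℂ P]
  [NormedAddCommGroup E] [NormedSpace ℂ E] [CompleteSpace E]
  [NormedAddCommGroup E'] [NormedSpace ℂ E']

theorem continuous_fderiv_of_analyticAt {Φ : P × ℂ → E} {γ : ℝ → ℂ} (hγ : Continuous γ)
    {y₀ : P} (h : ∀ θ, AnalyticAt ℂ Φ (y₀, γ θ)) :
    Continuous fun θ => fderiv ℂ Φ (y₀, γ θ) := by
  refine continuous_iff_continuousAt.mpr fun θ => ?_
  exact ContinuousAt.comp (f := fun θ => (y₀, γ θ)) (g := fderiv ℂ Φ) (h θ).fderiv.continuousAt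
    (continuous_const.prodMk hγ).continuousAt

/-- Differentiation under the integral sign over a compact path, for analytic integrands. -/
theorem hasFDerivAt_integral_of_analyticAt {Φ : P × ℂ → E} {γ : ℝ → ℂ} (hγ : Continuous γ)
    {K : ℝ → E →L[ℂ] E'} (hK : Continuous K) {a b : ℝ} {y₀ : P}
    (h : ∀ θ, AnalyticAt ℂ Φ (y₀, γ θ)) :
    HasFDerivAt (fun y => ∫ θ in a..b, K θ (Φ (y, γ θ)))
      (∫ θ in a..b, (K θ).comp ((fderiv ℂ Φ (y₀, γ θ)).comp (ContinuousLinearMap.inl ℂ P ℂ)))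
      y₀ := by
  have hdc := continuous_fderiv_of_analyticAt hγ h
  obtain ⟨C, hC⟩ := (isCompact_uIcc (a := a) (b := b)).exists_bound_of_continuousOn
    hdc.continuousOn
  obtain ⟨D, hD⟩ := (isCompact_uIcc (a := a) (b := b)).exists_bound_of_continuousOn
    hK.continuousOn
  -- Analyticity and the strict derivative bound are open conditions in `(y, θ)`. Compactness of the
  -- path gives one neighbourhood of `y₀` for all `θ`, and with it a constant dominating function.
  have hev : ∀ᶠ y in 𝓝 y₀, ∀ θ ∈ Set.uIcc a b,
      AnalyticAt ℂ Φ (y, γ θ) ∧ ‖fderiv ℂ Φ (y, γ θ)‖ < C + 1 := by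
    refine isCompact_uIcc.eventually_forall_of_forall_eventually fun θ hθ => ?_
    have hcont : Tendsto (fun p : P × ℝ => (p.1, γ p.2)) (𝓝 (y₀, θ)) (𝓝 (y₀, γ θ)) :=
      (continuous_fst.prodMk (hγ.comp continuous_snd)).tendsto (y₀, θ)
    have hlt : ‖fderiv ℂ Φ (y₀, γ θ)‖ < C + 1 := (hC θ hθ).trans_lt (lt_add_one C)
    exact hcont.eventually ((h θ).eventually_analyticAt.and
      ((h θ).fderiv.continuousAt.norm.eventually (gt_mem_nhds hlt)))
  have hsub : Set.uIoc a b ⊆ Set.uIcc a b := Set.uIoc_subset_uIcc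
  refine intervalIntegral.hasFDerivAt_integral_of_dominated_of_fderiv_le
    (F' := fun y θ => (K θ).comp ((fderiv ℂ Φ (y, γ θ)).comp (ContinuousLinearMap.inl ℂ P ℂ)))
    (bound := fun _ => D * ((C + 1) * ‖ContinuousLinearMap.inl ℂ P ℂ‖)) hev ?_ ?_ ?_ ?_ ?_ ?_
  · filter_upwards [hev] with y hy
    refine ContinuousOn.aestronglyMeasurable (fun θ hθ => ?_) measurableSet_uIoc
    refine ContinuousAt.continuousWithinAt ?_
    exact hK.continuousAt.clm_apply (ContinuousAt.comp (f := fun θ => (y, γ θ)) (g := Φ)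
      (hy θ (hsub hθ)).1.continuousAt (continuous_const.prodMk hγ).continuousAt)
  · refine Continuous.intervalIntegrable ?_ a b
    refine hK.clm_apply (continuous_iff_continuousAt.mpr fun θ => ?_)
    exact ContinuousAt.comp (f := fun θ => (y₀, γ θ)) (g := Φ)
      (h θ).continuousAt (continuous_const.prodMk hγ).continuousAt
  · exact (hK.clm_comp (hdc.clm_comp continuous_const)).aestronglyMeasurable
  · refine ae_of_all _ fun θ hθ y hy => ?_
    refine (ContinuousLinearMap.opNorm_comp_le _ _).trans ?_
    refine mul_le_mul (hD θ (hsub hθ)) ((ContinuousLinearMap.opNorm_comp_le _ _).trans ?_)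
      (norm_nonneg _) ((norm_nonneg _).trans (hD θ (hsub hθ)))
    exact mul_le_mul_of_nonneg_right (hy θ (hsub hθ)).2.le (norm_nonneg _)
  · exact intervalIntegrable_const
  · refine ae_of_all _ fun θ hθ y hy => ?_
    have h1 : HasFDerivAt (fun y : P => (y, γ θ)) (ContinuousLinearMap.inl ℂ P ℂ) y :=
      hasFDerivAt_prodMk_left y (γ θ)
    have h2 := (hy θ (hsub hθ)).1.differentiableAt.hasFDerivAt.comp y h1
    exact (K θ).hasFDerivAt.comp y h2

theorem fderiv_integral_apply_of_analyticAt [CompleteSpace E'] {Φ : P × ℂ → E} {γ : ℝ → ℂ}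
    (hγ : Continuous γ) {K : ℝ → E →L[ℂ] E'} (hK : Continuous K) {a b : ℝ} {y₀ : P}
    (h : ∀ θ, AnalyticAt ℂ Φ (y₀, γ θ)) (v : P) :
    fderiv ℂ (fun y => ∫ θ in a..b, K θ (Φ (y, γ θ))) y₀ v
      = ∫ θ in a..b, K θ (fderiv ℂ (fun y => Φ (y, γ θ)) y₀ v) := by
  have hc : Continuous fun θ =>
      (K θ).comp ((fderiv ℂ Φ (y₀, γ θ)).comp (ContinuousLinearMap.inl ℂ P ℂ)) :=
    hK.clm_comp ((continuous_fderiv_of_analyticAt hγ h).clm_comp continuous_const)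
  rw [(hasFDerivAt_integral_of_analyticAt hγ hK h).fderiv,
    ContinuousLinearMap.intervalIntegral_apply (hc.intervalIntegrable a b)]
  refine intervalIntegral.integral_congr fun θ _ => ?_
  have h5 : HasFDerivAt (fun y => Φ (y, γ θ)) _ y₀ :=
    HasFDerivAt.comp (g := Φ) (f := fun y => (y, γ θ)) y₀
      (h θ).differentiableAt.hasFDerivAt (hasFDerivAt_prodMk_left _ _)
  rw [h5.fderiv]
  rfl

end ParametricIntegral

/-! ### Geometric sequences in `ℓ¹`, the kernel of Cauchy's coefficient formula. -/

section GeometricSequences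

variable (E : Type*) [NormedAddCommGroup E] [NormedSpace ℂ E]

/-- `v ↦ (tⁿ v)ₙ`, as a map to `ℓ¹`, for `|t| < 1`. -/
noncomputable def geomSeq (t : ℂ) : E →L[ℂ] lp (fun _ : ℕ => E) 1 :=
  ∑' n : ℕ, t ^ n • lp.singleContinuousLinearMap ℂ (fun _ : ℕ => E) 1 n

variable {E}

theorem norm_single_le_one (n : ℕ) :
    ‖lp.singleContinuousLinearMap ℂ (fun _ : ℕ => E) 1 n‖ ≤ 1 := by
  refine ContinuousLinearMap.opNorm_le_bound _ zero_le_one fun v => ?_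
  rw [lp.singleContinuousLinearMap_apply, lp.norm_single (by norm_num), one_mul]

theorem norm_pow_smul_single_le {t : ℂ} {q : ℝ} (ht : ‖t‖ ≤ q) (n : ℕ) :
    ‖t ^ n • lp.singleContinuousLinearMap ℂ (fun _ : ℕ => E) 1 n‖ ≤ q ^ n := by
  rw [norm_smul, norm_pow]
  calc ‖t‖ ^ n * _ ≤ q ^ n * 1 := by
        gcongr
        · exact pow_nonneg ((norm_nonneg t).trans ht) n
        · exact norm_single_le_one n
    _ = q ^ n := mul_one _

variable [CompleteSpace E]

theorem geomSeq_apply {t : ℂ} (ht : ‖t‖ < 1) (v : E) (n : ℕ) : geomSeq E t v n = t ^ n • v := by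
  have hs : Summable fun n : ℕ => t ^ n • lp.singleContinuousLinearMap ℂ (fun _ : ℕ => E) 1 n :=
    Summable.of_norm_bounded (summable_geometric_of_lt_one (norm_nonneg t) ht)
      (norm_pow_smul_single_le le_rfl)
  have h1 := (ContinuousLinearMap.apply ℂ _ v).hasSum hs.hasSum
  have h2 := (lp.evalCLM ℂ (fun _ : ℕ => E) 1 n).hasSum h1
  have h3 : (lp.evalCLM ℂ (fun _ : ℕ => E) 1 n) ((ContinuousLinearMap.apply ℂ _ v)
      (∑' n : ℕ, t ^ n • lp.singleContinuousLinearMap ℂ (fun _ : ℕ => E) 1 n))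
        = geomSeq E t v n := rfl
  rw [h3] at h2
  refine h2.unique ?_
  convert hasSum_ite_eq n (t ^ n • v) using 2 with m
  simp only [ContinuousLinearMap.apply_apply, map_smul]
  rw [lp.singleContinuousLinearMap_apply]
  change t ^ m • (lp.single 1 m v : lp (fun _ : ℕ => E) 1) n = _
  by_cases hmn : m = n
  · subst hmn
    simp
  · rw [lp.single_apply_ne _ _ _ (Ne.symm hmn), if_neg hmn, smul_zero]

/-- The defining series converges uniformly in operator norm on `|t| ≤ q`. This continuity makes the
`ℓ¹`-valued Cauchy kernel integrable over a circle. -/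
theorem continuousOn_geomSeq {q : ℝ} (hq : q < 1) (hq0 : 0 ≤ q) :
    ContinuousOn (geomSeq E) (Metric.closedBall 0 q) :=
  continuousOn_tsum (fun n => (continuous_pow n).continuousOn.smul continuousOn_const)
    (summable_geometric_of_lt_one hq0 hq)
    fun n _ ht => norm_pow_smul_single_le (mem_closedBall_zero_iff.mp ht) n

/-- For summable `a`, the map `x ↦ ∑ aₙ xₙ` is linear and continuous on `ℓ¹`. -/
theorem exists_clm_hasSum {a : ℕ → ℂ} (ha : Summable fun n => ‖a n‖) :
    ∃ T : lp (fun _ : ℕ => E) 1 →L[ℂ] E, ∀ x : lp (fun _ : ℕ => E) 1,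
      HasSum (fun n => a n • x n) (T x) := by
  have hx : ∀ x : lp (fun _ : ℕ => E) 1, Summable fun n => a n • x n := fun x => by
    refine Summable.of_norm_bounded (ha.mul_right ‖x‖) fun n => ?_
    rw [norm_smul]
    exact mul_le_mul_of_nonneg_left (lp.norm_apply_le_norm one_ne_zero x n) (norm_nonneg _)
  let T₀ : lp (fun _ : ℕ => E) 1 →ₗ[ℂ] E :=
    { toFun := fun x => ∑' n, a n • x n
      map_add' := fun x y => by
        rw [← (hx x).tsum_add (hx y)]
        exact tsum_congr fun n => smul_add _ _ _
      map_smul' := fun c x => by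
        rw [RingHom.id_apply, ← (hx x).tsum_const_smul c]
        exact tsum_congr fun n => smul_comm _ _ _ }
  refine ⟨T₀.mkContinuous (∑' n, ‖a n‖) fun x => ?_, fun x => (hx x).hasSum⟩
  rw [← tsum_mul_right]
  refine tsum_of_norm_bounded (ha.mul_right ‖x‖).hasSum fun n => ?_
  rw [norm_smul]
  exact mul_le_mul_of_nonneg_left (lp.norm_apply_le_norm one_ne_zero x n) (norm_nonneg _)

end GeometricSequences

/-! ### Values of loops, and holomorphic families of loops. -/

section LoopValues

open Metric Complex

variable {V : Type*} [AddCommGroup V] [Module ℂ V] [FiniteDimensional ℂ V]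

/-- In finite dimension unconditional convergence is absolute, so convergence at one point controls
the norms of the coefficients on its circle. -/
theorem summable_norm_of_hasSum_laurent {n : ℕ} {c : ℤ → Fin n → ℂ} {z : ℂ} {a : Fin n → ℂ}
    (h : HasSum (fun k : ℤ => z ^ k • c k) a) : Summable fun k : ℤ => ‖c k‖ * ‖z‖ ^ k := by
  refine (summable_norm_iff.mpr h.summable).congr fun k => ?_
  rw [norm_smul, norm_zpow, mul_comm]

theorem Loop.summable_of_hasValue {X : Loop V} {z : ℂ} {v : V} (h : X.HasValue z v) :
    Summable fun k : ℤ => ‖coords V (X.1 k)‖ * ‖z‖ ^ k :=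
  summable_norm_of_hasSum_laurent h

theorem Loop.hasValue_eval {X : Loop V} {z : ℂ}
    (h : Summable fun k : ℤ => ‖coords V (X.1 k)‖ * ‖z‖ ^ k) : X.HasValue z (X.eval z) := by
  have hs : Summable fun k : ℤ => z ^ k • coords V (X.1 k) := by
    refine Summable.of_norm (h.congr fun k => ?_)
    rw [norm_smul, norm_zpow, mul_comm]
  unfold Loop.HasValue Loop.eval
  rw [LinearEquiv.apply_symm_apply]
  exact hs.hasSum

theorem Loop.HasValue.eval_eq {X : Loop V} {z : ℂ} {v : V} (h : X.HasValue z v) :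
    X.eval z = v := by
  unfold Loop.eval
  rw [HasSum.tsum_eq h, LinearEquiv.symm_apply_apply]

theorem exists_pos_forall_of_eventually_punctured {p : ℂ → Prop}
    (h : ∀ᶠ z in 𝓝[≠] (0 : ℂ), p z) : ∃ ε > 0, ∀ z : ℂ, 0 < ‖z‖ → ‖z‖ < ε → p z := by
  rw [eventually_nhdsWithin_iff, Metric.eventually_nhds_iff] at h
  obtain ⟨ε, hε, h⟩ := h
  exact ⟨ε, hε, fun z h0 h1 => h (by simpa using h1) (norm_pos_iff.mp h0)⟩

theorem eventually_punctured_of_forall {p : ℂ → Prop} {ε : ℝ} (hε : 0 < ε)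
    (h : ∀ z : ℂ, 0 < ‖z‖ → ‖z‖ < ε → p z) : ∀ᶠ z in 𝓝[≠] (0 : ℂ), p z := by
  rw [eventually_nhdsWithin_iff, Metric.eventually_nhds_iff]
  exact ⟨ε, hε, fun z h1 h0 => h z (norm_pos_iff.mpr h0) (by simpa using h1)⟩

/-- A Laurent series is determined by its values near `0`. -/
theorem Loop.eq_of_hasValue {X Y : Loop V} {F : ℂ → V}
    (hX : ∀ᶠ z in 𝓝[≠] (0 : ℂ), X.HasValue z (F z))
    (hY : ∀ᶠ z in 𝓝[≠] (0 : ℂ), Y.HasValue z (F z)) : X = Y := by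
  obtain ⟨ε, hε, h⟩ := exists_pos_forall_of_eventually_punctured (hX.and hY)
  have hs : 0 < ε / 2 := half_pos hε
  have hmem : ∀ z ∈ sphere (0 : ℂ) (ε / 2), X.HasValue z (F z) ∧ Y.HasValue z (F z) := by
    intro z hz
    rw [mem_sphere_zero_iff_norm] at hz
    exact h z (hz ▸ hs) (hz ▸ half_lt_self hε)
  have hz : ((ε / 2 : ℝ) : ℂ) ∈ sphere (0 : ℂ) (ε / 2) := by
    rw [mem_sphere_zero_iff_norm, norm_real, Real.norm_of_nonneg hs.le]
  have hnorm := mem_sphere_zero_iff_norm.mp hz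
  have sX := Loop.summable_of_hasValue (hmem _ hz).1
  have sY := Loop.summable_of_hasValue (hmem _ hz).2
  rw [hnorm] at sX sY
  refine Subtype.ext (funext fun k => (coords V).injective ?_)
  have e1 := circleIntegral_zpow_smul_laurent (F := fun z => coords V (F z)) hs sX
    (fun z hz => (hmem z hz).1) (-1 - k)
  have e2 := circleIntegral_zpow_smul_laurent (F := fun z => coords V (F z)) hs sY
    (fun z hz => (hmem z hz).2) (-1 - k)
  rw [e1] at e2
  have hpi : (2 * Real.pi * I : ℂ) ≠ 0 := two_pi_I_ne_zero
  simpa using smul_right_injective _ hpi e2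

theorem Loop.ofFun_eq {X : Loop V} {F : ℂ → V}
    (hX : ∀ᶠ z in 𝓝[≠] (0 : ℂ), X.HasValue z (F z)) : Loop.ofFun F = X := by
  have h : ∃ X : Loop V, ∀ᶠ z in 𝓝[≠] (0 : ℂ), X.HasValue z (F z) := ⟨X, hX⟩
  rw [Loop.ofFun, dif_pos h]
  exact Loop.eq_of_hasValue h.choose_spec hX

theorem exists_loop_of_bounded {F : ℂ → V} {R : ℝ} (hR : 0 < R)
    (hd : ∀ z, 0 < ‖z‖ → ‖z‖ < R → DifferentiableAt ℂ (fun z => coords V (F z)) z) {C : ℝ}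
    (hb : ∀ᶠ z in 𝓝[≠] (0 : ℂ), ‖z • coords V (F z)‖ ≤ C) :
    ∃ X : Loop V, (∀ n < -1, X.1 n = 0) ∧ ∀ z, 0 < ‖z‖ → ‖z‖ < R → X.HasValue z (F z) := by
  obtain ⟨c, hc0, hc⟩ := exists_laurent_of_bounded hd hb
  have hmem : (fun n => (coords V).symm (c n)) ∈ loopSubmodule V := by
    refine ⟨⟨-1, fun n hn => by simp [hc0 n hn]⟩, R, hR, fun s hs hsR => ?_⟩
    have hn : ‖(s : ℂ)‖ = s := by rw [norm_real, Real.norm_of_nonneg hs.le]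
    have := summable_norm_of_hasSum_laurent (hc s (hn.symm ▸ hs) (hn.symm ▸ hsR))
    simpa [hn, hs.le, abs_of_pos hs] using this
  refine ⟨⟨_, hmem⟩, fun n hn => by simp [hc0 n hn], fun z h0 h1 => ?_⟩
  unfold Loop.HasValue
  simpa using hc z h0 h1

/-- A function which is holomorphic in a punctured disc, with at most a simple pole, is the sum of
its Laurent series in the whole punctured disc. -/
theorem Loop.hasValue_of_eventually {X : Loop V} {F : ℂ → V} {R : ℝ}
    (hd : ∀ z, 0 < ‖z‖ → ‖z‖ < R → DifferentiableAt ℂ (fun z => coords V (F z)) z) {C : ℝ}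
    (hb : ∀ᶠ z in 𝓝[≠] (0 : ℂ), ‖z • coords V (F z)‖ ≤ C)
    (hX : ∀ᶠ z in 𝓝[≠] (0 : ℂ), X.HasValue z (F z)) {z : ℂ} (h0 : 0 < ‖z‖) (h1 : ‖z‖ < R) :
    X.HasValue z (F z) := by
  have hR := h0.trans h1
  obtain ⟨Y, -, hY⟩ := exists_loop_of_bounded hR hd hb
  rw [Loop.eq_of_hasValue hX (eventually_punctured_of_forall hR hY)]
  exact hY z h0 h1

/-- After multiplication by `z` only exponents `k + 1 ≥ 0` remain, and `|z|^(k+1) ≤ s^(k+1)`. This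
recovers the simple-pole bound from the series alone. -/
theorem Loop.norm_smul_coords_le {X : Loop V} (hX : ∀ n < -1, X.1 n = 0) {s : ℝ}
    (hs : Summable fun k : ℤ => ‖coords V (X.1 k)‖ * s ^ k) {z : ℂ} (h0 : 0 < ‖z‖) (h1 : ‖z‖ ≤ s)
    {v : V} (hv : X.HasValue z v) :
    ‖z • coords V v‖ ≤ s * ∑' k : ℤ, ‖coords V (X.1 k)‖ * s ^ k := by
  have hs0 := h0.trans_le h1
  have h := hv.const_smul z
  rw [← h.tsum_eq]
  refine tsum_of_norm_bounded (hs.hasSum.mul_left s) fun k => ?_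
  rcases lt_or_ge k (-1) with hk | hk
  · simp [hX k hk]
  · rw [norm_smul, norm_smul, norm_zpow]
    have e : ∀ t : ℝ, 0 < t → t * t ^ k = t ^ (k + 1) := fun t ht => by
      rw [zpow_add₀ ht.ne', zpow_one, mul_comm]
    calc ‖z‖ * (‖z‖ ^ k * ‖coords V (X.1 k)‖) = ‖coords V (X.1 k)‖ * (‖z‖ * ‖z‖ ^ k) := by ring
      _ ≤ ‖coords V (X.1 k)‖ * (s * s ^ k) := by
        rw [e _ h0, e _ hs0]
        gcongr
        exact zpow_le_zpow_left₀ (by omega) h0.le h1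
      _ = _ := by ring

theorem Loop.step_apply_of_lt {ρ : ℝ} (hρ : 0 < ρ) (x : SeqSpace V) {n : ℤ} (hn : n < -1) :
    (Loop.step 1 hρ x).1 n = 0 := by
  have h : ¬ -((1 : ℕ) : ℤ) ≤ n := by push_cast; omega
  simp only [Loop.step, if_neg h]

theorem Loop.step_hasValue_iff {ρ : ℝ} (hρ : 0 < ρ) (x : SeqSpace V) (z : ℂ) (v : V) :
    (Loop.step 1 hρ x).HasValue z v ↔
      HasSum (fun n : ℕ => (z ^ ((n : ℤ) - 1) * ((ρ : ℂ) ^ n)⁻¹) • x n) (coords V v) := by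
  unfold Loop.HasValue
  rw [hasSum_int_iff_hasSum_nat (N := 1)]
  · suffices h : (fun n : ℕ => z ^ ((n : ℤ) - 1) • coords V ((Loop.step 1 hρ x).1 (n - 1)))
        = fun n : ℕ => (z ^ ((n : ℤ) - 1) * ((ρ : ℂ) ^ n)⁻¹) • x n by rw [h]
    funext n
    have hn : -((1 : ℕ) : ℤ) ≤ (n : ℤ) - 1 := by push_cast; omega
    simp only [Loop.step, if_pos hn, map_smul, LinearEquiv.apply_symm_apply, smul_smul]
    simp
  · intro k hk
    rw [Loop.step_apply_of_lt hρ x hk, map_zero, smul_zero]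

theorem Loop.step_add_smul (N : ℕ) {ρ : ℝ} (hρ : 0 < ρ) (x y : SeqSpace V) (s : ℂ) :
    Loop.step N hρ (x + s • y) = Loop.step N hρ x + s • Loop.step N hρ y := by
  refine Subtype.ext (funext fun k => ?_)
  by_cases h : -(N : ℤ) ≤ k
  · have e : (x + s • y : SeqSpace V) (k + N).toNat
        = x (k + N).toNat + s • y (k + N).toNat := rfl
    simp only [Loop.step, Submodule.coe_add, Submodule.coe_smul, Pi.add_apply, Pi.smul_apply,
      if_pos h, e, map_add, map_smul, smul_add, smul_comm s]
  · simp [Loop.step, h]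

/-- A family of functions with at most simple poles at `0`, depending holomorphically on a
parameter, is a differentiable map to one of the steps. -/
theorem exists_hasFDerivAt_step {P : Type*} [NormedAddCommGroup P] [NormedSpace ℂ P]
    {Φ : P × ℂ → Fin (Module.finrank ℂ V) → ℂ} {y₀ : P} {δ : ℝ} (hδ : 0 < δ)
    (hA : ∀ᶠ y in 𝓝 y₀, ∀ z : ℂ, 0 < ‖z‖ → ‖z‖ < δ → AnalyticAt ℂ Φ (y, z))
    (hb : ∀ᶠ y in 𝓝 y₀, ∃ C : ℝ, ∀ᶠ z in 𝓝[≠] (0 : ℂ), ‖z • Φ (y, z)‖ ≤ C) :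
    ∃ (ρ : ℝ) (hρ : 0 < ρ) (Γ : P → SeqSpace V) (Γ' : P →L[ℂ] SeqSpace V),
      HasFDerivAt Γ Γ' y₀ ∧
      (∀ᶠ y in 𝓝 y₀, ∀ z : ℂ, 0 < ‖z‖ → ‖z‖ < ρ →
        (Loop.step 1 hρ (Γ y)).HasValue z ((coords V).symm (Φ (y, z)))) ∧
      ∀ (v : P) (z : ℂ), 0 < ‖z‖ → ‖z‖ < ρ → (Loop.step 1 hρ (Γ' v)).HasValue z
        ((coords V).symm (fderiv ℂ (fun y => Φ (y, z)) y₀ v)) := by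
  -- Coefficients are computed on `|w| = s` and recorded in the step of radius `ρ = s/2`. Thus
  -- `|ρ/w| = 1/2` on the contour and the geometric sequences lie in `ℓ¹`.
  set s := δ / 2 with hs_def
  have hs : 0 < s := half_pos hδ
  have hsδ : s < δ := half_lt_self hδ
  set ρ := s / 2 with hρ_def
  have hρ : 0 < ρ := half_pos hs
  have hρs : ρ < s := half_lt_self hs
  have hγ := continuous_circleMap 0 s
  have hnorm : ∀ θ, ‖circleMap 0 s θ‖ = s := fun θ => by simp [abs_of_pos hs]
  have hne : ∀ θ, circleMap 0 s θ ≠ 0 := fun θ => circleMap_ne_center hs.ne'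
  have ht : ∀ θ, ‖(ρ : ℂ) / circleMap 0 s θ‖ = 1 / 2 := fun θ => by
    rw [norm_div, hnorm, norm_real, Real.norm_of_nonneg hρ.le, hρ_def]
    field_simp
  -- All Cauchy formulas at once: entry `n` of `∫ K θ (Φ …)` is `ρⁿ (2πi)⁻¹ ∮ w⁻ⁿ Φ dw`, which is
  -- `ρⁿ` times the coefficient of `zⁿ⁻¹`.
  set K : ℝ → (Fin (Module.finrank ℂ V) → ℂ) →L[ℂ] SeqSpace V := fun θ =>
    (2 * Real.pi * I : ℂ)⁻¹ • deriv (circleMap 0 s) θ •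
      geomSeq (Fin (Module.finrank ℂ V) → ℂ) ((ρ : ℂ) / circleMap 0 s θ) with hK_def
  have hK : Continuous K := by
    suffices h : Continuous fun θ =>
        geomSeq (Fin (Module.finrank ℂ V) → ℂ) ((ρ : ℂ) / circleMap 0 s θ) from
      ((continuous_deriv_circleMap s).smul h).const_smul ((2 * Real.pi * I : ℂ)⁻¹)
    refine (continuousOn_geomSeq (q := 1 / 2) (by norm_num) (by norm_num)).comp_continuous
      (continuous_const.div hγ hne) fun θ => ?_
    rw [mem_closedBall_zero_iff, ht]
  have hder := hasFDerivAt_integral_of_analyticAt (a := 0) (b := 2 * Real.pi) (Φ := Φ) hγ hK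
    (y₀ := y₀) fun θ => hA.self_of_nhds _ (by rw [hnorm]; exact hs) (by rw [hnorm]; exact hsδ)
  set Γ : P → SeqSpace V := fun y => ∫ θ in (0 : ℝ)..2 * Real.pi, K θ (Φ (y, circleMap 0 s θ))
  have hval : ∀ᶠ y in 𝓝 y₀, ∀ z : ℂ, 0 < ‖z‖ → ‖z‖ < ρ →
      (Loop.step 1 hρ (Γ y)).HasValue z ((coords V).symm (Φ (y, z))) := by
    filter_upwards [hA, hb] with y hAy ⟨C, hC⟩ z h0 h1
    have hdz : ∀ z, 0 < ‖z‖ → ‖z‖ < δ → DifferentiableAt ℂ (fun z => Φ (y, z)) z :=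
      fun z h0 h1 => (hAy z h0 h1).differentiableAt.comp z
        ((differentiableAt_const y).prodMk differentiableAt_id)
    obtain ⟨c, hc0, hc⟩ := exists_laurent_of_bounded hdz hC
    have hsph : ∀ z ∈ sphere (0 : ℂ) s, 0 < ‖z‖ ∧ ‖z‖ < δ := fun z hz => by
      rw [mem_sphere_zero_iff_norm] at hz
      exact ⟨hz ▸ hs, hz ▸ hsδ⟩
    have hsum : Summable fun n : ℤ => ‖c n‖ * s ^ n := by
      have hn : ‖(s : ℂ)‖ = s := by rw [norm_real, Real.norm_of_nonneg hs.le]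
      have := summable_norm_of_hasSum_laurent (hc s (hn.symm ▸ hs) (hn.symm ▸ hsδ))
      rwa [hn] at this
    have hcoef : ∀ n : ℕ, Γ y n = (ρ : ℂ) ^ n • c (n - 1) := by
      intro n
      have hcont : Continuous fun θ => K θ (Φ (y, circleMap 0 s θ)) := by
        refine hK.clm_apply (continuous_iff_continuousAt.mpr fun θ => ?_)
        exact ContinuousAt.comp (f := fun θ => (y, circleMap 0 s θ)) (g := Φ)
          (hAy _ (by rw [hnorm]; exact hs) (by rw [hnorm]; exact hsδ)).continuousAt
          (continuous_const.prodMk hγ).continuousAt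
      have e1 := ContinuousLinearMap.intervalIntegral_comp_comm
        (lp.evalCLM ℂ (fun _ : ℕ => Fin (Module.finrank ℂ V) → ℂ) 1 n)
        (hcont.intervalIntegrable (μ := MeasureTheory.volume) 0 (2 * Real.pi))
      have e2 : Γ y n = lp.evalCLM ℂ (fun _ : ℕ => Fin (Module.finrank ℂ V) → ℂ) 1 n (Γ y) := rfl
      have e3 := circleIntegral_zpow_smul_laurent hs hsum (fun z hz => hc z (hsph z hz).1
        (hsph z hz).2) (-n)
      rw [e2, ← e1]
      have e4 : ∀ θ, lp.evalCLM ℂ (fun _ : ℕ => Fin (Module.finrank ℂ V) → ℂ) 1 n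
          (K θ (Φ (y, circleMap 0 s θ))) = ((2 * Real.pi * I : ℂ)⁻¹ * (ρ : ℂ) ^ n) •
            (deriv (circleMap 0 s) θ • (circleMap 0 s θ) ^ (-(n : ℤ)) •
              Φ (y, circleMap 0 s θ)) := fun θ => by
        have : lp.evalCLM ℂ (fun _ : ℕ => Fin (Module.finrank ℂ V) → ℂ) 1 n
          (K θ (Φ (y, circleMap 0 s θ))) = (2 * Real.pi * I : ℂ)⁻¹ • deriv (circleMap 0 s) θ •
            (geomSeq (Fin (Module.finrank ℂ V) → ℂ) ((ρ : ℂ) / circleMap 0 s θ)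
              (Φ (y, circleMap 0 s θ))) n := rfl
        rw [this, geomSeq_apply (by rw [ht]; norm_num)]
        simp only [smul_smul, div_pow, zpow_neg, zpow_natCast]
        congr 1
        ring
      simp only [e4]
      rw [intervalIntegral.integral_smul]
      have e5 : (∫ θ in (0 : ℝ)..2 * Real.pi, deriv (circleMap 0 s) θ •
          (circleMap 0 s θ) ^ (-(n : ℤ)) • Φ (y, circleMap 0 s θ))
          = (2 * Real.pi * I : ℂ) • c (-1 - -n) := e3
      rw [e5, smul_smul, show (-1 - -(n : ℤ)) = n - 1 by ring]
      congr 1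
      have := two_pi_I_ne_zero
      field_simp
    rw [Loop.step_hasValue_iff]
    simp only [hcoef, LinearEquiv.apply_symm_apply]
    have := hc z h0 (h1.trans (hρs.trans hsδ))
    rw [hasSum_int_iff_hasSum_nat (N := 1) (fun k hk => by simp [hc0 k hk])] at this
    have e : (fun n : ℕ => (z ^ ((n : ℤ) - 1) * ((ρ : ℂ) ^ n)⁻¹) • (ρ : ℂ) ^ n • c (n - 1))
        = fun n : ℕ => z ^ ((n : ℤ) - 1) • c (n - 1) := funext fun n => by
      rw [smul_smul, mul_assoc, inv_mul_cancel₀ (pow_ne_zero _ (ofReal_ne_zero.mpr hρ.ne')),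
        mul_one]
    rw [e]
    exact this
  refine ⟨ρ, hρ, Γ, _, hder, hval, fun v z h0 h1 => ?_⟩
  have hz0 : z ≠ 0 := norm_pos_iff.mp h0
  have hsum : Summable fun n : ℕ => ‖z ^ ((n : ℤ) - 1) * ((ρ : ℂ) ^ n)⁻¹‖ := by
    have hq : ‖z‖ / ρ < 1 := (div_lt_one hρ).mpr h1
    refine ((summable_geometric_of_lt_one (by positivity) hq).mul_left ‖z‖⁻¹).congr fun n => ?_
    rw [norm_mul, norm_zpow, norm_inv, norm_pow, norm_real, Real.norm_of_nonneg hρ.le,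
      zpow_sub₀ h0.ne', zpow_natCast, zpow_one, div_pow]
    ring
  -- Evaluation at `z` is a continuous linear map on the step because `|z| < ρ`, so it commutes with
  -- differentiation in `y`.
  obtain ⟨T, hT⟩ := exists_clm_hasSum (E := Fin (Module.finrank ℂ V) → ℂ) hsum
  rw [Loop.step_hasValue_iff, LinearEquiv.apply_symm_apply]
  have hcomp := T.hasFDerivAt.comp y₀ hder
  have heq : (fun y => Φ (y, z)) =ᶠ[𝓝 y₀] (T ∘ Γ) := by
    filter_upwards [hval] with y hy
    have h2 := hy z h0 h1
    rw [Loop.step_hasValue_iff, LinearEquiv.apply_symm_apply] at h2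
    exact h2.unique (hT (Γ y))
  rw [(hcomp.congr_of_eventuallyEq heq).fderiv]
  exact hT _

end LoopValues

section CoordinateBilinear

variable {V W : Type*} [AddCommGroup V] [Module ℂ V] [FiniteDimensional ℂ V]
  [AddCommGroup W] [Module ℂ W] [FiniteDimensional ℂ W]
  {E : Type*} [NormedAddCommGroup E] [NormedSpace ℂ E]

/-- A linear map on `V`, in coordinates. -/
noncomputable def coordsCLM (f : V →ₗ[ℂ] E) : (Fin (Module.finrank ℂ V) → ℂ) →L[ℂ] E :=
  LinearMap.toContinuousLinearMap (f ∘ₗ (coords V).symm.toLinearMap)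

theorem coordsCLM_apply (f : V →ₗ[ℂ] E) (c : Fin (Module.finrank ℂ V) → ℂ) :
    coordsCLM f c = f ((coords V).symm c) := rfl

@[simp] theorem coordsCLM_coords (f : V →ₗ[ℂ] E) (v : V) : coordsCLM f (coords V v) = f v := by
  rw [coordsCLM_apply, LinearEquiv.symm_apply_apply]

/-- A bilinear map on `V × W`, in coordinates. -/
noncomputable def coordsBilin (f : V →ₗ[ℂ] W →ₗ[ℂ] E) :
    (Fin (Module.finrank ℂ V) → ℂ) →L[ℂ] (Fin (Module.finrank ℂ W) → ℂ) →L[ℂ] E :=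
  coordsCLM ((LinearMap.toContinuousLinearMap (𝕜 := ℂ) (E := Fin (Module.finrank ℂ W) → ℂ)
    (F' := E)).toLinearMap ∘ₗ f.compl₂ (coords W).symm.toLinearMap)

theorem coordsBilin_apply (f : V →ₗ[ℂ] W →ₗ[ℂ] E) (c : Fin (Module.finrank ℂ V) → ℂ)
    (d : Fin (Module.finrank ℂ W) → ℂ) :
    coordsBilin f c d = f ((coords V).symm c) ((coords W).symm d) := rfl

@[simp] theorem coordsBilin_coords (f : V →ₗ[ℂ] W →ₗ[ℂ] E) (v : V) (w : W) :
    coordsBilin f (coords V v) (coords W w) = f v w := by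
  rw [coordsBilin_apply, LinearEquiv.symm_apply_apply, LinearEquiv.symm_apply_apply]

end CoordinateBilinear

/-! ### The residue pairing as a contour integral. -/

section Pairing

open Metric Complex

variable {V : Type*} [AddCommGroup V] [Module ℂ V] [FiniteDimensional ℂ V]

/-- Both series are bounded below, which confines `n` to an interval; finite sums and `tsum` then
agree. -/
theorem Loop.finite_support_pairing {W : Type*} [AddCommGroup W] [Module ℂ W]
    [FiniteDimensional ℂ W] (X : Loop V) (Y : Loop W) {A : Type*} [Zero A] (b : V → W → A)
    (hb0 : ∀ w, b 0 w = 0) (hb1 : ∀ v, b v 0 = 0) (j : ℤ) :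
    (Function.support fun n : ℤ => b (X.1 n) (Y.1 (j - n))).Finite := by
  obtain ⟨X, ⟨N, hN⟩, -⟩ := X
  obtain ⟨Y, ⟨M, hM⟩, -⟩ := Y
  refine (Set.finite_Icc N (j - M)).subset fun i hi => ?_
  by_contra hcon
  rw [Set.mem_Icc, not_and_or, not_le, not_le] at hcon
  refine hi ?_
  rcases hcon with h | h
  · simp [hN i h, hb0]
  · simp [hM (j - i) (by omega), hb1]

theorem Loop.pairing_eq_finsum (M : Loop (Module.Dual ℂ V)) (Y : Loop V) :
    Loop.pairing M Y = ∑ᶠ n : ℤ, M.1 n (Y.1 (-1 - n)) := by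
  unfold Loop.pairing
  let e : ℤ ≃ ℤ := ⟨fun n => -1 - n, fun n => -1 - n, fun n => by ring, fun n => by ring⟩
  rw [← finsum_comp_equiv e]
  refine finsum_congr fun n => ?_
  simp [e]

/-- The pairing as a contour integral. -/
theorem Loop.pairing_eq_circleIntegral (M : Loop (Module.Dual ℂ V)) (Y : Loop V) {s : ℝ}
    (hs : 0 < s) (hM : Summable fun n => ‖coords _ (M.1 n)‖ * s ^ n)
    (hY : Summable fun n => ‖coords _ (Y.1 n)‖ * s ^ n) :
    Loop.pairing M Y
      = (2 * Real.pi * I : ℂ)⁻¹ * ∮ w in C(0, s), M.eval w (Y.eval w) := by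
  have hval : ∀ {W : Type _} [AddCommGroup W] [Module ℂ W] [FiniteDimensional ℂ W] (X : Loop W),
      (Summable fun n => ‖coords _ (X.1 n)‖ * s ^ n) → ∀ z ∈ sphere (0 : ℂ) s,
      HasSum (fun n : ℤ => z ^ n • coords _ (X.1 n)) (coords _ (X.eval z)) := by
    intro W _ _ _ X hX z hz
    refine Loop.hasValue_eval ?_
    rwa [mem_sphere_zero_iff_norm.mp hz]
  have h := hasSum_circleIntegral_bilin (coordsBilin (LinearMap.id : Module.Dual ℂ V →ₗ[ℂ] _)) hs
    hM hY (hval M hM) (hval Y hY)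
  simp only [coordsBilin_coords, LinearMap.id_apply] at h
  rw [← h.tsum_eq, tsum_eq_finsum, Loop.pairing_eq_finsum, ← smul_finsum, smul_eq_mul,
    inv_mul_cancel_left₀ two_pi_I_ne_zero]
  refine (Loop.finite_support_pairing M Y (fun a b => a b) (by simp) (by simp) (-1)).subset
    fun n hn h0 => hn ?_
  beta_reduce at h0 ⊢
  rw [h0, smul_zero]

end Pairing

/-! ### From ad-invariance on loops to pointwise invariance. -/

section Invariance

variable {g : Type*} [LieRing g] [LieAlgebra ℂ g] [FiniteDimensional ℂ g]

/-- Provides the monomial loops `y zᵏ` as test elements for ad-invariance. -/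
theorem Loop.single_mem (k : ℤ) (y : g) :
    (fun n : ℤ => if n = k then y else 0) ∈ loopSubmodule g := by
  refine ⟨⟨k, fun n hn => if_neg hn.ne⟩, 1, one_pos, fun s _ _ => ?_⟩
  refine summable_of_ne_finset_zero (s := {k}) fun n hn => ?_
  have : n ≠ k := by simpa using hn
  simp [this]

theorem tsum_eq_zero_of_antidiagonal {f : ℤ × ℤ → ℂ} (hf : Summable f)
    (h : ∀ j : ℤ, ∑' n : ℤ, f (n, j - n) = 0) : ∑' p, f p = 0 := by
  let e : ℤ × ℤ ≃ ℤ × ℤ :=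
    ⟨fun p => (p.2, p.1 - p.2), fun p => (p.1 + p.2, p.1), fun p => by simp, fun p => by simp⟩
  have hfe : Summable (f ∘ e) := e.summable_iff.mpr hf
  rw [← e.tsum_eq f]
  exact (hfe.tsum_prod).trans ((tsum_congr h).trans tsum_zero)

/-- Ad-invariance holds pointwise. -/
theorem Loop.AdInvariant.eval_lie_eq_zero {df : Loop g → Loop (Module.Dual ℂ g)}
    (h : Loop.AdInvariant df) (X : Loop g) {w : ℂ} (hw : w ≠ 0)
    (hM : Summable fun n => ‖coords _ ((df X).1 n)‖ * ‖w‖ ^ n)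
    (hX : Summable fun n => ‖coords _ (X.1 n)‖ * ‖w‖ ^ n) (y : g) :
    (df X).eval w ⁅y, X.eval w⁆ = 0 := by
  set M := df X with hMdef
  -- The test loop `y z^(-1-j)` isolates the coefficient of `zʲ` in `M(z)([y, X(z)])`.
  have hcoef : ∀ j : ℤ, ∑' n : ℤ, M.1 n ⁅y, X.1 (j - n)⁆ = 0 := by
    intro j
    have h1 := h X ⟨_, Loop.single_mem (-1 - j) y⟩
    rw [Loop.pairing_eq_finsum] at h1
    rw [tsum_eq_finsum, ← h1]
    · refine finsum_congr fun n => ?_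
      change _ = M.1 n (∑ᶠ i : ℤ, ⁅(if i = -1 - j then y else 0), X.1 (-1 - n - i)⁆)
      rw [finsum_eq_single _ (-1 - j) fun i hi => by rw [if_neg hi, zero_lie], if_pos rfl]
      congr 3
      ring_nf
    · exact Loop.finite_support_pairing M X (fun a b => a ⁅y, b⁆) (by simp) (by simp) j
  let B := coordsBilin ((LinearMap.id : Module.Dual ℂ g →ₗ[ℂ] _).compl₂
    (LieAlgebra.ad ℂ g y : g →ₗ[ℂ] g))
  have hB : ∀ (m : Module.Dual ℂ g) (x : g), B (coords _ m) (coords _ x) = m ⁅y, x⁆ := fun m x => by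
    simp [B]
  have hMv := Loop.hasValue_eval hM
  have hXv := Loop.hasValue_eval hX
  set f : ℤ × ℤ → ℂ := fun p => B (w ^ p.1 • coords _ (M.1 p.1)) (w ^ p.2 • coords _ (X.1 p.2))
    with hf
  have hfs : Summable f := by
    have h2 := (hM.mul_of_nonneg hX (fun n => by positivity) (fun n => by positivity)).mul_left ‖B‖
    refine Summable.of_norm_bounded h2 fun p => ?_
    refine (B.le_opNorm₂ _ _).trans (le_of_eq ?_)
    rw [norm_smul, norm_smul, norm_zpow, norm_zpow]
    ring
  -- The absolutely convergent double series `f` is summed in two ways: by rows it is the value at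
  -- `w`, by antidiagonals every coefficient vanishes.
  have e1 : ∑' p, f p = M.eval w ⁅y, X.eval w⁆ := by
    rw [hfs.tsum_prod, ← hB]
    have h3 : ∀ n : ℤ, ∑' m : ℤ, f (n, m) = B (w ^ n • coords _ (M.1 n)) (coords _ (X.eval w)) :=
      fun n => ((B (w ^ n • coords _ (M.1 n))).hasSum hXv).tsum_eq
    simp only [h3]
    exact ((B.flip (coords _ (X.eval w))).hasSum hMv).tsum_eq
  have e2 : ∑' p, f p = 0 := by
    refine tsum_eq_zero_of_antidiagonal hfs fun j => ?_
    have h5 : ∀ n : ℤ, f (n, j - n) = w ^ j * M.1 n ⁅y, X.1 (j - n)⁆ := by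
      intro n
      simp only [hf, map_smul, smul_eq_mul]
      rw [_root_.smul_apply, hB, smul_eq_mul, ← mul_assoc, ← zpow_add₀ hw, sub_add_cancel]
    simp only [h5]
    rw [tsum_mul_left, hcoef, mul_zero]
  rw [← e1, e2]

end Invariance

/-! ### Holomorphy in linear coordinates. -/

section Holomorphy

variable {V W : Type*} [AddCommGroup V] [Module ℂ V] [FiniteDimensional ℂ V]
  [AddCommGroup W] [Module ℂ W] [FiniteDimensional ℂ W]
  {P : Type*} [NormedAddCommGroup P] [NormedSpace ℂ P]

theorem HolAt.analyticAt_comp {F : V → W} {γ : P → V} {p : P} (hF : HolAt F (γ p))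
    (hγ : AnalyticAt ℂ (fun p => coords V (γ p)) p) :
    AnalyticAt ℂ (fun p => coords W (F (γ p))) p := by
  have h := AnalyticAt.comp (g := inCoords F) (f := fun p => coords V (γ p)) hF hγ
  simpa [Function.comp_def, inCoords] using h

theorem analyticAt_coords_linear [FiniteDimensional ℂ P] (f : P →ₗ[ℂ] V) (p : P) :
    AnalyticAt ℂ (fun p => coords V (f p)) p :=
  (LinearMap.toContinuousLinearMap ((coords V).toLinearMap ∘ₗ f)).analyticAt p

theorem analyticAt_coords_linear_fst (f : V →ₗ[ℂ] W)
    (p : (Fin (Module.finrank ℂ V) → ℂ) × ℂ) :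
    AnalyticAt ℂ (fun p : (Fin (Module.finrank ℂ V) → ℂ) × ℂ =>
      coords W (f ((coords V).symm p.1))) p := by
  have h : AnalyticAt ℂ (coordsCLM ((coords W).toLinearMap ∘ₗ f)) p.1 :=
    ContinuousLinearMap.analyticAt _ _
  exact AnalyticAt.comp (g := coordsCLM ((coords W).toLinearMap ∘ₗ f)) (f := Prod.fst) h
    analyticAt_fst

theorem AnalyticAt.clm_bilin {E E₁ E₂ : Type*} [NormedAddCommGroup E] [NormedSpace ℂ E]
    [NormedAddCommGroup E₁] [NormedSpace ℂ E₁] [NormedAddCommGroup E₂] [NormedSpace ℂ E₂]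
    {f : P → E} {f₁ : P → E₁} {p : P} (hf : AnalyticAt ℂ f p) (B : E →L[ℂ] E₁ →L[ℂ] E₂)
    (hf₁ : AnalyticAt ℂ f₁ p) : AnalyticAt ℂ (fun p => B (f p) (f₁ p)) p :=
  AnalyticAt.comp₂ (h := fun q : E × E₁ => B q.1 q.2) (B.analyticAt_bilinear _) hf hf₁

end Holomorphy

/-! ### The r-matrix and the Lax function in coordinates. -/

section RMatrix

variable {g : Type*} [LieRing g] [LieAlgebra ℂ g] [FiniteDimensional ℂ g]
  {H : LieSubalgebra ℂ g} {r : Module.Dual ℂ H × ℂ → g ⊗[ℂ] g}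

/-- `r` in coordinates. -/
noncomputable def rCoords (r : Module.Dual ℂ H × ℂ → g ⊗[ℂ] g)
    (p : (Fin (Module.finrank ℂ (Module.Dual ℂ H)) → ℂ) × ℂ) :
    Fin (Module.finrank ℂ (g ⊗[ℂ] g)) → ℂ :=
  coords (g ⊗[ℂ] g) (r ((coords (Module.Dual ℂ H)).symm p.1, p.2))

theorem HolAt.analyticAt_rCoords {c : Fin (Module.finrank ℂ (Module.Dual ℂ H)) → ℂ} {z : ℂ}
    (h : HolAt r ((coords (Module.Dual ℂ H)).symm c, z)) : AnalyticAt ℂ (rCoords r) (c, z) :=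
  HolAt.analyticAt_comp
    (γ := fun p : (Fin (Module.finrank ℂ (Module.Dual ℂ H)) → ℂ) × ℂ =>
      ((coords (Module.Dual ℂ H)).symm p.1, p.2)) h
    (analyticAt_coords_linear (((coords (Module.Dual ℂ H)).symm.toLinearMap).prodMap LinearMap.id)
      (c, z))

theorem HolAt.analyticAt_rCoords_coords {q : Module.Dual ℂ H} {z : ℂ}
    (h : HolAt r (q, z)) : AnalyticAt ℂ (rCoords r) (coords (Module.Dual ℂ H) q, z) :=
  HolAt.analyticAt_rCoords (by rwa [LinearEquiv.symm_apply_apply])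

/-- The chosen basis of `h* × ℂ` is unrelated to that of `h*`, so a linear change of coordinates is
needed. This direction makes regularity an open condition in the pair `(q, z)`. -/
theorem HolAt.of_analyticAt_rCoords {c : Fin (Module.finrank ℂ (Module.Dual ℂ H)) → ℂ} {z : ℂ}
    (h : AnalyticAt ℂ (rCoords r) (c, z)) : HolAt r ((coords (Module.Dual ℂ H)).symm c, z) := by
  let f : (Fin (Module.finrank ℂ (Module.Dual ℂ H × ℂ)) → ℂ) →ₗ[ℂ]
      (Fin (Module.finrank ℂ (Module.Dual ℂ H)) → ℂ) × ℂ :=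
    ((coords (Module.Dual ℂ H)).toLinearMap.prodMap LinearMap.id) ∘ₗ
      (coords (Module.Dual ℂ H × ℂ)).symm.toLinearMap
  have hf : f (coords _ ((coords (Module.Dual ℂ H)).symm c, z)) = (c, z) := by simp [f]
  have h2 := AnalyticAt.comp (f := f) (g := rCoords r) (by rw [hf]; exact h)
    ((LinearMap.toContinuousLinearMap f).analyticAt _)
  have e : rCoords r ∘ f = inCoords r := by
    funext d
    simp [f, rCoords, inCoords]
  rw [e] at h2
  exact h2

theorem HolAt.eventually {q : Module.Dual ℂ H} {z : ℂ} (h : HolAt r (q, z)) :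
    ∀ᶠ p : (Fin (Module.finrank ℂ (Module.Dual ℂ H)) → ℂ) × ℂ in
      𝓝 (coords (Module.Dual ℂ H) q, z), HolAt r ((coords (Module.Dual ℂ H)).symm p.1, p.2) :=
  h.analyticAt_rCoords_coords.eventually_analyticAt.mono fun _ hp =>
    HolAt.of_analyticAt_rCoords hp

/-- The derivative of `r(·, z)` at `q`. -/
noncomputable def baseDeriv (r : Module.Dual ℂ H × ℂ → g ⊗[ℂ] g) (q : Module.Dual ℂ H) (z : ℂ) :
    Module.Dual ℂ H →ₗ[ℂ] g ⊗[ℂ] g :=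
  (coords (g ⊗[ℂ] g)).symm.toLinearMap ∘ₗ
    (fderiv ℂ (fun c => rCoords r (c, z)) (coords (Module.Dual ℂ H) q)).toLinearMap ∘ₗ
      (coords (Module.Dual ℂ H)).toLinearMap

theorem HolAt.hasDerivAt_base {q : Module.Dual ℂ H} {z : ℂ} (h : HolAt r (q, z))
    (a : Module.Dual ℂ H) :
    HasDerivAt (fun s : ℂ => coords (g ⊗[ℂ] g) (r (q + s • a, z)))
      (coords (g ⊗[ℂ] g) (baseDeriv r q z a)) 0 := by
  have h1 : DifferentiableAt ℂ (fun c => rCoords r (c, z)) (coords (Module.Dual ℂ H) q) :=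
    DifferentiableAt.comp (g := rCoords r) (f := fun c => (c, z)) (coords (Module.Dual ℂ H) q)
      h.analyticAt_rCoords_coords.differentiableAt
      (differentiableAt_id.prodMk (differentiableAt_const z))
  have h2 : HasDerivAt (fun s : ℂ => coords (Module.Dual ℂ H) q + s • coords (Module.Dual ℂ H) a)
      (coords (Module.Dual ℂ H) a) 0 := by
    simpa using ((hasDerivAt_id (0 : ℂ)).smul_const (coords (Module.Dual ℂ H) a)).const_add
      (coords (Module.Dual ℂ H) q)
  have h3 := HasFDerivAt.comp_hasDerivAt_of_eq (0 : ℂ) h1.hasFDerivAt h2 (by simp)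
  have e1 : (fun s : ℂ => coords (g ⊗[ℂ] g) (r (q + s • a, z))) = (fun c => rCoords r (c, z)) ∘
      fun s : ℂ => coords (Module.Dual ℂ H) q + s • coords (Module.Dual ℂ H) a := by
    funext s
    simp [rCoords, ← map_smul, ← map_add]
  have e2 : coords (g ⊗[ℂ] g) (baseDeriv r q z a) = fderiv ℂ (fun c => rCoords r (c, z))
      (coords (Module.Dual ℂ H) q) (coords (Module.Dual ℂ H) a) := by
    simp [baseDeriv]
  rw [e1, e2]
  exact h3

/-- At a regular point the derivative along a line is a value of the Fréchet derivative and so is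
linear in `a`; the passage from coordinate derivatives to `i*ξ` rests on this. -/
theorem HolAt.derivBase_eq {q : Module.Dual ℂ H} {z : ℂ} (h : HolAt r (q, z))
    (a : Module.Dual ℂ H) : derivBase r a q z = baseDeriv r q z a := by
  unfold derivBase derivZero
  rw [(h.hasDerivAt_base a).deriv, LinearEquiv.symm_apply_apply]

variable (g) in
/-- The contraction of the second factor, in coordinates. -/
noncomputable def contrSndCoords :
    (Fin (Module.finrank ℂ (Module.Dual ℂ g)) → ℂ) →L[ℂ]
      (Fin (Module.finrank ℂ (g ⊗[ℂ] g)) → ℂ) →L[ℂ] (Fin (Module.finrank ℂ g) → ℂ) :=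
  coordsBilin ((contrSndHom g).compr₂ (coords g).toLinearMap)

variable (g) in
/-- The contraction of the first factor, in coordinates. -/
noncomputable def contrFstCoords :
    (Fin (Module.finrank ℂ (Module.Dual ℂ g)) → ℂ) →L[ℂ]
      (Fin (Module.finrank ℂ (g ⊗[ℂ] g)) → ℂ) →L[ℂ] (Fin (Module.finrank ℂ g) → ℂ) :=
  coordsBilin ((contrFstHom g).compr₂ (coords g).toLinearMap)

theorem contrSndCoords_coords (ξ : Module.Dual ℂ g) (s : g ⊗[ℂ] g) :
    contrSndCoords g (coords _ ξ) (coords _ s) = coords g (contrSnd ξ s) :=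
  coordsBilin_coords _ _ _

theorem contrFstCoords_coords (ξ : Module.Dual ℂ g) (s : g ⊗[ℂ] g) :
    contrFstCoords g (coords _ ξ) (coords _ s) = coords g (contrFst ξ s) :=
  coordsBilin_coords _ _ _

theorem coords_laxAt (x : Phase H) (z : ℂ) :
    coords g (laxAt r x z) = coords g (x.2.1 : g)
      + contrSndCoords g (coords _ x.2.2) (coords _ (r (x.1, z))) := by
  rw [contrSndCoords_coords, laxAt, map_add]

theorem HolAt.hasDerivAt_laxAt {x : Phase H} {z : ℂ} (h : HolAt r (x.1, z)) (v : Phase H) :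
    HasDerivAt (fun s : ℂ => coords g (laxAt r (x + s • v) z))
      (coords g (laxDeriv x.2.2 (r (x.1, z)) (baseDeriv r x.1 z) v)) 0 := by
  have line : ∀ {n : ℕ} (a b : Fin n → ℂ), HasDerivAt (fun s : ℂ => a + s • b) b 0 :=
    fun a b => by simpa using ((hasDerivAt_id (0 : ℂ)).smul_const b).const_add a
  have h1 := (contrSndCoords g).hasFDerivAt.comp_hasDerivAt (0 : ℂ)
    (line (coords _ x.2.2) (coords _ v.2.2))
  have h2 := h1.clm_apply (h.hasDerivAt_base v.1)
  have h3 := (line (coords g (x.2.1 : g)) (coords g (v.2.1 : g))).add h2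
  have e1 : (fun s : ℂ => coords g (laxAt r (x + s • v) z)) =
      (fun s : ℂ => coords g (x.2.1 : g) + s • coords g (v.2.1 : g)) + fun s : ℂ =>
        (contrSndCoords g ∘ fun s : ℂ => coords _ x.2.2 + s • coords _ v.2.2) s
          (coords _ (r (x.1 + s • v.1, z))) := by
    funext s
    have : coords g (laxAt r (x + s • v) z) = coords g ((x.2.1 : g) + s • (v.2.1 : g))
      + contrSndCoords g (coords _ (x.2.2 + s • v.2.2)) (coords _ (r (x.1 + s • v.1, z))) :=
      coords_laxAt _ _
    rw [this]
    simp only [map_add, map_smul, Pi.add_apply, Function.comp_apply]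
  have e2 : coords g (laxDeriv x.2.2 (r (x.1, z)) (baseDeriv r x.1 z) v) =
      coords g (v.2.1 : g) +
        (contrSndCoords g (coords _ v.2.2) (coords _ (r (x.1 + (0 : ℂ) • v.1, z))) +
          (contrSndCoords g ∘ fun s : ℂ => coords _ x.2.2 + s • coords _ v.2.2) 0
            (coords _ (baseDeriv r x.1 z v.1))) := by
    simp only [Function.comp_apply, zero_smul, add_zero, contrSndCoords_coords, laxDeriv_apply,
      map_add, add_assoc]
  rw [e1, e2]
  exact h3

theorem HolAt.dirDeriv_laxAt {x : Phase H} {z : ℂ} (h : HolAt r (x.1, z)) (η : Module.Dual ℂ g)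
    (v : Phase H) : dirDeriv (fun y => η (laxAt r y z)) x v
      = η (laxDeriv x.2.2 (r (x.1, z)) (baseDeriv r x.1 z) v) := by
  have := (coordsCLM η).hasFDerivAt.comp_hasDerivAt (0 : ℂ) (h.hasDerivAt_laxAt v)
  simp only [Function.comp_def, coordsCLM_coords] at this
  exact this.deriv

/-- The Lax function in coordinates. -/
noncomputable def laxCoords (r : Module.Dual ℂ H × ℂ → g ⊗[ℂ] g)
    (p : (Fin (Module.finrank ℂ (Phase H)) → ℂ) × ℂ) : Fin (Module.finrank ℂ g) → ℂ :=
  coords g (laxAt r ((coords (Phase H)).symm p.1) p.2)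

variable (H) in
/-- `(q, p, ξ) ↦ q`. -/
def phaseBase : Phase H →ₗ[ℂ] Module.Dual ℂ H where
  toFun x := x.1
  map_add' _ _ := rfl
  map_smul' _ _ := rfl

variable (H) in
/-- `(q, p, ξ) ↦ p`. -/
def phaseMomentum : Phase H →ₗ[ℂ] g where
  toFun x := x.2.1
  map_add' _ _ := rfl
  map_smul' _ _ := rfl

variable (H) in
/-- `(q, p, ξ) ↦ ξ`. -/
def phaseSpin : Phase H →ₗ[ℂ] Module.Dual ℂ g where
  toFun x := x.2.2
  map_add' _ _ := rfl
  map_smul' _ _ := rfl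

theorem HolAt.analyticAt_laxCoords {y : Fin (Module.finrank ℂ (Phase H)) → ℂ} {z : ℂ}
    (h : HolAt r (((coords (Phase H)).symm y).1, z)) : AnalyticAt ℂ (laxCoords r) (y, z) := by
  have h1 : AnalyticAt ℂ (fun p : (Fin (Module.finrank ℂ (Phase H)) → ℂ) × ℂ =>
      coords g (((coords (Phase H)).symm p.1).2.1 : g)) (y, z) :=
    analyticAt_coords_linear_fst (phaseMomentum H) (y, z)
  have h2 : AnalyticAt ℂ (fun p : (Fin (Module.finrank ℂ (Phase H)) → ℂ) × ℂ =>
      coords (Module.Dual ℂ g) ((coords (Phase H)).symm p.1).2.2) (y, z) :=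
    analyticAt_coords_linear_fst (phaseSpin H) (y, z)
  have h3 : AnalyticAt ℂ (fun p : (Fin (Module.finrank ℂ (Phase H)) → ℂ) × ℂ =>
      coords (Module.Dual ℂ H) ((coords (Phase H)).symm p.1).1) (y, z) :=
    analyticAt_coords_linear_fst (phaseBase H) (y, z)
  have h0 : AnalyticAt ℂ (rCoords r) (coords (Module.Dual ℂ H) ((coords (Phase H)).symm y).1, z) :=
    h.analyticAt_rCoords_coords
  have h4 : AnalyticAt ℂ (fun p : (Fin (Module.finrank ℂ (Phase H)) → ℂ) × ℂ =>
      rCoords r (coords (Module.Dual ℂ H) ((coords (Phase H)).symm p.1).1, p.2)) (y, z) :=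
    AnalyticAt.comp (g := rCoords r)
      (f := fun p : (Fin (Module.finrank ℂ (Phase H)) → ℂ) × ℂ =>
        (coords (Module.Dual ℂ H) ((coords (Phase H)).symm p.1).1, p.2)) h0
      (h3.prod analyticAt_snd)
  have h5 := h1.add (h2.clm_bilin (contrSndCoords g) h4)
  refine h5.congr (Eventually.of_forall fun p => ?_)
  rw [laxCoords, coords_laxAt, Pi.add_apply, rCoords, LinearEquiv.symm_apply_apply]

theorem HolAt.fderiv_laxCoords {x : Phase H} {z : ℂ} (h : HolAt r (x.1, z)) (v : Phase H) :
    fderiv ℂ (fun y => laxCoords r (y, z)) (coords _ x) (coords _ v)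
      = coords g (laxDeriv x.2.2 (r (x.1, z)) (baseDeriv r x.1 z) v) := by
  have ha : AnalyticAt ℂ (laxCoords r) (coords _ x, z) :=
    HolAt.analyticAt_laxCoords (by rwa [LinearEquiv.symm_apply_apply])
  have h1 : DifferentiableAt ℂ (fun y => laxCoords r (y, z)) (coords _ x) :=
    DifferentiableAt.comp (g := laxCoords r) (f := fun c => (c, z)) (coords (Phase H) x)
      ha.differentiableAt (differentiableAt_id.prodMk (differentiableAt_const z))
  have h2 : HasDerivAt (fun s : ℂ => coords (Phase H) x + s • coords (Phase H) v)
      (coords (Phase H) v) 0 := by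
    simpa using ((hasDerivAt_id (0 : ℂ)).smul_const (coords (Phase H) v)).const_add
      (coords (Phase H) x)
  have h3 := HasFDerivAt.comp_hasDerivAt_of_eq (0 : ℂ) h1.hasFDerivAt h2 (by simp)
  refine h3.unique ?_
  have e1 : (fun y => laxCoords r (y, z)) ∘
      (fun s : ℂ => coords (Phase H) x + s • coords (Phase H) v)
        = fun s : ℂ => coords g (laxAt r (x + s • v) z) := by
    funext s
    simp [laxCoords, ← map_smul, ← map_add]
  rw [e1]
  exact h.hasDerivAt_laxAt v

end RMatrix

/-! ### The Lax map into the loop algebra and its bracket relations. -/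

section LaxMap

variable {g : Type*} [LieRing g] [LieAlgebra ℂ g] [FiniteDimensional ℂ g]
  {H : LieSubalgebra ℂ g} {r : Module.Dual ℂ H × ℂ → g ⊗[ℂ] g}

theorem baseDomain_eventually {q : Module.Dual ℂ H} (hq : q ∈ baseDomain r) :
    ∀ᶠ c in 𝓝 (coords (Module.Dual ℂ H) q), (coords (Module.Dual ℂ H)).symm c ∈ baseDomain r := by
  obtain ⟨δ, hδ, h⟩ := hq
  filter_upwards [eventually_eventually_nhds.mpr h] with c hc
  exact ⟨δ, hδ, by rwa [LinearEquiv.apply_symm_apply]⟩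

theorem exists_regularBelow_of_mem_baseDomain {q : Module.Dual ℂ H} (hq : q ∈ baseDomain r) :
    ∃ δ > 0, RegularBelow r q δ := by
  obtain ⟨δ, hδ, h⟩ := hq
  refine ⟨δ, hδ, fun z h0 h1 => ?_⟩
  simpa using h.self_of_nhds z h0 h1

theorem HolAt.differentiableAt_laxAt {x : Phase H} {z : ℂ} (h : HolAt r (x.1, z)) :
    DifferentiableAt ℂ (fun z => coords g (laxAt r x z)) z := by
  have ha : AnalyticAt ℂ (laxCoords r) (coords _ x, z) :=
    HolAt.analyticAt_laxCoords (by rwa [LinearEquiv.symm_apply_apply])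
  have h1 := DifferentiableAt.comp (g := laxCoords r) (f := fun z => (coords (Phase H) x, z)) z
    ha.differentiableAt ((differentiableAt_const _).prodMk differentiableAt_id)
  simpa [Function.comp_def, laxCoords] using h1

theorem tendsto_coords_base (x : Phase H) :
    Tendsto (fun y => coords (Module.Dual ℂ H) ((coords (Phase H)).symm y).1)
      (𝓝 (coords _ x)) (𝓝 (coords (Module.Dual ℂ H) x.1)) := by
  have h := (coordsCLM ((coords (Module.Dual ℂ H)).toLinearMap ∘ₗ phaseBase H)).continuous.tendsto
    (coords _ x)
  rwa [coordsCLM_coords] at h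

variable [LieAlgebra.IsSimple ℂ g]

theorem IsDynamicalRMatrix.tendsto_smul (hr : IsDynamicalRMatrix H r) {q : Module.Dual ℂ H}
    (hq : q ∈ baseDomain r) {W : Type*} [AddCommGroup W] [Module ℂ W] [FiniteDimensional ℂ W]
    (A : g ⊗[ℂ] g →ₗ[ℂ] W) :
    Tendsto (fun z : ℂ => z • coords W (A (r (q, z)))) (𝓝[≠] 0) (𝓝 (coords W (A (casimir g)))) := by
  have h := ((coordsCLM ((coords W).toLinearMap ∘ₗ A)).continuous.tendsto _).comp (hr.residue q hq)
  simp only [Function.comp_def, coordsCLM_coords, LinearMap.comp_apply, LinearEquiv.coe_coe,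
    map_smul] at h
  exact h

/-- `z L(z)` tends to the contraction of `Ω` with `ξ`, so it is bounded near `0`. -/
theorem IsDynamicalRMatrix.exists_bound_laxAt (hr : IsDynamicalRMatrix H r) {x : Phase H}
    (hx : x.1 ∈ baseDomain r) :
    ∃ C : ℝ, ∀ᶠ z in 𝓝[≠] (0 : ℂ), ‖z • coords g (laxAt r x z)‖ ≤ C := by
  have h1 := hr.tendsto_smul hx (contrSnd x.2.2)
  have h2 : Tendsto (fun z : ℂ => z • coords g (x.2.1 : g)) (𝓝[≠] 0) (𝓝 0) := by
    have hc : Continuous fun z : ℂ => z • coords g (x.2.1 : g) := continuous_id.smul continuous_const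
    have := (hc.tendsto 0).mono_left (nhdsWithin_le_nhds (s := {(0 : ℂ)}ᶜ))
    rwa [zero_smul] at this
  have h3 := (h2.add h1).norm
  obtain ⟨C, hC⟩ := h3.isBoundedUnder_le
  refine ⟨C, ?_⟩
  rw [eventually_map] at hC
  filter_upwards [hC] with z hz
  rwa [laxAt, map_add, smul_add]

/-- The Lax map takes values in the loop algebra. -/
theorem IsDynamicalRMatrix.lax_hasValue (hr : IsDynamicalRMatrix H r) {x : Phase H}
    (hx : x.1 ∈ baseDomain r) {ρ : ℝ} (hρ : RegularBelow r x.1 ρ) {z : ℂ} (h0 : 0 < ‖z‖)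
    (h1 : ‖z‖ < ρ) : (lax r x).HasValue z (laxAt r x z) := by
  obtain ⟨C, hC⟩ := hr.exists_bound_laxAt hx
  obtain ⟨X, -, hX⟩ := exists_loop_of_bounded (h0.trans h1)
    (fun z h0 h1 => (hρ z h0 h1).differentiableAt_laxAt) hC
  rw [lax, Loop.ofFun_eq (eventually_punctured_of_forall (h0.trans h1) hX)]
  exact hX z h0 h1

/-- The fundamental Poisson bracket relations. -/
theorem IsDynamicalRMatrix.laxBracket_eq (hr : IsDynamicalRMatrix H r) (x : Phase H) {z w : ℂ}
    (hz : HolAt r (x.1, z)) (hw : HolAt r (x.1, w)) (hzw : HolAt r (x.1, z - w)) :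
    laxBracket x.2.2 (r (x.1, z)) (r (x.1, w)) (baseDeriv r x.1 z) (baseDeriv r x.1 w) =
      -(lieSlotOne (r (x.1, z - w)) (laxAt r x z) + lieSlotTwo (r (x.1, z - w)) (laxAt r x w))
        - baseDeriv r x.1 (z - w) (restrictDual H x.2.2) := by
  refine _root_.laxBracket_eq x.2.1 x.2.2 _ _ _ _ _ (baseDeriv r x.1 (z - w))
    (hr.zeroWeight _ _ hzw _ x.2.1.2) ?_
  -- With third point `0` the arguments `z₁₃` and `z₂₃` become those of the two Lax functions.
  have h := hr.cdybe x.1 z w 0 hzw (by rwa [sub_zero]) (by rwa [sub_zero])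
  simpa only [altDeriv, sub_zero, hz.derivBase_eq, hw.derivBase_eq, hzw.derivBase_eq] using h

theorem IsDynamicalRMatrix.poissonTensor_eq (hr : IsDynamicalRMatrix H r) (x : Phase H) {z w : ℂ}
    (hz : HolAt r (x.1, z)) (hw : HolAt r (x.1, w)) (hzw : HolAt r (x.1, z - w)) :
    poissonTensor (fun y => laxAt r y z) (fun y => laxAt r y w) x =
      -(lieSlotOne (r (x.1, z - w)) (laxAt r x z) + lieSlotTwo (r (x.1, z - w)) (laxAt r x w))
        - derivBase r (restrictDual H x.2.2) x.1 (z - w) := by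
  rw [hzw.derivBase_eq, ← hr.laxBracket_eq x hz hw hzw]
  exact poissonTensor_eq_laxBracket hz.dirDeriv_laxAt hw.dirDeriv_laxAt

theorem IsDynamicalRMatrix.flipTensor_eq (hr : IsDynamicalRMatrix H r) {q : Module.Dual ℂ H}
    {z w : ℂ} (hzw : HolAt r (q, z - w)) (hwz : HolAt r (q, w - z)) :
    flipTensor (r (q, w - z)) = -r (q, z - w) := by
  have h := hr.unitarity q (z - w) hzw (by rwa [neg_sub])
  rw [neg_sub] at h
  exact eq_neg_of_add_eq_zero_right h

theorem IsDynamicalRMatrix.poissonTensor_eq_flip (hr : IsDynamicalRMatrix H r) (x : Phase H)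
    {z w : ℂ} (hz : HolAt r (x.1, z)) (hw : HolAt r (x.1, w)) (hzw : HolAt r (x.1, z - w))
    (hwz : HolAt r (x.1, w - z)) :
    poissonTensor (fun y => laxAt r y z) (fun y => laxAt r y w) x =
      -lieSlotOne (r (x.1, z - w)) (laxAt r x z)
        + lieSlotTwo (flipTensor (r (x.1, w - z))) (laxAt r x w)
        - derivBase r (restrictDual H x.2.2) x.1 (z - w) := by
  rw [hr.poissonTensor_eq x hz hw hzw, hr.flipTensor_eq hzw hwz, neg_add]
  simp only [lieSlotTwo, map_neg]

/-- Near a point of the phase space the Lax map is a differentiable map to one of the steps. -/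
theorem IsDynamicalRMatrix.exists_hasFDerivAt_lax (hr : IsDynamicalRMatrix H r) {x : Phase H}
    (hx : x.1 ∈ baseDomain r) :
    ∃ (ρ : ℝ) (hρ : 0 < ρ) (Γ : (Fin (Module.finrank ℂ (Phase H)) → ℂ) → SeqSpace g)
      (Γ' : (Fin (Module.finrank ℂ (Phase H)) → ℂ) →L[ℂ] SeqSpace g),
      HasFDerivAt Γ Γ' (coords _ x) ∧
      (∀ᶠ y in 𝓝 (coords _ x), Loop.step 1 hρ (Γ y) = lax r ((coords (Phase H)).symm y)) ∧
      ∀ (v : Phase H) (R : ℝ), RegularBelow r x.1 R → ∀ z : ℂ, 0 < ‖z‖ → ‖z‖ < R →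
        (Loop.step 1 hρ (Γ' (coords _ v))).HasValue z
          (laxDeriv x.2.2 (r (x.1, z)) (baseDeriv r x.1 z) v) := by
  have hcont := tendsto_coords_base x
  have hbase : ∀ᶠ y in 𝓝 (coords _ x), ((coords (Phase H)).symm y).1 ∈ baseDomain r := by
    filter_upwards [hcont.eventually (baseDomain_eventually hx)] with y hy
    rwa [LinearEquiv.symm_apply_apply] at hy
  have hb : ∀ᶠ y in 𝓝 (coords _ x), ∃ C : ℝ, ∀ᶠ z in 𝓝[≠] (0 : ℂ),
      ‖z • laxCoords r (y, z)‖ ≤ C := by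
    filter_upwards [hbase] with y hy
    exact hr.exists_bound_laxAt (x := (coords (Phase H)).symm y) hy
  obtain ⟨δ, hδ, hδ'⟩ := id hx
  have hA : ∀ᶠ y in 𝓝 (coords _ x), ∀ z : ℂ, 0 < ‖z‖ → ‖z‖ < δ →
      AnalyticAt ℂ (laxCoords r) (y, z) := by
    filter_upwards [hcont.eventually hδ'] with y hy z h0 h1
    have := hy z h0 h1
    rw [LinearEquiv.symm_apply_apply] at this
    exact HolAt.analyticAt_laxCoords (y := y) this
  obtain ⟨ρ, hρ, Γ, Γ', hder, hval, hval'⟩ := exists_hasFDerivAt_step hδ hA hb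
  refine ⟨ρ, hρ, Γ, Γ', hder, ?_, fun v R hR z h0 h1 => ?_⟩
  · filter_upwards [hval] with y hy
    refine (Loop.ofFun_eq (eventually_punctured_of_forall hρ fun z h0 h1 => ?_)).symm
    have := hy z h0 h1
    rwa [laxCoords, LinearEquiv.symm_apply_apply] at this
  · have hreg := exists_regularBelow_of_mem_baseDomain hx
    obtain ⟨δ', hδ', hreg⟩ := hreg
    have hev : ∀ z : ℂ, 0 < ‖z‖ → ‖z‖ < min ρ δ' → (Loop.step 1 hρ (Γ' (coords _ v))).HasValue z
          (laxDeriv x.2.2 (r (x.1, z)) (baseDeriv r x.1 z) v) := fun z h0 h1 => by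
      have h2 := hval' (coords _ v) z h0 (h1.trans_le (min_le_left _ _))
      rwa [(hreg z h0 (h1.trans_le (min_le_right _ _))).fderiv_laxCoords,
        LinearEquiv.symm_apply_apply] at h2
    have hm : 0 < min ρ δ' := lt_min hρ hδ'
    have hs : 0 < min ρ δ' / 2 := half_pos hm
    have hn : ‖((min ρ δ' / 2 : ℝ) : ℂ)‖ = min ρ δ' / 2 := by
      rw [Complex.norm_real, Real.norm_of_nonneg hs.le]
    have hsum := Loop.summable_of_hasValue (hev ((min ρ δ' / 2 : ℝ) : ℂ) (hn.symm ▸ hs)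
      (hn.symm ▸ half_lt_self hm))
    rw [hn] at hsum
    -- So far the value of the derivative is known only near `0`. It is holomorphic in `z` wherever
    -- `r` is, and it has at most a simple pole since it comes from a series in `step 1`. Hence its
    -- expansion converges to it up to radius `R`.
    refine Loop.hasValue_of_eventually (F := fun z =>
      laxDeriv x.2.2 (r (x.1, z)) (baseDeriv r x.1 z) v) (R := R) (fun z h0 h1 => ?_)
      (C := min ρ δ' / 2 * ∑' k : ℤ, ‖coords g ((Loop.step 1 hρ (Γ' (coords _ v))).1 k)‖
        * (min ρ δ' / 2) ^ k) ?_ (eventually_punctured_of_forall hm hev) h0 h1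
    · have ha : AnalyticAt ℂ (laxCoords r) (coords _ x, z) :=
        HolAt.analyticAt_laxCoords (by
          rw [LinearEquiv.symm_apply_apply]; exact hR z h0 h1)
      -- A partial derivative of the jointly analytic `laxCoords` is again analytic in `z`.
      have h3 : DifferentiableAt ℂ (fun z => fderiv ℂ (laxCoords r) (coords _ x, z)
          (coords _ v, 0)) z := by
        have h4 := DifferentiableAt.comp (g := fderiv ℂ (laxCoords r))
          (f := fun z => (coords (Phase H) x, z)) z ha.fderiv.differentiableAt
          ((differentiableAt_const _).prodMk differentiableAt_id)
        exact h4.clm_apply (differentiableAt_const _)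
      refine h3.congr_of_eventuallyEq ?_
      have hopen : IsOpen {z : ℂ | 0 < ‖z‖ ∧ ‖z‖ < R} :=
        (isOpen_lt continuous_const continuous_norm).inter
          (isOpen_lt continuous_norm continuous_const)
      filter_upwards [hopen.mem_nhds ⟨h0, h1⟩] with u hu
      have hu' := hR u hu.1 hu.2
      have ha' : AnalyticAt ℂ (laxCoords r) (coords _ x, u) :=
        HolAt.analyticAt_laxCoords (by rw [LinearEquiv.symm_apply_apply]; exact hu')
      rw [← hu'.fderiv_laxCoords]
      have h5 : HasFDerivAt (fun y => laxCoords r (y, u)) _ (coords (Phase H) x) :=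
        HasFDerivAt.comp (g := laxCoords r) (f := fun y => (y, u)) (coords (Phase H) x)
          ha'.differentiableAt.hasFDerivAt (hasFDerivAt_prodMk_left _ u)
      rw [h5.fderiv]
      simp
    · refine eventually_punctured_of_forall hs fun z h0 h1 => ?_
      exact Loop.norm_smul_coords_le (fun n hn => Loop.step_apply_of_lt hρ _ hn) hsum h0 h1.le
        (hev z h0 (h1.trans (half_lt_self hm)))

end LaxMap

/-! ### Hamiltonian vectors and velocities. -/

section Hamiltonian

variable {g : Type*} [LieRing g] [LieAlgebra ℂ g] [FiniteDimensional ℂ g]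
  {H : LieSubalgebra ℂ g}

/-- `df` is only a directional differential. Smoothness supplies a Fréchet derivative on each step,
and the two agree along lines. -/
theorem Loop.Smooth.fderiv_step {V : Type*} [AddCommGroup V] [Module ℂ V] [FiniteDimensional ℂ V]
    {f : Loop V → ℂ} {df : Loop V → Loop (Module.Dual ℂ V)} (hf : Loop.Smooth f)
    (hdf : Loop.IsDifferential f df) (N : ℕ) {ρ : ℝ} (hρ : 0 < ρ) (x y : SeqSpace V) :
    fderiv ℂ (fun x : SeqSpace V => f (Loop.step N hρ x)) x y
      = Loop.pairing (df (Loop.step N hρ x)) (Loop.step N hρ y) := by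
  have h1 : DifferentiableAt ℂ (fun x : SeqSpace V => f (Loop.step N hρ x)) x :=
    ((hf N ρ hρ).differentiable (by simp)).differentiableAt
  have h2 : HasDerivAt (fun s : ℂ => x + s • y) y 0 := by
    simpa using ((hasDerivAt_id (0 : ℂ)).smul_const y).const_add x
  have h3 := HasFDerivAt.comp_hasDerivAt_of_eq (0 : ℂ) h1.hasFDerivAt h2 (by simp)
  refine h3.unique ?_
  have e : (fun x : SeqSpace V => f (Loop.step N hρ x)) ∘ (fun s : ℂ => x + s • y)
      = fun s : ℂ => f (Loop.step N hρ x + s • Loop.step N hρ y) := by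
    funext s
    simp only [Function.comp_apply, Loop.step_add_smul]
  rw [e]
  exact hdf _ _

/-- The Poisson bracket with a linear function is the derivative along a vector. -/
theorem exists_hamiltonian_vector (l : Module.Dual ℂ (Phase H)) (x : Phase H) :
    ∃ X : Phase H, ∀ m : Module.Dual ℂ (Phase H), poisson l m x = m X := by
  let T : Module.Dual ℂ (Module.Dual ℂ (Phase H)) :=
    { toFun := fun m => poisson l m x
      map_add' := fun m m' => by
        simp only [poisson, dP, dQ, gradXi, dirDeriv_dual, LinearMap.add_apply, add_smul, mul_add,
          Finset.sum_add_distrib, lie_add, map_add, Finset.sum_sub_distrib]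
        ring
      map_smul' := fun c m => by
        simp only [poisson, dP, dQ, gradXi, dirDeriv_dual, LinearMap.smul_apply, smul_eq_mul,
          mul_smul, ← Finset.smul_sum, lie_smul, map_smul, RingHom.id_apply, mul_add,
          Finset.mul_sum]
        congr 1
        refine Finset.sum_congr rfl fun i _ => ?_
        ring }
  -- Reflexivity: a linear functional on linear functions is evaluation at a vector.
  obtain ⟨X, hX⟩ := (Module.evalEquiv ℂ (Phase H)).surjective T
  refine ⟨X, fun m => ?_⟩
  have := LinearMap.congr_fun hX m
  exact this.symm

theorem poisson_eq_of_dirDeriv_eq {l : Module.Dual ℂ (Phase H)} {x X : Phase H}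
    (hX : ∀ m : Module.Dual ℂ (Phase H), poisson l m x = m X) {F : Phase H → ℂ}
    (m : Module.Dual ℂ (Phase H)) (hF : ∀ v, dirDeriv F x v = m v) :
    poisson l F x = dirDeriv F x X := by
  rw [hF, ← hX]
  exact poisson_congr (fun _ => rfl) fun v => (hF v).trans (dirDeriv_dual _ _ _).symm

/-- The velocity of a solution of Hamilton's equations. -/
theorem SatisfiesHamiltonAt.exists_velocity {F : Phase H → ℂ} {φ : ℝ → Phase H} {t : ℝ}
    (h : SatisfiesHamiltonAt F φ t) :
    ∃ v : Phase H, HasDerivAt (fun s => coords (Phase H) (φ s)) (coords (Phase H) v) t ∧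
      ∀ l : Module.Dual ℂ (Phase H), l v = poisson l F (φ t) := by
  set d : Fin (Module.finrank ℂ (Phase H)) → ℂ := fun i =>
    poisson (LinearMap.proj i ∘ₗ (coords (Phase H)).toLinearMap : Module.Dual ℂ (Phase H)) F (φ t)
    with hd
  have h1 : HasDerivAt (fun s => coords (Phase H) (φ s)) d t :=
    hasDerivAt_pi.mpr fun i => h (LinearMap.proj i ∘ₗ (coords (Phase H)).toLinearMap)
  refine ⟨(coords (Phase H)).symm d, by rwa [LinearEquiv.apply_symm_apply], fun l => ?_⟩
  have h2 := ((coordsCLM l).hasFDerivAt.restrictScalars ℝ).comp_hasDerivAt t h1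
  have h3 := h l
  have e : coordsCLM l ∘ (fun s => coords (Phase H) (φ s)) = fun s => l (φ s) := by
    funext s
    simp
  rw [e] at h2
  exact h2.unique h3

end Hamiltonian

/-! ### The differential of the Hamiltonian `f ∘ L`. -/

section LaxHamiltonian

variable {g : Type*} [LieRing g] [LieAlgebra ℂ g] [FiniteDimensional ℂ g]
  {H : LieSubalgebra ℂ g} {r : Module.Dual ℂ H × ℂ → g ⊗[ℂ] g}
  {f : Loop g → ℂ} {df : Loop g → Loop (Module.Dual ℂ g)}

theorem hasFDerivAt_comp_lax (hf : Loop.Smooth f) {x : Phase H} {ρ : ℝ} {hρ : 0 < ρ}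
    {Γ : (Fin (Module.finrank ℂ (Phase H)) → ℂ) → SeqSpace g}
    {Γ' : (Fin (Module.finrank ℂ (Phase H)) → ℂ) →L[ℂ] SeqSpace g}
    (hΓ : HasFDerivAt Γ Γ' (coords _ x))
    (hlax : ∀ᶠ y in 𝓝 (coords _ x), Loop.step 1 hρ (Γ y) = lax r ((coords (Phase H)).symm y)) :
    HasFDerivAt (fun c => f (lax r ((coords (Phase H)).symm c)))
      ((fderiv ℂ (fun x : SeqSpace g => f (Loop.step 1 hρ x)) (Γ (coords _ x))).comp Γ')
      (coords (Phase H) x) := by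
  have h1 : DifferentiableAt ℂ (fun x : SeqSpace g => f (Loop.step 1 hρ x)) (Γ (coords _ x)) :=
    ((hf 1 ρ hρ).differentiable (by simp)).differentiableAt
  refine (HasFDerivAt.comp (g := fun x : SeqSpace g => f (Loop.step 1 hρ x)) (coords (Phase H) x)
    h1.hasFDerivAt hΓ).congr_of_eventuallyEq ?_
  filter_upwards [hlax] with y hy
  simp only [Function.comp_apply, hy]

/-- The chain rule through a step. Linearity in `v` is recorded because it allows the Poisson
bracket with `f ∘ L` to be rewritten as a derivative along a Hamiltonian vector. -/
theorem exists_dual_dirDeriv_comp_lax (hf : Loop.Smooth f) (hdf : Loop.IsDifferential f df)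
    {x : Phase H} {ρ : ℝ} {hρ : 0 < ρ} {Γ : (Fin (Module.finrank ℂ (Phase H)) → ℂ) → SeqSpace g}
    {Γ' : (Fin (Module.finrank ℂ (Phase H)) → ℂ) →L[ℂ] SeqSpace g}
    (hΓ : HasFDerivAt Γ Γ' (coords _ x))
    (hlax : ∀ᶠ y in 𝓝 (coords _ x), Loop.step 1 hρ (Γ y) = lax r ((coords (Phase H)).symm y)) :
    ∃ m : Module.Dual ℂ (Phase H), ∀ v, dirDeriv (fun y => f (lax r y)) x v = m v ∧
      m v = Loop.pairing (df (lax r x)) (Loop.step 1 hρ (Γ' (coords _ v))) := by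
  have h0 : Loop.step 1 hρ (Γ (coords _ x)) = lax r x := by
    have := hlax.self_of_nhds
    rwa [LinearEquiv.symm_apply_apply] at this
  have h1 := hasFDerivAt_comp_lax hf hΓ hlax
  set L := (fderiv ℂ (fun x : SeqSpace g => f (Loop.step 1 hρ x)) (Γ (coords _ x))).comp Γ' with hL
  refine ⟨L.toLinearMap ∘ₗ (coords (Phase H)).toLinearMap, fun v => ⟨?_, ?_⟩⟩
  · have h2 : HasDerivAt (fun s : ℂ => coords (Phase H) x + s • coords (Phase H) v)
        (coords (Phase H) v) 0 := by
      simpa using ((hasDerivAt_id (0 : ℂ)).smul_const (coords (Phase H) v)).const_add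
        (coords (Phase H) x)
    have h3 := HasFDerivAt.comp_hasDerivAt_of_eq (0 : ℂ) h1 h2 (by simp)
    have e : (fun c => f (lax r ((coords (Phase H)).symm c))) ∘
        (fun s : ℂ => coords (Phase H) x + s • coords (Phase H) v)
          = fun s : ℂ => f (lax r (x + s • v)) := by
      funext s
      simp [← map_smul, ← map_add]
    rw [e] at h3
    exact h3.deriv
  · rw [← h0, ← hf.fderiv_step hdf]
    rfl

/-- The radius `σ` is free below `ρ`; it will be taken smaller than `|z|`, so that the contour
avoids the pole `w = z`. -/
theorem dirDeriv_comp_lax_eq_circleIntegral {F : Phase H → ℂ} {x v : Phase H}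
    {M : Loop (Module.Dual ℂ g)} {Y : Loop g} (hF : dirDeriv F x v = Loop.pairing M Y)
    {ρ σ : ℝ} (hY : ∀ z : ℂ, 0 < ‖z‖ → ‖z‖ < ρ → Y.HasValue z
      (laxDeriv x.2.2 (r (x.1, z)) (baseDeriv r x.1 z) v))
    (hM : ConvergesOn M.1 ρ) (hσ : 0 < σ) (hσρ : σ < ρ) :
    dirDeriv F x v = (2 * Real.pi * Complex.I : ℂ)⁻¹ * ∮ w in C(0, σ),
      M.eval w (laxDeriv x.2.2 (r (x.1, w)) (baseDeriv r x.1 w) v) := by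
  have hn : ‖(σ : ℂ)‖ = σ := by rw [Complex.norm_real, Real.norm_of_nonneg hσ.le]
  have hs := Loop.summable_of_hasValue (hY σ (hn.symm ▸ hσ) (hn.symm ▸ hσρ))
  rw [hn] at hs
  rw [hF, Loop.pairing_eq_circleIntegral M Y hσ (hM σ hσ hσρ) hs]
  congr 1
  refine circleIntegral.integral_congr hσ.le fun w hw => ?_
  have hw' := mem_sphere_zero_iff_norm.mp hw
  rw [(hY w (hw' ▸ hσ) (hw' ▸ hσρ)).eval_eq]

end LaxHamiltonian

/-! ### The operator `R` through integrals over smaller circles. -/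

section OperatorR

open Complex Metric

variable {g : Type*} [LieRing g] [LieAlgebra ℂ g] [FiniteDimensional ℂ g]
  {H : LieSubalgebra ℂ g} {r : Module.Dual ℂ H × ℂ → g ⊗[ℂ] g}

theorem ConvergesOn.differentiableAt_eval {V : Type*} [AddCommGroup V] [Module ℂ V]
    [FiniteDimensional ℂ V] {M : Loop V} {ρ : ℝ} (hM : ConvergesOn M.1 ρ) {w : ℂ}
    (h0 : 0 < ‖w‖) (h1 : ‖w‖ < ρ) : DifferentiableAt ℂ (fun w => coords V (M.eval w)) w :=
  laurent_differentiableAt (c := fun n => coords V (M.1 n)) hM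
    (fun z h0 h1 => Loop.hasValue_eval (hM ‖z‖ h0 h1)) h0 h1

theorem HolAt.differentiableAt_spectral {q : Module.Dual ℂ H} {z : ℂ} (h : HolAt r (q, z)) :
    DifferentiableAt ℂ (fun z => coords (g ⊗[ℂ] g) (r (q, z))) z := by
  have h1 := DifferentiableAt.comp (g := rCoords r) (f := fun z => (coords (Module.Dual ℂ H) q, z))
    z h.analyticAt_rCoords_coords.differentiableAt
    ((differentiableAt_const _).prodMk differentiableAt_id)
  simpa [Function.comp_def, rCoords] using h1

/-- `(2πi)⁻¹ ∮ ⟨M(w) ⊗ 1, s(w)⟩ dw` over the circle `|w| = σ`. -/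
noncomputable def contrIntegral (M : Loop (Module.Dual ℂ g)) (s : ℂ → g ⊗[ℂ] g) (σ : ℝ) : g :=
  (coords g).symm ((2 * Real.pi * I : ℂ)⁻¹ • ∮ w in C(0, σ), coords g (contrFst (M.eval w) (s w)))

/-- Near `0` the definition of `baseDomain` gives a punctured disc common to all nearby `q'`. What
remains below `R'` lies in a compact annulus of regular points, where openness is uniform. -/
theorem RegularBelow.eventually {q : Module.Dual ℂ H} {R R' : ℝ} (hq : q ∈ baseDomain r)
    (h : RegularBelow r q R) (hR : R' < R) :
    ∀ᶠ c in 𝓝 (coords (Module.Dual ℂ H) q),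
      RegularBelow r ((coords (Module.Dual ℂ H)).symm c) R' := by
  obtain ⟨δ, hδ, hδ'⟩ := hq
  have hK : IsCompact (closedBall (0 : ℂ) R' \ ball 0 (δ / 2)) :=
    (isCompact_closedBall 0 R').diff isOpen_ball
  have h1 : ∀ᶠ c in 𝓝 (coords (Module.Dual ℂ H) q), ∀ u ∈ closedBall (0 : ℂ) R' \ ball 0 (δ / 2),
      HolAt r ((coords (Module.Dual ℂ H)).symm c, u) := by
    refine hK.eventually_forall_of_forall_eventually fun u hu => ?_
    have hu1 : ‖u‖ ≤ R' := by simpa using hu.1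
    have hu2 : δ / 2 ≤ ‖u‖ := by simpa using hu.2
    exact (h u ((half_pos hδ).trans_le hu2) (hu1.trans_lt hR)).eventually
  filter_upwards [hδ', h1] with c hc1 hc2 u h0 hu
  rcases lt_or_ge ‖u‖ (δ / 2) with hlt | hge
  · exact hc1 u h0 (hlt.trans (half_lt_self hδ))
  · exact hc2 u ⟨by simpa using hu.le, by simpa using hge⟩

/-- The principal value defining `R` in terms of the integral over a smaller circle. -/
theorem IsDynamicalRMatrix.hasValueR [LieAlgebra.IsSimple ℂ g] (hr : IsDynamicalRMatrix H r)
    {q : Module.Dual ℂ H} (hq : q ∈ baseDomain r) {M : Loop (Module.Dual ℂ g)} {ρ σ : ℝ} {z : ℂ}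
    (hreg : RegularBelow r q (ρ + ‖z‖)) (hM : ConvergesOn M.1 ρ) (hzρ : ‖z‖ < ρ) (hσ : 0 < σ)
    (hσz : σ < ‖z‖) :
    HasValueR r q M z (contrIntegral M (fun w => r (q, w - z)) σ
      + (2⁻¹ : ℂ) • contrFst (M.eval z) (casimir g)) := by
  have h0 : 0 < ‖z‖ := hσ.trans hσz
  have hd : ∀ w, 0 < ‖w‖ → ‖w‖ < ρ → w ≠ z → DifferentiableAt ℂ
      (fun w => coords g (contrFst (M.eval w) (r (q, w - z)))) w := by
    intro w hw0 hw1 hwz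
    -- The argument satisfies `|w - z| ≤ |w| + |z| < ρ + |z|`, which explains the radius in `hreg`.
    have hol : HolAt r (q, w - z) := hreg (w - z) (norm_pos_iff.mpr (sub_ne_zero.mpr hwz))
      ((norm_sub_le w z).trans_lt (by linarith))
    have h1 := DifferentiableAt.comp (g := fun z => coords (g ⊗[ℂ] g) (r (q, z)))
      (f := fun w => w - z) w hol.differentiableAt_spectral (differentiableAt_id.sub_const z)
    have h2 := ((contrFstCoords g).differentiableAt.comp w
      (hM.differentiableAt_eval hw0 hw1)).clm_apply h1
    simpa only [Function.comp_def, contrFstCoords_coords] using h2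
  have hA : Tendsto (fun w => (w - z) • coords g (contrFst (M.eval w) (r (q, w - z)))) (𝓝[≠] z)
      (𝓝 (coords g (contrFst (M.eval z) (casimir g)))) := by
    have h1 : Tendsto (fun w => coords _ (M.eval w)) (𝓝[≠] z) (𝓝 (coords _ (M.eval z))) :=
      (hM.differentiableAt_eval h0 hzρ).continuousAt.tendsto.mono_left nhdsWithin_le_nhds
    have h2 : Tendsto (fun w : ℂ => w - z) (𝓝[≠] z) (𝓝[≠] 0) := by
      refine tendsto_nhdsWithin_iff.mpr ⟨?_, ?_⟩
      · have := ((continuous_id.sub continuous_const).tendsto z (X := ℂ)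
          (f := fun w : ℂ => w - z)).mono_left (nhdsWithin_le_nhds (s := {z}ᶜ))
        simpa using this
      · filter_upwards [self_mem_nhdsWithin] with w hw
        exact sub_ne_zero.mpr hw
    have h3 := (hr.residue q hq).comp h2
    have h4 := ((contrFstCoords g).isBoundedBilinearMap.continuous.tendsto
      (coords _ (M.eval z), coords _ (casimir g))).comp (h1.prodMk_nhds h3)
    simp only [Function.comp_def, map_smul, contrFstCoords_coords] at h4
    simpa only [map_smul, contrFstCoords_coords] using h4
  have key := (tendsto_circleIntegral_truncate_inner hzρ hσ hσz hd hA).const_smul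
    ((2 * Real.pi * I : ℂ)⁻¹)
  have e : coords g (contrIntegral M (fun w => r (q, w - z)) σ
      + (2⁻¹ : ℂ) • contrFst (M.eval z) (casimir g))
      = (2 * Real.pi * I : ℂ)⁻¹ • ((∮ w in C(0, σ), coords g (contrFst (M.eval w) (r (q, w - z))))
        + (Real.pi * I : ℂ) • coords g (contrFst (M.eval z) (casimir g))) := by
    rw [contrIntegral, map_add, LinearEquiv.apply_symm_apply, smul_add, smul_smul, map_smul]
    -- `(2πi)⁻¹ · πi = 1/2`: a pole on the contour counts for half its residue.
    congr 2
    have := two_pi_I_ne_zero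
    have hpi : (Real.pi : ℂ) ≠ 0 := by exact_mod_cast Real.pi_ne_zero
    field_simp
  unfold HasValueR
  rw [e]
  exact key

theorem HasValueR.opR_eq {q : Module.Dual ℂ H} {M : Loop (Module.Dual ℂ g)} {z : ℂ} {v : g}
    (h : HasValueR r q M z v) : opR r q M z = v := by
  unfold opR
  rw [Tendsto.limUnder_eq h, LinearEquiv.symm_apply_apply]

/-- The derivative with respect to `q` of the integral over a smaller circle. -/
theorem hasDerivAt_contrIntegral {q : Module.Dual ℂ H} (a : Module.Dual ℂ H)
    {M : Loop (Module.Dual ℂ g)} {ρ σ : ℝ} {z : ℂ} (hM : ConvergesOn M.1 ρ) (hσ : 0 < σ)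
    (hσρ : σ < ρ) (hreg : ∀ w : ℂ, ‖w‖ = σ → HolAt r (q, w - z)) :
    HasDerivAt (fun s : ℂ => coords g (contrIntegral M (fun w => r (q + s • a, w - z)) σ))
      (coords g (contrIntegral M (fun w => baseDeriv r q (w - z) a) σ)) 0 := by
  have hnorm : ∀ θ, ‖circleMap 0 σ θ‖ = σ := fun θ => by simp [abs_of_pos hσ]
  have hγ : Continuous fun θ => circleMap 0 σ θ - z := (continuous_circleMap 0 σ).sub continuous_const
  set K : ℝ → (Fin (Module.finrank ℂ (g ⊗[ℂ] g)) → ℂ) →L[ℂ] (Fin (Module.finrank ℂ g) → ℂ) :=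
    fun θ => (2 * Real.pi * I : ℂ)⁻¹ • deriv (circleMap 0 σ) θ •
      contrFstCoords g (coords _ (M.eval (circleMap 0 σ θ))) with hK_def
  have hMc : Continuous fun θ => coords _ (M.eval (circleMap 0 σ θ)) := by
    refine continuous_iff_continuousAt.mpr fun θ => ?_
    exact ContinuousAt.comp (g := fun w => coords (Module.Dual ℂ g) (M.eval w))
      (f := circleMap 0 σ) (hM.differentiableAt_eval (by rw [hnorm]; exact hσ)
        (by rw [hnorm]; exact hσρ)).continuousAt (continuous_circleMap 0 σ).continuousAt
  have hK : Continuous K :=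
    ((continuous_deriv_circleMap σ).smul ((contrFstCoords g).continuous.comp hMc)).const_smul
      ((2 * Real.pi * I : ℂ)⁻¹)
  have hol : ∀ θ, HolAt r (q, circleMap 0 σ θ - z) := fun θ => hreg _ (hnorm θ)
  have han : ∀ θ, AnalyticAt ℂ (rCoords r) (coords (Module.Dual ℂ H) q, circleMap 0 σ θ - z) :=
    fun θ => (hol θ).analyticAt_rCoords_coords
  have hform : ∀ u : ℂ → g ⊗[ℂ] g, coords g (contrIntegral M u σ)
      = ∫ θ in (0 : ℝ)..2 * Real.pi, K θ (coords _ (u (circleMap 0 σ θ))) := by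
    intro u
    rw [contrIntegral, LinearEquiv.apply_symm_apply, circleIntegral, ← intervalIntegral.integral_smul]
    refine intervalIntegral.integral_congr fun θ _ => ?_
    simp only [hK_def, _root_.smul_apply, contrFstCoords_coords]
  have hder := hasFDerivAt_integral_of_analyticAt (a := 0) (b := 2 * Real.pi) hγ hK han
  have hder' := hder.differentiableAt.hasFDerivAt
  have h2 : HasDerivAt (fun s : ℂ => coords (Module.Dual ℂ H) q + s • coords (Module.Dual ℂ H) a)
      (coords (Module.Dual ℂ H) a) 0 := by
    simpa using ((hasDerivAt_id (0 : ℂ)).smul_const (coords (Module.Dual ℂ H) a)).const_add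
      (coords (Module.Dual ℂ H) q)
  have h3 := HasFDerivAt.comp_hasDerivAt_of_eq (0 : ℂ) hder' h2 (by simp)
  rw [fderiv_integral_apply_of_analyticAt hγ hK han] at h3
  have e1 : (fun s : ℂ => coords g (contrIntegral M (fun w => r (q + s • a, w - z)) σ)) =
      (fun y => ∫ θ in (0 : ℝ)..2 * Real.pi, K θ (rCoords r (y, circleMap 0 σ θ - z))) ∘
        fun s : ℂ => coords (Module.Dual ℂ H) q + s • coords (Module.Dual ℂ H) a := by
    funext s
    rw [hform]
    simp [rCoords, ← map_smul, ← map_add]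
  have e2 : coords g (contrIntegral M (fun w => baseDeriv r q (w - z) a) σ)
      = ∫ θ in (0 : ℝ)..2 * Real.pi, K θ (fderiv ℂ (fun y => rCoords r (y, circleMap 0 σ θ - z))
        (coords (Module.Dual ℂ H) q) (coords (Module.Dual ℂ H) a)) := by
    rw [hform]
    simp [baseDeriv]
  rw [e1, e2]
  exact h3

end OperatorR

/-! ### The velocity of the Lax function. -/

section QuasiLax

open Complex Metric

variable {g : Type*} [LieRing g] [LieAlgebra ℂ g] [FiniteDimensional ℂ g]
  {H : LieSubalgebra ℂ g} {r : Module.Dual ℂ H × ℂ → g ⊗[ℂ] g}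

theorem HolAt.eventually_line {q : Module.Dual ℂ H} {z : ℂ} (h : HolAt r (q, z))
    (a : Module.Dual ℂ H) : ∀ᶠ s : ℂ in 𝓝 0, HolAt r (q + s • a, z) := by
  have hc : Continuous fun s : ℂ =>
      (coords (Module.Dual ℂ H) q + s • coords (Module.Dual ℂ H) a, z) :=
    (continuous_const.add (continuous_id.smul continuous_const)).prodMk continuous_const
  have h0 := hc.tendsto 0
  rw [zero_smul, add_zero] at h0
  filter_upwards [h0.eventually h.eventually] with s hs
  simpa [← map_smul, ← map_add] using hs

theorem HolAt.continuousAt_baseDeriv {q : Module.Dual ℂ H} {z : ℂ} (h : HolAt r (q, z))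
    (a : Module.Dual ℂ H) :
    ContinuousAt (fun z => coords (g ⊗[ℂ] g) (baseDeriv r q z a)) z := by
  have ha := h.analyticAt_rCoords_coords
  have hp : ContinuousAt (fun z : ℂ => (coords (Module.Dual ℂ H) q, z)) z :=
    (continuous_const.prodMk continuous_id).continuousAt
  have h1 : ContinuousAt (fun z => fderiv ℂ (rCoords r) (coords (Module.Dual ℂ H) q, z)) z :=
    ContinuousAt.comp (g := fderiv ℂ (rCoords r))
      (f := fun z : ℂ => (coords (Module.Dual ℂ H) q, z)) ha.fderiv.continuousAt hp
  have h2 : ContinuousAt (fun z => fderiv ℂ (rCoords r) (coords (Module.Dual ℂ H) q, z)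
      (coords (Module.Dual ℂ H) a, 0)) z := h1.clm_apply continuousAt_const
  refine h2.congr ?_
  filter_upwards [hp.eventually ha.eventually_analyticAt] with u hu
  have h3 : HasFDerivAt (fun y => rCoords r (y, u)) _ (coords (Module.Dual ℂ H) q) :=
    HasFDerivAt.comp (g := rCoords r) (f := fun y => (y, u)) (coords (Module.Dual ℂ H) q)
      hu.differentiableAt.hasFDerivAt (hasFDerivAt_prodMk_left _ u)
  simp [baseDeriv, h3.fderiv]

variable [LieAlgebra.IsSimple ℂ g]

/-- Unitarity holds along the whole line near `q`, since both arguments stay regular, and can be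
differentiated. -/
theorem IsDynamicalRMatrix.flipTensor_baseDeriv (hr : IsDynamicalRMatrix H r)
    {q : Module.Dual ℂ H} {z w : ℂ} (hzw : HolAt r (q, z - w)) (hwz : HolAt r (q, w - z))
    (a : Module.Dual ℂ H) :
    flipTensor (baseDeriv r q (w - z) a) = -baseDeriv r q (z - w) a := by
  have h1 := (hzw.hasDerivAt_base a).neg
  have h2 := (coordsCLM ((coords (g ⊗[ℂ] g)).toLinearMap ∘ₗ
    (TensorProduct.comm ℂ g g).toLinearMap)).hasFDerivAt.comp_hasDerivAt (0 : ℂ)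
      (hwz.hasDerivAt_base a)
  simp only [Function.comp_def, coordsCLM_coords] at h2
  refine (coords (g ⊗[ℂ] g)).injective ?_
  rw [map_neg]
  refine h2.unique (h1.congr_of_eventuallyEq ?_)
  filter_upwards [hzw.eventually_line a, hwz.eventually_line a] with s hs1 hs2
  have := congrArg (coords (g ⊗[ℂ] g)) (hr.flipTensor_eq hs1 hs2)
  rw [map_neg] at this
  exact this

/-- The contraction of the Poisson bracket relations with an invariant linear form. -/
theorem IsDynamicalRMatrix.contrSnd_laxBracket (hr : IsDynamicalRMatrix H r) (x : Phase H)
    {z w : ℂ} (hz : HolAt r (x.1, z)) (hw : HolAt r (x.1, w)) (hzw : HolAt r (x.1, z - w))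
    (hwz : HolAt r (x.1, w - z)) (ζ : Module.Dual ℂ g)
    (hζ : ∀ y : g, ζ ⁅y, laxAt r x w⁆ = 0) :
    contrSnd ζ (laxBracket x.2.2 (r (x.1, z)) (r (x.1, w)) (baseDeriv r x.1 z)
      (baseDeriv r x.1 w)) = ⁅contrFst ζ (r (x.1, w - z)), laxAt r x z⁆
        + contrFst ζ (baseDeriv r x.1 (w - z) (restrictDual H x.2.2)) := by
  -- Invariance of `ζ` removes the second slot. By unitarity, contracting the second factor of `-r(z
  -- - w)` is contracting the first factor of `r(w - z)`.
  rw [hr.laxBracket_eq x hz hw hzw, map_sub, map_neg, map_add, contrSnd_lieSlotOne,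
    contrSnd_lieSlotTwo ζ _ _ hζ, add_zero, ← contrSnd_flipTensor, ← contrSnd_flipTensor,
    hr.flipTensor_eq hzw hwz, hr.flipTensor_baseDeriv hzw hwz, map_neg, map_neg, neg_lie,
    sub_eq_add_neg]

/-- The velocity of the Lax function along the Hamiltonian flow. -/
theorem IsDynamicalRMatrix.laxDeriv_velocity_eq (hr : IsDynamicalRMatrix H r) {x v : Phase H}
    {M : Loop (Module.Dual ℂ g)} {F : Phase H → ℂ} {ρ σ : ℝ} {z : ℂ}
    (hreg : RegularBelow r x.1 (2 * ρ)) (hM : ConvergesOn M.1 ρ)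
    (hMinv : ∀ w : ℂ, 0 < ‖w‖ → ‖w‖ < ρ → ∀ y : g, M.eval w ⁅y, laxAt r x w⁆ = 0)
    (m : Module.Dual ℂ (Phase H)) (hm : ∀ u, dirDeriv F x u = m u)
    (hF : ∀ u, dirDeriv F x u = (2 * Real.pi * I : ℂ)⁻¹ * ∮ w in C(0, σ),
      M.eval w (laxDeriv x.2.2 (r (x.1, w)) (baseDeriv r x.1 w) u))
    (hv : ∀ l : Module.Dual ℂ (Phase H), l v = poisson l F x)
    (hσ : 0 < σ) (hσz : σ < ‖z‖) (hzρ : ‖z‖ < ρ) :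
    laxDeriv x.2.2 (r (x.1, z)) (baseDeriv r x.1 z) v
      = ⁅contrIntegral M (fun w => r (x.1, w - z)) σ, laxAt r x z⁆
        + contrIntegral M (fun w => baseDeriv r x.1 (w - z) (restrictDual H x.2.2)) σ := by
  have hz0 : 0 < ‖z‖ := hσ.trans hσz
  have hz : HolAt r (x.1, z) := hreg z hz0 (by linarith)
  have hws : ∀ w ∈ sphere (0 : ℂ) σ, HolAt r (x.1, w) ∧ HolAt r (x.1, z - w) ∧
      HolAt r (x.1, w - z) ∧ 0 < ‖w‖ ∧ ‖w‖ < ρ := by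
    intro w hw
    have hw' := mem_sphere_zero_iff_norm.mp hw
    have hne : 0 < ‖z - w‖ := by
      refine norm_pos_iff.mpr (sub_ne_zero.mpr ?_)
      rintro rfl
      exact hσz.ne hw'.symm
    have hlt : ‖z - w‖ < 2 * ρ := (norm_sub_le z w).trans_lt (by linarith)
    exact ⟨hreg w (by linarith) (by linarith), hreg _ hne hlt,
      hreg _ (by rwa [norm_sub_rev]) (by rwa [norm_sub_rev]), by linarith, by linarith⟩
  have hMc : ContinuousOn (fun w => coords _ (M.eval w)) (sphere 0 σ) := fun w hw =>
    (hM.differentiableAt_eval (hws w hw).2.2.2.1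
      (hws w hw).2.2.2.2).continuousAt.continuousWithinAt
  have hcont : ∀ u : ℂ → g ⊗[ℂ] g, ContinuousOn (fun w => coords _ (u w)) (sphere (0 : ℂ) σ) →
      ContinuousOn (fun w => coords g (contrFst (M.eval w) (u w))) (sphere (0 : ℂ) σ) := by
    intro u hu
    have := ((contrFstCoords g).continuous.comp_continuousOn hMc).clm_apply hu
    simpa only [Function.comp_def, contrFstCoords_coords] using this
  have c1 := hcont (fun w => r (x.1, w - z)) fun w hw => by
    have h1 := DifferentiableAt.comp (g := fun z => coords (g ⊗[ℂ] g) (r (x.1, z)))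
      (f := fun w => w - z) w (hws w hw).2.2.1.differentiableAt_spectral
      (differentiableAt_id.sub_const z)
    exact h1.continuousAt.continuousWithinAt
  have c2 := hcont (fun w => baseDeriv r x.1 (w - z) (restrictDual H x.2.2)) fun w hw => by
    exact (ContinuousAt.comp (g := fun z => coords (g ⊗[ℂ] g)
      (baseDeriv r x.1 z (restrictDual H x.2.2))) (f := fun w => w - z)
      ((hws w hw).2.2.1.continuousAt_baseDeriv _)
      (continuous_id.sub continuous_const).continuousAt).continuousWithinAt
  have key : ∀ η : Module.Dual ℂ g, η (laxDeriv x.2.2 (r (x.1, z)) (baseDeriv r x.1 z) v)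
      = η (⁅contrIntegral M (fun w => r (x.1, w - z)) σ, laxAt r x z⁆
        + contrIntegral M (fun w => baseDeriv r x.1 (w - z) (restrictDual H x.2.2)) σ) := by
    intro η
    set l : Module.Dual ℂ (Phase H) := η ∘ₗ laxDeriv x.2.2 (r (x.1, z)) (baseDeriv r x.1 z) with hl
    -- The bracket with `l` is differentiation along the fixed vector `X`, which passes under the
    -- contour integral in `hF`.
    obtain ⟨X, hX⟩ := exists_hamiltonian_vector l x
    have e1 : l v = (2 * Real.pi * I : ℂ)⁻¹ * ∮ w in C(0, σ),
        M.eval w (laxDeriv x.2.2 (r (x.1, w)) (baseDeriv r x.1 w) X) := by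
      rw [hv, poisson_eq_of_dirDeriv_eq hX m hm, hF]
    -- Bracketing with the fixed `L(z)` is linear, so in this form it can be pulled out of the
    -- integral over `w`.
    let A₀ : g →ₗ[ℂ] ℂ := -(η ∘ₗ (LieAlgebra.ad ℂ g (laxAt r x z) : g →ₗ[ℂ] g))
    have hA₀ : ∀ y, A₀ y = η ⁅y, laxAt r x z⁆ := fun y => by
      simp only [A₀, LinearMap.neg_apply, LinearMap.comp_apply, LieAlgebra.ad_apply]
      rw [← map_neg, lie_skew]
    have e2 : (∮ w in C(0, σ), M.eval w (laxDeriv x.2.2 (r (x.1, w)) (baseDeriv r x.1 w) X))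
        = ∮ w in C(0, σ), (coordsCLM A₀ (coords g (contrFst (M.eval w) (r (x.1, w - z))))
          + coordsCLM η (coords g (contrFst (M.eval w)
            (baseDeriv r x.1 (w - z) (restrictDual H x.2.2))))) := by
      refine circleIntegral.integral_congr hσ.le fun w hw => ?_
      obtain ⟨h1, h2, h3, h4, h5⟩ := hws w hw
      -- For fixed `w` the integrand is the bracket of `l` with a linear function, to which the
      -- contracted bracket relation applies.
      have h6 := hX (M.eval w ∘ₗ laxDeriv x.2.2 (r (x.1, w)) (baseDeriv r x.1 w))
      rw [hl, poisson_laxDeriv, hr.contrSnd_laxBracket x hz h1 h2 h3 _ (hMinv w h4 h5),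
        map_add, ← hA₀] at h6
      simp only [coordsCLM_coords]
      exact h6.symm
    change l v = _
    rw [e1, e2, circleIntegral.integral_add, clm_circleIntegral_comm _ hσ.le c1,
      clm_circleIntegral_comm _ hσ.le c2, map_add, ← hA₀, mul_add]
    · simp only [contrIntegral, map_smul, coordsCLM_apply, smul_eq_mul]
    · exact ((coordsCLM A₀).continuous.comp_continuousOn c1).circleIntegrable hσ.le
    · exact ((coordsCLM η).continuous.comp_continuousOn c2).circleIntegrable hσ.le
  rw [← sub_eq_zero, ← Module.forall_dual_apply_eq_zero_iff ℂ]
  intro η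
  rw [map_sub, key η, sub_self]

end QuasiLax

/-! ### Assembly of the theorem. -/

theorem theoremA {g : Type*} [LieRing g] [LieAlgebra ℂ g] [FiniteDimensional ℂ g]
    [LieAlgebra.IsSimple ℂ g] (H : LieSubalgebra ℂ g) [H.IsCartanSubalgebra]
    (r : Module.Dual ℂ H × ℂ → g ⊗[ℂ] g) (hr : IsDynamicalRMatrix H r) :
    -- the Lax map takes values in the loop algebra
    (∀ x : Phase H, x.1 ∈ baseDomain r → ∀ ρ : ℝ, RegularBelow r x.1 ρ →
      ∀ z : ℂ, 0 < ‖z‖ → ‖z‖ < ρ → (lax r x).HasValue z (laxAt r x z)) ∧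
    -- the fundamental Poisson bracket relations
    (∀ (x : Phase H) (z w : ℂ), HolAt r (x.1, z) → HolAt r (x.1, w) → HolAt r (x.1, z - w) →
      poissonTensor (fun y => laxAt r y z) (fun y => laxAt r y w) x =
          -(lieSlotOne (r (x.1, z - w)) (laxAt r x z) + lieSlotTwo (r (x.1, z - w)) (laxAt r x w))
            - derivBase r (restrictDual H x.2.2) x.1 (z - w) ∧
      (HolAt r (x.1, w - z) →
        poissonTensor (fun y => laxAt r y z) (fun y => laxAt r y w) x =
          -lieSlotOne (r (x.1, z - w)) (laxAt r x z)
            + lieSlotTwo (flipTensor (r (x.1, w - z))) (laxAt r x w)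
            - derivBase r (restrictDual H x.2.2) x.1 (z - w))) ∧
    -- the quasi-Lax equation
    (∀ (f : Loop g → ℂ) (df : Loop g → Loop (Module.Dual ℂ g)),
      Loop.Smooth f → Loop.IsDifferential f df → Loop.AdInvariant df →
      (∀ x : Phase H, x.1 ∈ baseDomain r →
        DifferentiableAt ℂ (fun c => f (lax r ((coords (Phase H)).symm c))) (coords (Phase H) x)) ∧
      ∀ (J : Set ℝ) (φ : ℝ → Phase H), IsOpen J → (∀ t ∈ J, (φ t).1 ∈ baseDomain r) →
        (∀ t ∈ J, SatisfiesHamiltonAt (fun y => f (lax r y)) φ t) →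
        ∀ t ∈ J, ∃ v : Loop g, Loop.HasDerivAtLoop (fun s => lax r (φ s)) v t ∧
          ∀ ρ : ℝ, RegularBelow r (φ t).1 (2 * ρ) → ConvergesOn (df (lax r (φ t))).1 ρ →
          ∀ z : ℂ, 0 < ‖z‖ → ‖z‖ < ρ →
            HasValueR r (φ t).1 (df (lax r (φ t))) z (opR r (φ t).1 (df (lax r (φ t))) z) ∧
            DifferentiableAt ℂ (fun s : ℂ => coords g
              (opR r ((φ t).1 + s • restrictDual H (φ t).2.2) (df (lax r (φ t))) z)) 0 ∧
            v.HasValue z (⁅opR r (φ t).1 (df (lax r (φ t))) z, laxAt r (φ t) z⁆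
                + derivOpR r (restrictDual H (φ t).2.2) (φ t).1 (df (lax r (φ t))) z)) := by
  refine ⟨fun x hx ρ hρ z h0 h1 => hr.lax_hasValue hx hρ h0 h1,
    fun x z w hz hw hzw => ⟨hr.poissonTensor_eq x hz hw hzw,
      fun hwz => hr.poissonTensor_eq_flip x hz hw hzw hwz⟩,
    fun f df hf hdf hinv => ⟨fun x hx => ?_, fun J φ _ hJ hφ t ht => ?_⟩⟩
  · obtain ⟨ρ, hρ, Γ, Γ', hΓ, hlax, -⟩ := hr.exists_hasFDerivAt_lax hx
    exact (hasFDerivAt_comp_lax hf hΓ hlax).differentiableAt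
  · have hq := hJ t ht
    obtain ⟨ρ₀, hρ₀, Γ, Γ', hΓ, hlax, hval⟩ := hr.exists_hasFDerivAt_lax hq
    obtain ⟨v, hv, hvl⟩ := (hφ t ht).exists_velocity
    have hΓt : HasDerivAt (fun s => Γ (coords _ (φ s))) (Γ' (coords _ v)) t :=
      HasFDerivAt.comp_hasDerivAt (𝕜 := ℝ) (l := Γ) (l' := Γ'.restrictScalars ℝ)
        (f := fun s => coords (Phase H) (φ s)) t (hΓ.restrictScalars ℝ) hv
    refine ⟨Loop.step 1 hρ₀ (Γ' (coords _ v)), ⟨1, ρ₀, hρ₀, fun s => Γ (coords _ (φ s)),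
      Γ' (coords _ v), ?_, rfl, hΓt⟩,
      fun ρ hreg hM z h0 h1 => ?_⟩
    · filter_upwards [hv.continuousAt.eventually hlax] with s hs
      rwa [LinearEquiv.symm_apply_apply] at hs
    · set M := df (lax r (φ t)) with hMdef
      obtain ⟨m, hm⟩ := exists_dual_dirDeriv_comp_lax hf hdf hΓ hlax
      have hρ : 0 < ρ := h0.trans h1
      have hreg' : RegularBelow r (φ t).1 ρ := fun u hu0 hu1 => hreg u hu0 (by linarith)
      have hσ : 0 < ‖z‖ / 2 := half_pos h0
      have hσz : ‖z‖ / 2 < ‖z‖ := half_lt_self h0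
      have hMinv : ∀ w : ℂ, 0 < ‖w‖ → ‖w‖ < ρ → ∀ y : g, M.eval w ⁅y, laxAt r (φ t) w⁆ = 0 := by
        intro w hw0 hw1 y
        have hL := hr.lax_hasValue hq hreg' hw0 hw1
        rw [← hL.eval_eq]
        exact hinv.eval_lie_eq_zero _ (norm_pos_iff.mp hw0) (hM _ hw0 hw1)
          (Loop.summable_of_hasValue hL) y
      have hmain := hr.laxDeriv_velocity_eq hreg hM hMinv m (fun u => (hm u).1)
        (fun u => dirDeriv_comp_lax_eq_circleIntegral ((hm u).1.trans (hm u).2)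
          (fun z hz0 hz1 => hval u ρ hreg' z hz0 hz1) hM hσ (hσz.trans h1))
        hvl hσ hσz h1
      -- Since `ρ₁ < ρ`, the radius `ρ₁ + |z|` is strictly below `2ρ`; this slack is what lets
      -- regularity persist for `q'` near `q`.
      obtain ⟨ρ₁, hzρ₁, hρ₁⟩ := exists_between h1
      have hM₁ : ConvergesOn M.1 ρ₁ := fun s hs hs1 => hM s hs (hs1.trans hρ₁)
      have hlt : ρ₁ + ‖z‖ < 2 * ρ := by linarith
      have hR := hr.hasValueR hq (fun u hu0 hu1 => hreg u hu0 (hu1.trans hlt)) hM₁ hzρ₁ hσ hσz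
      have hder := hasDerivAt_contrIntegral (q := (φ t).1) (restrictDual H (φ t).2.2) hM hσ
        (hσz.trans h1) (z := z) (r := r) fun w hw => by
          refine hreg _ (norm_pos_iff.mpr (sub_ne_zero.mpr ?_))
            ((norm_sub_le w z).trans_lt (by linarith))
          rintro rfl
          exact hσz.ne hw.symm
      have hline : Tendsto (fun s : ℂ => coords (Module.Dual ℂ H) (φ t).1
          + s • coords (Module.Dual ℂ H) (restrictDual H (φ t).2.2)) (𝓝 0)
          (𝓝 (coords (Module.Dual ℂ H) (φ t).1)) := by
        have hc : Continuous fun s : ℂ => coords (Module.Dual ℂ H) (φ t).1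
          + s • coords (Module.Dual ℂ H) (restrictDual H (φ t).2.2) :=
          continuous_const.add (continuous_id.smul continuous_const)
        have := hc.tendsto 0
        rwa [zero_smul, add_zero] at this
      have hop : HasDerivAt (fun s : ℂ => coords g
          (opR r ((φ t).1 + s • restrictDual H (φ t).2.2) M z))
          (coords g (contrIntegral M (fun w => baseDeriv r (φ t).1 (w - z)
            (restrictDual H (φ t).2.2)) (‖z‖ / 2))) 0 := by
        -- The half residue involves only `M(z)` and `Ω`, so it is constant in `q` and does not
        -- affect the derivative.
        refine (hder.add_const (coords g ((2⁻¹ : ℂ) •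
          contrFst (M.eval z) (casimir g)))).congr_of_eventuallyEq ?_
        filter_upwards [hline.eventually (baseDomain_eventually hq),
          hline.eventually (hreg.eventually hq hlt)] with s hs1 hs2
        have e : (coords (Module.Dual ℂ H)).symm (coords (Module.Dual ℂ H) (φ t).1
          + s • coords (Module.Dual ℂ H) (restrictDual H (φ t).2.2))
            = (φ t).1 + s • restrictDual H (φ t).2.2 := by simp
        rw [e] at hs1 hs2
        rw [(hr.hasValueR hs1 hs2 hM₁ hzρ₁ hσ hσz).opR_eq, map_add]
      refine ⟨by rwa [hR.opR_eq], hop.differentiableAt, ?_⟩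
      have hfin : ⁅opR r (φ t).1 M z, laxAt r (φ t) z⁆
          + derivOpR r (restrictDual H (φ t).2.2) (φ t).1 M z
          = laxDeriv (φ t).2.2 (r ((φ t).1, z)) (baseDeriv r (φ t).1 z) v := by
        -- In the commutator the half residue disappears because it commutes with `L(z)`.
        rw [hmain, hR.opR_eq, add_lie, smul_lie, lie_contrFst_casimir _ _ (hMinv z h0 h1),
          smul_zero, add_zero, derivOpR, derivZero, hop.deriv, LinearEquiv.symm_apply_apply]
      rw [hfin]
      exact hval v ρ hreg' z h0 h1
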